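/- **Setting.** All systems are finite-dimensional with distinguished bases. A *finite resource* $(\mathcal N:\omega\otimes\rho)$ is a CPTP map $\mathcal N:A^{\rm rel}A^{\rm abs}S\to AB$ (inputs: Alice's and the Source's; outputs: Alice's and Bob's; any system may be null) with a test state $\omega$ on $A^{\rm rel}$ and a source state $\rho$ on $S$. For operations with the same test and source states, $$\|\mathcal M-\mathcal N\|_{\omega\otimes\rho}=\max_{\xi}\|(\mathcal M\otimes{\rm id}_R)\xi-(\mathcal N\otimes{\rm id}_R)\xi\|_1,$$ over all states $\xi$ on $A^{\rm rel}A^{\rm abs}SR$ ($R$ an arbitrary reference) whose restriction to $A^{\rm rel}S$ is $\omega\otimes\rho$. A *depth-$\ell$ resource* is an unordered collection of $\ell$ finite resources; ${\bf S}[\cdot]$ denotes the tensor product of its components, $(\cdot)^{\otimes k}$ the componentwise tensor power, $(\cdot)^{\times k}$ the collection of $k$ copies. $(\mathcal N:\omega\otimes\rho)\overset{*}{\ge}(\mathcal N':\omega'\otimes\rho')$ means $\mathcal N'=(\mathcal D_A\otimes\mathcal D_B)\circ\mathcal N\circ(\mathcal E\otimes\mathcal I)$, where $\mathcal E$ is an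 encoding by Alice that takes every extension of $\omega'$ to an extension of $\omega$, $\mathcal D_A,\mathcal D_B$ are local decodings, and $\mathcal I$ supplies the unused source systems, $\rho$ being the product of $\rho'$ and the state of these. Resources of larger depth reduce componentwise, along an injection of components. A *protocol* ${\bf P}$ on a depth-$\ell$ resource uses each component once, in some order: Alice applies an encoding operation; before each use she applies an isometry from what she holds to the next input and an auxiliary system; at the end Alice applies an operation to what she holds, and Bob one to all he has received. It creates a finite resource with prescribed test state $\Omega$ and source state $\Theta$, where the created source system is a subsystem of the consumed ones and the remaining source systems carry their own product state. ${\bf P}$ is *$\eta$-valid* if on every extension of $\Omega\otimes\Theta$ the input to each component restricts on $A^{\rm rel}$ to a state within trace distance $\|\cdot\|_1\le\eta$ of its test state. An *asymptotic resource* is a sequence $\alpha=(\alpha_n)_{n\ge1}$ of resources of constant depth with $\alpha_n\overset{*}{\ge}\alpha_{n-1}$ for large $n$ and, for all $0<\delta<1$, $k\ge1$ and large $n$, $\alpha_{\lfloor n(1+\delta)\rfloor}\overset{*}{\ge}(\alpha_{\lfloor n/k\rfloor})^{\otimes k}\overset{*}{\ge}\alpha_{\lfloor n(1-\delta)\rfloor}$.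 Put $(\alpha+\beta)_n=(\alpha_n,\beta_n)$ (concatenation) and $(z\alpha)_n=\alpha_{\lfloor zn\rfloor}$. The units $[q\,q]$, $[q\to q]$, $[c\to c]$ are the sequences of $n$-th tensor powers of the maximally entangled two-qubit state, of the qubit identity channel from Alice to Bob, and of the completely dephasing qubit channel from Alice to Bob (all without test state). $\alpha\ge\beta$ means: for every $\delta\in(0,1)$ there is $k\ge1$ such that for every $\epsilon>0$ and all sufficiently large $n$ there is an $\epsilon$-valid protocol ${\bf P}^{(n)}$ on $(\alpha_{\lfloor n/k\rfloor})^{\times k}$ with $$\big\|{\bf P}^{(n)}[(\alpha_{\lfloor n/k\rfloor})^{\times k}]-{\bf S}[\beta_{\lfloor(1-\delta)n\rfloor}]\big\|\le\epsilon .$$ *Coherent decoupling of the output.* Let ${\bf P}$ create $b\otimes c$, where $c$ is a classical channel with input $X_1$ (Alice) and output $Y_1$ (Bob). Extend everything isometrically, keeping $X_1$ and $Y_1$ classical: the consumed channels by isometric extensions; Alice's initial and final operations, for each message $x$, by isometric extensions that may depend on $x$; Bob's decoding, an instrument with classical outcome in $Y_1$, by an isometry followed by dephasing of $Y_1$. Let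 $E$ be all environments. Then $c$ is *$\epsilon$-coherently decoupled* with respect to ${\bf P}$ if for some such extension $$\|\sigma^{X_1Y_1QE}-\sigma^{X_1Y_1}\otimes\sigma^{QE}\|_1\le\epsilon$$ for every final state $\sigma$ obtained from an input of $c$, a copy of which in the distinguished basis is kept in $X_1$, and an independent extension of the test and source states of $b$, the remaining source systems being in an arbitrary extension of their state; $Q$ consists of all other outputs and of the references of these extensions. **Theorem (Rule O).** Let $\alpha,\beta$ be asymptotic resources and $R>0$. Suppose that $\alpha\ge\beta+R\,[c\to c]$ and that the output resource $R\,[c\to c]$ is coherently decoupled, i.e. the protocols ${\bf P}^{(n)}$ in the definition of the inequality can be chosen such that in addition the created resource $(R\,[c\to c])_{\lfloor(1-\delta)n\rfloor}$ is $\epsilon$-coherently decoupled with respect to ${\bf P}^{(n)}$. Then $$\alpha\ \ge\ \beta+\tfrac R2\,[q\,q]+\tfrac R2\,[q\to q].$$ -/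

import Mathlib

open scoped Matrix ComplexOrder Kronecker

namespace QRes

/-! ### Finite quantum systems, states, trace norm -/

/-- A finite-dimensional quantum system, given by the label set of its distinguished basis.
Every system has dimension at least one; a null system is one with a single label. -/
structure Sys : Type 1 where
  /-- the labels of the distinguished basis -/
  carrier : Type
  [fintype : Fintype carrier]
  [decEq : DecidableEq carrier]
  [nonempty : Nonempty carrier]

instance : CoeSort Sys Type := ⟨Sys.carrier⟩

attribute [instance] Sys.fintype Sys.decEq Sys.nonempty

/-- A nonempty finite type, regarded as a system. -/
abbrev Sys.of (a : Type) [Fintype a] [DecidableEq a] [Nonempty a] : Sys := ⟨a⟩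

/-- Density operators: positive semidefinite, of unit trace. -/
structure IsState {a : Type} [Fintype a] (ρ : Matrix a a ℂ) : Prop where
  posSemidef : ρ.PosSemidef
  trace_eq_one : ρ.trace = 1

/-- The trace norm `tr √(X† X)`: the sum of the singular values of `X`. -/
noncomputable def traceNorm {a : Type} [Fintype a] [DecidableEq a] (X : Matrix a a ℂ) : ℝ :=
  ∑ i, √((Matrix.isHermitian_conjTranspose_mul_self X).eigenvalues i)

/-- Partial trace over the second factor. -/
def trRight {a b : Type} [Fintype b] (X : Matrix (a × b) (a × b) ℂ) : Matrix a a ℂ :=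
  Matrix.of fun i j => ∑ k, X (i, k) (j, k)

/-- Partial trace over the first factor. -/
def trLeft {a b : Type} [Fintype a] (X : Matrix (a × b) (a × b) ℂ) : Matrix b b ℂ :=
  Matrix.of fun i j => ∑ k, X (k, i) (k, j)

/-! ### Quantum operations -/

/-- A quantum operation from system `a` to system `b`: a map with a Kraus representation
`ρ ↦ ∑ K ρ K†`, `∑ K† K = 1`, i.e. a completely positive trace preserving map. -/
structure Channel (a b : Type) [Fintype a] [DecidableEq a] [Fintype b] where
  /-- the underlying map on matrices -/
  toFun : Matrix a a ℂ → Matrix b b ℂ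
  kraus : ∃ (ι : Type) (_ : Fintype ι) (K : ι → Matrix b a ℂ),
    ∑ i, (K i)ᴴ * K i = 1 ∧ ∀ X, toFun X = ∑ i, K i * X * (K i)ᴴ

namespace Channel

instance {a b : Type} [Fintype a] [DecidableEq a] [Fintype b] :
    CoeFun (Channel a b) (fun _ => Matrix a a ℂ → Matrix b b ℂ) := ⟨Channel.toFun⟩

/-- The operation with a given Kraus family. -/
def ofKraus {a b : Type} [Fintype a] [DecidableEq a] [Fintype b]
    {ι : Type} [Fintype ι] (K : ι → Matrix b a ℂ) (hK : ∑ i, (K i)ᴴ * K i = 1) :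
    Channel a b where
  toFun X := ∑ i, K i * X * (K i)ᴴ
  kraus := ⟨ι, inferInstance, K, hK, fun _ => rfl⟩

/-- Conjugation `X ↦ V X V†` by an isometry. -/
def ofIsometry {a b : Type} [Fintype a] [DecidableEq a] [Fintype b]
    (V : Matrix b a ℂ) (hV : Vᴴ * V = 1) : Channel a b where
  toFun X := V * X * Vᴴ
  kraus := ⟨Unit, inferInstance, fun _ => V, by simpa using hV, fun X => by simp⟩

/-- Composition: first `N`, then `M`. -/
def comp {a b c : Type} [Fintype a] [DecidableEq a] [Fintype b] [DecidableEq b] [Fintype c]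
    (M : Channel b c) (N : Channel a b) : Channel a c where
  toFun X := M (N X)
  kraus := by
    obtain ⟨ι, _, K, hK, hN⟩ := N.kraus
    obtain ⟨κ, _, L, hL, hM⟩ := M.kraus
    refine ⟨κ × ι, inferInstance, fun p => L p.1 * K p.2, ?_, fun X => ?_⟩
    · rw [Fintype.sum_prod_type_right]
      have h : ∀ i, ∑ j, (L j * K i)ᴴ * (L j * K i) = (K i)ᴴ * K i := by
        intro i
        have : ∀ j, (L j * K i)ᴴ * (L j * K i) = (K i)ᴴ * ((L j)ᴴ * L j) * K i := by
          intro j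
          simp only [Matrix.conjTranspose_mul, Matrix.mul_assoc]
        simp only [this]
        rw [← Matrix.sum_mul, ← Matrix.mul_sum, hL, Matrix.mul_one]
      simp only [h, hK]
    · rw [hM, hN, Fintype.sum_prod_type]
      refine Finset.sum_congr rfl fun j _ => ?_
      rw [Matrix.mul_sum, Matrix.sum_mul]
      refine Finset.sum_congr rfl fun i _ => ?_
      simp only [Matrix.conjTranspose_mul, Matrix.mul_assoc]

/-- Relabelling of basis vectors (in particular, regrouping of tensor factors). -/
def relabel {a b : Type} [Fintype a] [DecidableEq a] [Fintype b] [DecidableEq b]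
    (e : a ≃ b) : Channel a b where
  toFun X := X.submatrix e.symm e.symm
  kraus := by
    refine ⟨Unit, inferInstance,
      fun _ => (1 : Matrix b b ℂ).submatrix id e, ?_, fun X => ?_⟩
    · simp only [Finset.univ_unique, Finset.sum_singleton]
      ext i j
      simp [Matrix.mul_apply, Matrix.one_apply, eq_comm]
    · ext i j
      have h : ∀ (x : a) (k : b), (e x = k) = (x = e.symm k) := fun x k =>
        propext e.eq_symm_apply.symm
      have h' : ∀ (x : a) (k : b), (k = e x) = (x = e.symm k) := fun x k => by
        rw [← h, @eq_comm _ k]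
      simp [Matrix.mul_apply, Matrix.one_apply, h, h']

/-- The operation `N ⊗ id` on a larger system `a R`. -/
def amp {a b : Type} [Fintype a] [DecidableEq a] [Fintype b]
    (N : Channel a b) (R : Type) [Fintype R] [DecidableEq R] :
    Channel (a × R) (b × R) where
  toFun X := Matrix.of fun p q => N (Matrix.of fun i j => X (i, p.2) (j, q.2)) p.1 q.1
  kraus := by
    obtain ⟨ι, _, K, hK, hN⟩ := N.kraus
    refine ⟨ι, inferInstance, fun i => K i ⊗ₖ (1 : Matrix R R ℂ), ?_, fun X => ?_⟩
    · have : ∀ i, (K i ⊗ₖ (1 : Matrix R R ℂ))ᴴ * (K i ⊗ₖ (1 : Matrix R R ℂ))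
          = ((K i)ᴴ * K i) ⊗ₖ (1 : Matrix R R ℂ) := by
        intro i
        rw [Matrix.conjTranspose_kronecker, ← Matrix.mul_kronecker_mul]
        simp
      simp only [this]
      ext p q
      have h := congrFun (congrFun hK p.1) q.1
      simp only [Matrix.sum_apply] at h
      simp only [Matrix.sum_apply, Matrix.kroneckerMap_apply, ← Finset.sum_mul, h,
        Matrix.one_apply, Prod.ext_iff]
      by_cases h1 : p.1 = q.1 <;> by_cases h2 : p.2 = q.2 <;> simp [h1, h2]
    · ext ⟨b, r⟩ ⟨b', r'⟩
      simp only [hN, Matrix.of_apply, Matrix.sum_apply]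
      refine Finset.sum_congr rfl fun i _ => ?_
      simp [Matrix.mul_apply, Fintype.sum_prod_type, Matrix.kroneckerMap_apply,
        Matrix.one_apply, apply_ite]

/-- Parallel composition `N ⊗ M`. -/
def tensor {a b c d : Type} [Fintype a] [DecidableEq a] [Fintype b] [DecidableEq b]
    [Fintype c] [DecidableEq c] [Fintype d] [DecidableEq d]
    (N : Channel a b) (M : Channel c d) : Channel (a × c) (b × d) :=
  (relabel (Equiv.prodComm d b)).comp <| (M.amp b).comp <|
    (relabel (Equiv.prodComm b c)).comp (N.amp c)

/-- The operation `X ↦ X ⊗ ρ` appending the state `ρ`. -/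
def append (a : Type) [Fintype a] [DecidableEq a] {b : Type} [Fintype b] [DecidableEq b]
    (ρ : Matrix b b ℂ) (hρ : IsState ρ) : Channel a (a × b) where
  toFun X := X ⊗ₖ ρ
  kraus := by
    obtain ⟨m, v, hv⟩ := Matrix.posSemidef_iff_eq_sum_vecMulVec.mp hρ.posSemidef
    have htr : ∑ i, ∑ k, star (v i k) * v i k = 1 := by
      have := hρ.trace_eq_one
      rw [hv] at this
      simp only [Matrix.trace, Matrix.diag, Matrix.sum_apply, Matrix.vecMulVec_apply,
        Pi.star_apply] at this
      rw [Finset.sum_comm, ← this]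
      exact Finset.sum_congr rfl fun k _ => Finset.sum_congr rfl fun i _ => mul_comm _ _
    refine ⟨Fin m, inferInstance,
      fun i => Matrix.of fun p j => if p.1 = j then v i p.2 else 0, ?_, fun X => ?_⟩
    · ext j j'
      simp only [Matrix.sum_apply, Matrix.mul_apply, Matrix.conjTranspose_apply,
        Matrix.of_apply, Fintype.sum_prod_type, Matrix.one_apply]
      by_cases h : j = j'
      · subst h
        simpa [apply_ite] using htr
      · simp [h, Ne.symm h, apply_ite]
    · ext ⟨p, k⟩ ⟨q, l⟩
      rw [hv]
      simp only [Matrix.kroneckerMap_apply, Matrix.sum_apply, Matrix.vecMulVec_apply,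
        Matrix.mul_apply, Matrix.conjTranspose_apply, Matrix.of_apply, Pi.star_apply,
        Finset.mul_sum]
      refine Finset.sum_congr rfl fun i _ => ?_
      simp [apply_ite]
      ring

/-- The perfect classical channel (completely dephasing operation) on the system `a`,
with Kraus operators `|x⟩⟨x|`. -/
def dephase (a : Type) [Fintype a] [DecidableEq a] : Channel a a :=
  ofKraus (fun x : a => Matrix.single x x (1 : ℂ)) (by
    ext i j
    have h : ∀ x : a, (Matrix.single x x (1 : ℂ))ᴴ * Matrix.single x x (1 : ℂ)
        = Matrix.single x x 1 := by
      intro x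
      simp
    simp only [h, Matrix.sum_apply, Matrix.single_apply, Matrix.one_apply]
    by_cases hij : i = j
    · subst hij
      simp
    · have : ∀ x : a, ¬(x = i ∧ x = j) := fun x hx => hij (hx.1.symm.trans hx.2)
      simp [hij, this])

end Channel

theorem IsState.kronecker {a b : Type} [Fintype a] [Fintype b]
    {ρ : Matrix a a ℂ} {σ : Matrix b b ℂ} (hρ : IsState ρ) (hσ : IsState σ) :
    IsState (ρ ⊗ₖ σ) :=
  ⟨hρ.posSemidef.kronecker hσ.posSemidef, by
    rw [Matrix.trace_kronecker, hρ.trace_eq_one, hσ.trace_eq_one, one_mul]⟩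

theorem isState_one_unit : IsState (1 : Matrix Unit Unit ℂ) :=
  ⟨Matrix.PosSemidef.one, by simp⟩

/-! ### Finite resources -/

/-- The restriction to `Arel S` of a state of `(Arel Aabs) S`. -/
def testMarginal {r a s : Type} [Fintype a] (ξ : Matrix ((r × a) × s) ((r × a) × s) ℂ) :
    Matrix (r × s) (r × s) ℂ :=
  Matrix.of fun p q => ∑ k, ξ ((p.1, k), p.2) ((q.1, k), q.2)

/-- A finite (generalized) resource `(N : ω ⊗ ρ)` of depth one: an operation
`N : A' S → A B` with `A' = Arel Aabs` on Alice's side and `S` the Source's system, together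
with a test state `ω` on `Arel` and a source state `ρ` on `S`.  Any of the systems may be
null. -/
structure Resource : Type 1 where
  /-- the part of Alice's input subject to the test state -/
  Arel : Sys
  /-- the unrestricted part of Alice's input -/
  Aabs : Sys
  /-- the Source's input -/
  S : Sys
  /-- Alice's output -/
  A : Sys
  /-- Bob's output -/
  B : Sys
  /-- the operation -/
  N : Channel ((Arel × Aabs) × S) (A × B)
  /-- the test state -/
  ω : Matrix Arel Arel ℂ
  isState_ω : IsState ω
  /-- the source state -/
  ρ : Matrix S S ℂ
  isState_ρ : IsState ρ

/-- `‖M - N‖_{ω ⊗ ρ} ≤ ε`: for every reference system `R` and every state `ξ` on `Arel Aabs S R`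
which extends `ω ⊗ ρ`, the outputs of `M` and `N` are `ε`-close in trace norm. -/
def DistLE {r a s b : Type} [Fintype r] [DecidableEq r] [Fintype a] [DecidableEq a]
    [Fintype s] [DecidableEq s] [Fintype b] [DecidableEq b]
    (M N : Channel ((r × a) × s) b) (ω : Matrix r r ℂ) (ρ : Matrix s s ℂ) (ε : ℝ) : Prop :=
  ∀ (R : Sys) (ξ : Matrix (((r × a) × s) × R) (((r × a) × s) × R) ℂ), IsState ξ →
    testMarginal (trRight ξ) = ω ⊗ₖ ρ →
    traceNorm (M.amp R ξ - N.amp R ξ) ≤ ε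

/-- Regrouping of the input systems in a tensor product of resources. -/
def tensorInEquiv (r r' a a' s s' : Type) :
    ((r × r') × (a × a')) × (s × s') ≃ ((r × a) × s) × ((r' × a') × s') where
  toFun p := (((p.1.1.1, p.1.2.1), p.2.1), ((p.1.1.2, p.1.2.2), p.2.2))
  invFun p := (((p.1.1.1, p.2.1.1), (p.1.1.2, p.2.1.2)), (p.1.2, p.2.2))
  left_inv _ := rfl
  right_inv _ := rfl

/-- The tensor product `(N₁ ⊗ N₂ : ω₁ ⊗ ω₂)` of two resources. -/
def Resource.tensor (c d : Resource) : Resource where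
  Arel := .of (c.Arel × d.Arel)
  Aabs := .of (c.Aabs × d.Aabs)
  S := .of (c.S × d.S)
  A := .of (c.A × d.A)
  B := .of (c.B × d.B)
  N := (Channel.relabel (Equiv.prodProdProdComm c.A c.B d.A d.B)).comp <|
    (c.N.tensor d.N).comp <|
      Channel.relabel (tensorInEquiv c.Arel d.Arel c.Aabs d.Aabs c.S d.S)
  ω := c.ω ⊗ₖ d.ω
  isState_ω := c.isState_ω.kronecker d.isState_ω
  ρ := c.ρ ⊗ₖ d.ρ
  isState_ρ := c.isState_ρ.kronecker d.isState_ρ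

/-- The trivial resource, on null systems. -/
def Resource.trivial : Resource where
  Arel := .of Unit
  Aabs := .of Unit
  S := .of Unit
  A := .of Unit
  B := .of Unit
  N := Channel.relabel (Equiv.prodPUnit (Unit × Unit))
  ω := 1
  isState_ω := isState_one_unit
  ρ := 1
  isState_ρ := isState_one_unit

/-- The unconstrained (absolute) resource of an operation `N : A' → A B`. -/
def Resource.proper {a a' b : Type} [Fintype a'] [DecidableEq a'] [Nonempty a']
    [Fintype a] [DecidableEq a] [Nonempty a] [Fintype b] [DecidableEq b] [Nonempty b]
    (N : Channel a' (a × b)) : Resource where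
  Arel := .of Unit
  Aabs := .of a'
  S := .of Unit
  A := .of a
  B := .of b
  N := N.comp (Channel.relabel ((Equiv.prodPUnit (Unit × a')).trans (Equiv.punitProd a')))
  ω := 1
  isState_ω := isState_one_unit
  ρ := 1
  isState_ρ := isState_one_unit

/-- The state vector of `|Φ₂⟩ = (|00⟩ + |11⟩)/√2`, as an isometry from a null system. -/
noncomputable def ebitVec : Matrix (Fin 2 × Fin 2) Unit ℂ :=
  Matrix.of fun p _ => if p.1 = p.2 then ((√2 : ℝ) : ℂ)⁻¹ else 0

theorem ebitVec_isometry : ebitVecᴴ * ebitVec = 1 := by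
  ext i j
  have h : (((√2 : ℝ) : ℂ)⁻¹) * ((√2 : ℝ) : ℂ)⁻¹ = 2⁻¹ := by
    rw [← mul_inv, ← Complex.ofReal_mul, Real.mul_self_sqrt (by norm_num)]
    norm_num
  simp [ebitVec, Matrix.mul_apply, Fintype.sum_prod_type, h]

/-- The maximally entangled state `Φ₂` shared by Alice and Bob. -/
noncomputable def ebitRes : Resource :=
  Resource.proper (Channel.ofIsometry ebitVec ebitVec_isometry)

/-- The perfect qubit channel `id₂ : A' → B`. -/
def qubitRes : Resource :=
  Resource.proper (Channel.relabel (Equiv.punitProd (Fin 2)).symm)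

/-- The perfect classical bit channel from Alice to Bob, i.e. the dephased `id₂`. -/
def cbitRes : Resource :=
  Resource.proper
    ((Channel.relabel (Equiv.punitProd (Fin 2)).symm).comp (Channel.dephase (Fin 2)))

/-- A finite resource of arbitrary depth is a collection of depth-one resources; the order
is immaterial in what follows, since a protocol may use the components in any order. -/
abbrev Depth := List Resource

/-- The depth-one resource obtained by the standard protocol: the tensor product of all
components. -/
def flatten : Depth → Resource
  | [] => Resource.trivial
  | r :: l => r.tensor (flatten l)

/-- `r^{⊗ k}` for a depth-one resource. -/
def Resource.tpow (r : Resource) (k : ℕ) : Resource := flatten (List.replicate k r)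

/-- Componentwise tensor power of a resource. -/
def tpow (l : Depth) (k : ℕ) : Depth := l.map fun r => r.tpow k

/-- `k` copies `l^{× k}` of a resource, available for sequential use. -/
def copies (k : ℕ) (l : Depth) : Depth := (List.replicate k l).flatten

/-- Reduction of depth-one resources: `r` simulates `r'` by one encoding by Alice and local
decodings by Alice and Bob.  The source system of `r'` is a subsystem of that of `r`; the
complementary source system carries its own (product) source state `τ`.  The encoding has to map
every extension of the test state of `r'` to an extension of the test state of `r`. -/
def Resource.Reduces (r r' : Resource) : Prop :=
  ∃ (E : Channel (r'.Arel × r'.Aabs) (r.Arel × r.Aabs)) (DA : Channel r.A r'.A)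
    (DB : Channel r.B r'.B) (T : Sys) (e : r'.S × T ≃ r.S) (τ : Matrix T T ℂ) (hτ : IsState τ),
    r.ρ = (r'.ρ ⊗ₖ τ).submatrix e.symm e.symm ∧
    (∀ ξ, IsState ξ → trRight ξ = r'.ω → trRight (E ξ) = r.ω) ∧
    r'.N = ((DA.tensor DB).comp r.N).comp
      (E.tensor ((Channel.relabel e).comp (Channel.append r'.S τ hτ)))

/-- Reduction of resources of arbitrary depth: distinct components of `l` reduce to the
components of `l'`. -/
def Reduces (l l' : Depth) : Prop :=
  ∃ f : Fin l'.length → Fin l.length, Function.Injective f ∧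
    ∀ i, (l.get (f i)).Reduces (l'.get i)

/-! ### Protocols -/

/-- The joint source system of a list of resources. -/
def srcSys : Depth → Sys
  | [] => .of Unit
  | r :: l => .of (r.S × srcSys l)

/-- The joint source state of a list of resources. -/
def srcState : (l : Depth) → Matrix (srcSys l) (srcSys l) ℂ
  | [] => (1 : Matrix Unit Unit ℂ)
  | r :: l => r.ρ ⊗ₖ srcState l

/-- The joint output system of Bob of a list of resources. -/
def bobSys : Depth → Sys
  | [] => .of Unit
  | r :: l => .of (r.B × bobSys l)

/-- The successive uses of the resources in the list, in this order.  Alice starts with memory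
`M`; before each use she applies an isometry from her current memory to the input `Arel Aabs`
of the next resource and an auxiliary system `X`; after it she holds its output `A` and `X`.
At the end her memory is `M'`. -/
inductive Steps : Depth → Sys → Sys → Type 1
  | done (M : Sys) : Steps [] M M
  | use (r : Resource) (l : Depth) (M M' X : Sys)
      (V : Matrix ((r.Arel × r.Aabs) × X) M ℂ) (hV : Vᴴ * V = 1)
      (rest : Steps l (.of (r.A × X)) M') : Steps (r :: l) M M'

/-- Regrouping before a use of a resource. -/
def preEquiv (a x s t : Type) : (a × x) × (s × t) ≃ (a × s) × (x × t) :=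
  Equiv.prodProdProdComm a x s t

/-- Regrouping after a use of a resource. -/
def postEquiv (a b x t : Type) : (a × b) × (x × t) ≃ ((a × x) × t) × b where
  toFun p := (((p.1.1, p.2.1), p.2.2), p.1.2)
  invFun p := ((p.1.1.1, p.2), (p.1.1.2, p.1.2))
  left_inv _ := rfl
  right_inv _ := rfl

/-- Regrouping of Bob's outputs. -/
def bobEquiv (m b t : Type) : (m × t) × b ≃ m × (b × t) where
  toFun p := (p.1.1, (p.2, p.1.2))
  invFun p := ((p.1, p.2.2), p.2.1)
  left_inv _ := rfl
  right_inv _ := rfl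

/-- Alice's isometry before the first use, with the inputs of that use regrouped. -/
def stepPre (r : Resource) (M X T : Sys) (V : Matrix ((r.Arel × r.Aabs) × X) M ℂ)
    (hV : Vᴴ * V = 1) :
    Channel (M × (r.S × T)) (((r.Arel × r.Aabs) × r.S) × (X × T)) :=
  (Channel.relabel (preEquiv (r.Arel × r.Aabs) X r.S T)).comp
    ((Channel.ofIsometry V hV).amp (r.S × T))

/-- The use of the resource, with the outputs regrouped. -/
def stepUse (r : Resource) (X T : Sys) :
    Channel (((r.Arel × r.Aabs) × r.S) × (X × T)) (((r.A × X) × T) × r.B) :=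
  (Channel.relabel (postEquiv r.A r.B X T)).comp (r.N.amp (X × T))

/-- The total operation of the successive uses, from Alice's initial memory and the source
systems to Alice's final memory and Bob's collected outputs. -/
def Steps.run : {l : Depth} → {M M' : Sys} → Steps l M M' →
    Channel (M × srcSys l) (M' × bobSys l)
  | _, _, _, .done M => Channel.relabel (Equiv.refl (M × Unit))
  | _, _, _, .use r l M M' X V hV rest =>
    (Channel.relabel (bobEquiv M' r.B (bobSys l))).comp <|
      (rest.run.amp r.B).comp <|
        (stepUse r X (srcSys l)).comp (stepPre r M X (srcSys l) V hV)

/-- The restriction of Alice's input to the system `Arel` of the resource about to be used. -/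
def relInput {r a s y : Type} [Fintype a] [Fintype s] [Fintype y]
    (ξ : Matrix (((r × a) × s) × y) (((r × a) × s) × y) ℂ) : Matrix r r ℂ :=
  trRight (trRight (trRight ξ))

/-- On the initial state `ξ` of Alice's memory and the source systems, at each use the
restriction of the input to `Arel` is `η`-close to the test state. -/
def Steps.Valid (η : ℝ) : {l : Depth} → {M M' : Sys} → Steps l M M' →
    Matrix (M × srcSys l) (M × srcSys l) ℂ → Prop
  | _, _, _, .done _ => fun _ => True
  | _, _, _, .use r l M _ X V hV rest => fun ξ =>
    traceNorm (relInput (stepPre r M X (srcSys l) V hV ξ) - r.ω) ≤ η ∧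
      rest.Valid η (trRight (stepUse r X (srcSys l) (stepPre r M X (srcSys l) V hV ξ)))

/-- A protocol consuming the resource `l` and creating a depth-one resource with the systems and
the test and source states of `t`: an order in which the components are used, Alice's initial
encoding, her isometries in between, her final operation, and Bob's decoding of everything he
has received.  The source system of `t` is a subsystem of the joint source system of `l`; the
complementary source system `T` carries its own (product) source state `τ`. -/
structure Protocol (l : Depth) (t : Resource) where
  /-- the components in the order of their use -/
  order : Depth
  perm : order.Perm l
  /-- Alice's memory after the initial encoding -/
  M₀ : Sys
  /-- Alice's memory after the last use -/
  M₁ : Sys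
  /-- Alice's initial encoding -/
  enc : Channel (t.Arel × t.Aabs) M₀
  /-- the uses of the resources -/
  steps : Steps order M₀ M₁
  /-- Alice's final operation -/
  fin : Channel M₁ t.A
  /-- Bob's decoding -/
  dec : Channel (bobSys order) t.B
  /-- the remaining source systems -/
  T : Sys
  /-- identification of the source systems -/
  src : t.S × T ≃ srcSys order
  /-- the state of the remaining source systems -/
  τ : Matrix T T ℂ
  isState_τ : IsState τ
  src_eq : srcState order = (t.ρ ⊗ₖ τ).submatrix src.symm src.symm

namespace Protocol

variable {l : Depth} {t : Resource}

/-- The first stage: Alice's encoding; the remaining source systems are supplied. -/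
def input (P : Protocol l t) :
    Channel ((t.Arel × t.Aabs) × t.S) (P.M₀ × srcSys P.order) :=
  P.enc.tensor ((Channel.relabel P.src).comp (Channel.append t.S P.τ P.isState_τ))

/-- The operation of the created resource. -/
def op (P : Protocol l t) : Channel ((t.Arel × t.Aabs) × t.S) (t.A × t.B) :=
  (P.fin.tensor P.dec).comp (P.steps.run.comp P.input)

/-- `η`-validity: on every extension of the test and source state of the created resource,
each consumed component receives an input which restricts to a state `η`-close to its test state
(the part of the extension held by the reference does not enter, so it is left out). -/
def Valid (P : Protocol l t) (η : ℝ) : Prop :=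
  ∀ ξ : Matrix ((t.Arel × t.Aabs) × t.S) ((t.Arel × t.Aabs) × t.S) ℂ, IsState ξ →
    testMarginal ξ = t.ω ⊗ₖ t.ρ → P.steps.Valid η (P.input ξ)

/-- The created resource is `ε`-close to `t`. -/
def Accurate (P : Protocol l t) (ε : ℝ) : Prop := DistLE P.op t.N t.ω t.ρ ε

end Protocol

/-! ### Coherent decoupling of created classical communication

The created resource is `b ⊗ c`, where `c` is a classical resource with input `X₁ = Arel Aabs`
and output `Y₁ = B` (distinguished bases).  All operations are isometrically extended, while the
message `X₁` and Bob's output `Y₁` remain classical. -/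

/-- `V` is an isometric extension (Stinespring dilation) of the operation `f`, with environment
`E`. -/
def IsDilation {a b E : Type} [Fintype a] [DecidableEq a] [Fintype b] [Fintype E]
    (V : Matrix (b × E) a ℂ) (f : Matrix a a ℂ → Matrix b b ℂ) : Prop :=
  Vᴴ * V = 1 ∧ ∀ X, trRight (V * X * Vᴴ) = f X

/-- The input `|x⟩⟨x|` for `c`, together with the input `X` for `b`. -/
def msgInsert {b c : Resource} (x : c.Arel × c.Aabs)
    (X : Matrix (b.Arel × b.Aabs) (b.Arel × b.Aabs) ℂ) :
    Matrix ((b.tensor c).Arel × (b.tensor c).Aabs)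
      ((b.tensor c).Arel × (b.tensor c).Aabs) ℂ :=
  Matrix.of fun (p q : (b.Arel × c.Arel) × (b.Aabs × c.Aabs)) =>
    if (p.1.2, p.2.2) = x ∧ (q.1.2, q.2.2) = x then X (p.1.1, p.2.1) (q.1.1, q.2.1) else 0

/-- Isometric extension of a protocol creating `b ⊗ c`, the communication `c` being classical.
* Alice knows the message `x`, so that her operations are families of operations labelled by `x`
  and are extended by families of isometries `U x` and `G x`.
* `W` extends the composition of all uses of the consumed resources (with Alice's isometries in
  between), the environments of the resources being collected in `E₁`.  Extensions of this
  composition are unique up to an isometry on `E₁`.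
* Bob's decoding is an instrument with classical outcome `y` in `Y₁`: `V` extends it up to the
  final dephasing of `Y₁`. -/
structure Protocol.CohExt {l : Depth} {b c : Resource} (P : Protocol l (b.tensor c)) where
  /-- environment of Alice's encoding -/
  E₀ : Sys
  /-- environment of the consumed resources -/
  E₁ : Sys
  /-- environment of Alice's final operation -/
  E₂ : Sys
  /-- environment of Bob's decoding -/
  E₃ : Sys
  /-- extensions of Alice's encoding of the message `x` -/
  U : c.Arel × c.Aabs → Matrix (P.M₀ × E₀) (b.Arel × b.Aabs) ℂ
  isDilation_U : ∀ x, IsDilation (U x) fun X => P.enc (msgInsert x X)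
  /-- extension of the uses of the consumed resources -/
  W : Matrix ((P.M₁ × bobSys P.order) × E₁) (P.M₀ × srcSys P.order) ℂ
  isDilation_W : IsDilation W P.steps.run
  /-- extensions of Alice's final operation -/
  G : c.Arel × c.Aabs → Matrix ((b.tensor c).A × E₂) P.M₁ ℂ
  isDilation_G : ∀ x, IsDilation (G x) P.fin
  /-- extension of Bob's decoding, before the dephasing of `Y₁` -/
  V : Matrix ((b.B × c.B) × E₃) (bobSys P.order) ℂ
  isometry_V : Vᴴ * V = 1
  instrument_V : ∀ X (y : c.B) (z z' : b.B),
    trRight (V * X * Vᴴ) (z, y) (z', y) = P.dec X (z, y) (z', y)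

namespace Protocol.CohExt

/-- Regrouping of the inputs: reference systems go last. -/
def inEquiv (a s R s' T R' : Type) :
    ((a × s) × R) × ((s' × T) × R') ≃ (a × ((s × s') × T)) × (R × R') where
  toFun p := ((p.1.1.1, ((p.1.1.2, p.2.1.1), p.2.1.2)), (p.1.2, p.2.2))
  invFun p := (((p.1.1, p.1.2.1.1), p.2.1), ((p.1.2.1.2, p.1.2.2), p.2.2))
  left_inv _ := rfl
  right_inv _ := rfl

/-- Exchange of the last two of three systems. -/
def swapEquiv (a b c : Type) : (a × b) × c ≃ (a × c) × b where
  toFun p := ((p.1.1, p.2), p.1.2)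
  invFun p := ((p.1.1, p.2), p.1.2)
  left_inv _ := rfl
  right_inv _ := rfl

/-- Regrouping of the outputs: `Y₁` goes first. -/
def outEquiv (A E₂ B Y E₃ E₁ E₀ : Type) :
    ((A × E₂) × ((B × Y) × E₃)) × (E₁ × E₀) ≃ Y × ((A × B) × ((E₀ × E₁) × (E₂ × E₃))) where
  toFun p := (p.1.2.1.2, ((p.1.1.1, p.1.2.1.1), ((p.2.2, p.2.1), (p.1.1.2, p.1.2.2))))
  invFun q := (((q.2.1.1, q.2.2.2.1), ((q.2.1.2, q.1), q.2.2.2.2)), (q.2.2.1.2, q.2.2.1.1))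
  left_inv _ := rfl
  right_inv _ := rfl

variable {l : Depth} {b c : Resource} {P : Protocol l (b.tensor c)}

/-- All outputs and environments other than `Y₁`. -/
def Out (D : P.CohExt) : Sys :=
  .of (((b.tensor c).A × b.B) × ((D.E₀ × D.E₁) × (D.E₂ × D.E₃)))

/-- The extended protocol for the message `x`; all environments are kept. -/
def out (D : P.CohExt) (x : c.Arel × c.Aabs) :
    Channel ((b.Arel × b.Aabs) × srcSys P.order) (c.B × D.Out) :=
  (Channel.relabel (outEquiv (b.tensor c).A D.E₂ b.B c.B D.E₃ D.E₁ D.E₀)).comp <|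
    (((Channel.ofIsometry (D.G x) (D.isDilation_G x).1).tensor
        (Channel.ofIsometry D.V D.isometry_V)).amp (D.E₁ × D.E₀)).comp <|
      (Channel.relabel (Equiv.prodAssoc (P.M₁ × bobSys P.order) D.E₁ D.E₀)).comp <|
        ((Channel.ofIsometry D.W D.isDilation_W.1).amp D.E₀).comp <|
          (Channel.relabel (swapEquiv P.M₀ D.E₀ (srcSys P.order))).comp <|
            (Channel.ofIsometry (D.U x) (D.isDilation_U x).1).amp (srcSys P.order)

/-- The systems `Q E`: outputs other than `Y₁`, environments, and references. -/
def Rest (D : P.CohExt) (R R' : Sys) : Sys := .of (D.Out × (R × R'))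

/-- The joint state of `Y₁` (not yet dephased) and `Q E` for the message `x`, when `b` is applied
to `ξ` (with reference `R`), and the remaining source systems are in the state `ψ` (with
reference `R'`). -/
def stateOf (D : P.CohExt) (x : c.Arel × c.Aabs) {R R' : Sys}
    (ξ : Matrix (((b.Arel × b.Aabs) × b.S) × R) (((b.Arel × b.Aabs) × b.S) × R) ℂ)
    (ψ : Matrix ((c.S × P.T) × R') ((c.S × P.T) × R') ℂ) :
    Matrix (c.B × D.Rest R R') (c.B × D.Rest R R') ℂ :=
  (Channel.relabel (Equiv.prodAssoc c.B D.Out (R × R')))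
    ((D.out x).amp (R × R')
      ((Channel.relabel (((Equiv.refl (b.Arel × b.Aabs)).prodCongr P.src).prodCongr
          (Equiv.refl (R × R'))))
        ((Channel.relabel (inEquiv (b.Arel × b.Aabs) b.S R c.S P.T R')) (ξ ⊗ₖ ψ))))

/-- The state `σ` of `(X₁ Y₁) (Q E)`: the message `x` has probability `p x` and a copy of it is
kept in `X₁`; `Y₁` is dephased. -/
def sigma (D : P.CohExt) (p : c.Arel × c.Aabs → ℂ) {R R' : Sys}
    (ξ : Matrix (((b.Arel × b.Aabs) × b.S) × R) (((b.Arel × b.Aabs) × b.S) × R) ℂ)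
    (ψ : Matrix ((c.S × P.T) × R') ((c.S × P.T) × R') ℂ) :
    Matrix (((c.Arel × c.Aabs) × c.B) × D.Rest R R')
      (((c.Arel × c.Aabs) × c.B) × D.Rest R R') ℂ :=
  Matrix.of fun u v =>
    if u.1 = v.1 then p u.1.1 * D.stateOf u.1.1 ξ ψ (u.1.2, u.2) (v.1.2, v.2) else 0

end Protocol.CohExt

/-- The created classical resource `c` is `ε`-coherently decoupled with respect to the protocol
`P` creating `b ⊗ c`: in an isometric extension of `P`, the final state `σ` satisfies
`‖σ^{X₁ Y₁ Q E} - σ^{X₁ Y₁} ⊗ σ^{Q E}‖₁ ≤ ε`, for every input `μ` of `c` and every input `ξ` of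
`b` extending the test and source states.  The message is independent of the input of `b` and of
its reference `R`, and `ψ` runs over the extensions of the state of the remaining source systems;
the references `R`, `R'` belong to `Q`. -/
def Protocol.CoherentlyDecoupled {l : Depth} {b c : Resource} (P : Protocol l (b.tensor c))
    (ε : ℝ) : Prop :=
  ∃ D : P.CohExt,
    ∀ μ : Matrix (c.Arel × c.Aabs) (c.Arel × c.Aabs) ℂ, IsState μ → trRight μ = c.ω →
    ∀ (R : Sys)
      (ξ : Matrix (((b.Arel × b.Aabs) × b.S) × R) (((b.Arel × b.Aabs) × b.S) × R) ℂ),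
      IsState ξ → testMarginal (trRight ξ) = b.ω ⊗ₖ b.ρ →
    ∀ (R' : Sys) (ψ : Matrix ((c.S × P.T) × R') ((c.S × P.T) × R') ℂ),
      IsState ψ → trRight ψ = c.ρ ⊗ₖ P.τ →
    traceNorm (D.sigma (fun x => μ x x) ξ ψ -
      trRight (D.sigma (fun x => μ x x) ξ ψ) ⊗ₖ trLeft (D.sigma (fun x => μ x x) ξ ψ)) ≤ ε

/-! ### Asymptotic resources -/

/-- Sequences of finite resources, indexed by the block length `n ≥ 1` (the value at `0` is
irrelevant). -/
abbrev ResSeq := ℕ → Depth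

/-- The sequence is an asymptotic resource: it has constant depth, is eventually monotone, and
is quasi-i.i.d. -/
structure IsAsymptotic (α : ResSeq) : Prop where
  depth : ∃ d, ∀ n, 1 ≤ n → (α n).length = d
  mono : ∃ N, ∀ n, N ≤ n → Reduces (α n) (α (n - 1))
  quasi_iid : ∀ δ : ℝ, 0 < δ → δ < 1 → ∀ k : ℕ, 1 ≤ k → ∃ N, ∀ n : ℕ, N ≤ n →
    Reduces (α ⌊n * (1 + δ)⌋₊) (tpow (α (n / k)) k) ∧
    Reduces (tpow (α (n / k)) k) (α ⌊n * (1 - δ)⌋₊)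

/-- The i.i.d. resource `⟨r⟩ = (r^{⊗ n})_n`. -/
def iid (r : Resource) : ResSeq := fun n => [r.tpow n]

/-- The sum of two asymptotic resources. -/
def ResSeq.plus (α β : ResSeq) : ResSeq := fun n => α n ++ β n

/-- The multiple `z α = (α_{⌊z n⌋})_n` of an asymptotic resource. -/
noncomputable def ResSeq.scale (z : ℝ) (α : ResSeq) : ResSeq := fun n => α ⌊z * n⌋₊

/-- The ebit `[q q]`. -/
noncomputable def ebit : ResSeq := iid ebitRes

/-- The qubit `[q → q]`. -/
def qubit : ResSeq := iid qubitRes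

/-- The cbit `[c → c]`. -/
def cbit : ResSeq := iid cbitRes

/-- The asymptotic resource inequality `α ≥ β`. -/
def ResIneq (α β : ResSeq) : Prop :=
  ∀ δ : ℝ, 0 < δ → δ < 1 → ∃ k : ℕ, 1 ≤ k ∧ ∀ ε : ℝ, 0 < ε → ∃ N, ∀ n : ℕ, N ≤ n →
    ∃ P : Protocol (copies k (α (n / k))) (flatten (β ⌊(1 - δ) * n⌋₊)),
      P.Valid ε ∧ P.Accurate ε

/-- The asymptotic resource inequality `α ≥ β + γ`, in which the classical output resource `γ`
is coherently decoupled: the protocols `P` of the inequality, which create the tensor product of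
(the flattened) `β` and `γ`, are such that `γ` is `ε`-coherently decoupled with respect to `P`. -/
def ResIneqDecoupled (α β γ : ResSeq) : Prop :=
  ∀ δ : ℝ, 0 < δ → δ < 1 → ∃ k : ℕ, 1 ≤ k ∧ ∀ ε : ℝ, 0 < ε → ∃ N, ∀ n : ℕ, N ≤ n →
    ∃ P : Protocol (copies k (α (n / k)))
        ((flatten (β ⌊(1 - δ) * n⌋₊)).tensor (flatten (γ ⌊(1 - δ) * n⌋₊))),
      P.Valid ε ∧ P.Accurate ε ∧ P.CoherentlyDecoupled ε

end QRes

/-! A cbit whose transmission leaves no trace beyond Bob's outcome can be replaced by a coherent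
bit, the map `|x⟩ ↦ |x⟩|x⟩` from Alice to Alice and Bob. Two coherent bits, used with a recyclable
supply of entanglement, are worth one ebit and one qubit channel.

Making the message coherent. In the isometric extension, the final amplitudes for a fixed message
`x` split into branches according to Bob's outcome. Accuracy puts almost all the weight on the right
branch. Decoupling, applied to the equal mixture of `x` and a fixed `x₀` and tested on the final
vector for `x₀`, shows that the two right branches have overlap of modulus nearly one
(`le_norm_overlap_sq`). They therefore agree up to a phase, which might still depend on the input of
`b`. Superposing two inputs with orthogonal references averages their overlaps. Since the average
again has modulus nearly one, the parallelogram law makes the two overlaps nearly equal, so one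
phase per message serves all inputs (`exists_phase`). Alice can thus keep the message as a quantum
control and absorb the phases in her encoding (`exists_coherent`). The result is close to `b`
tensored with the coherent channel (`creates_tensor_cohRes`). The coherent channel is obtained only
relative to a maximally mixed test state: every block of the input, one for each message, has to
satisfy the test condition of `b`.

Using the coherent channel. In coherent teleportation in dimension `d`, Alice's Bell measurement is
an isometry, its outcome travels through a coherent channel of dimension `d ^ 2`, and Bob's
correction is controlled by his copy. Afterwards the two copies of the outcome are maximally
entangled and decoupled from the teleported system. With `d = 2 ^ r`, this turns `r` ebits and `2 *
r` coherent bits into `r` qubits and `2 * r` ebits. The outcome register must enter the coherent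
channel maximally mixed for every teleported state. For this Alice first applies a Weyl operator
whose label is her half of a further maximally entangled state of two `d ^ 2`-dimensional systems.
Bob undoes it with his half, so this entanglement is returned: it is a catalyst
(`weylCorrection_bellChannel`, `sum_bellChannel`).

Bootstrapping. The entanglement made by one block of the protocol serves the next, so protocols have
to be composed sequentially. `Creates.comp` does this with additive errors. Among `K` blocks one
creates `b` alone, two create the initial entanglement by sending halves of maximally entangled
states, and the remaining `K - 3` teleport; all of them contribute a copy of `b`
(`exists_creates_iterate`). As `K` depends on `δ` only, the total error tends to zero, and the three
lost rounds cost a fraction of at most `δ / 4` of the rate. The accounting is done in the ordered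
commutative monoid of resources up to mutual reduction, and the quasi-i.i.d. property of `β` turns
the `K` blocks of `β` into a longer one. -/

set_option linter.unusedSectionVars false

namespace QRes

/-! ### The Euclidean norm of vectors -/

/-- The Euclidean norm of a vector of amplitudes. -/
noncomputable def vnorm {a : Type} [Fintype a] (v : a → ℂ) : ℝ :=
  ‖(WithLp.toLp 2 v : EuclideanSpace ℂ a)‖

section vnorm

variable {a b : Type} [Fintype a] [Fintype b]

theorem vnorm_nonneg (v : a → ℂ) : 0 ≤ vnorm v := norm_nonneg _

theorem vnorm_sq (v : a → ℂ) : vnorm v ^ 2 = ∑ i, ‖v i‖ ^ 2 := by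
  rw [vnorm, EuclideanSpace.norm_sq_eq]

theorem vnorm_sq_eq_dotProduct (v : a → ℂ) : ((vnorm v ^ 2 : ℝ) : ℂ) = star v ⬝ᵥ v := by
  rw [vnorm_sq]
  push_cast
  refine Finset.sum_congr rfl fun i _ => ?_
  rw [Pi.star_apply, Complex.star_def, ← Complex.normSq_eq_conj_mul_self, Complex.normSq_eq_norm_sq]
  push_cast
  rfl

theorem vnorm_smul (c : ℂ) (v : a → ℂ) : vnorm (c • v) = ‖c‖ * vnorm v :=
  norm_smul c (WithLp.toLp 2 v : EuclideanSpace ℂ a)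

theorem norm_dotProduct_le (v w : a → ℂ) : ‖star v ⬝ᵥ w‖ ≤ vnorm v * vnorm w := by
  have := norm_inner_le_norm (𝕜 := ℂ) (WithLp.toLp 2 v : EuclideanSpace ℂ a) (WithLp.toLp 2 w)
  rwa [EuclideanSpace.inner_eq_star_dotProduct, dotProduct_comm] at this

theorem vnorm_le_of_sq_le {v : a → ℂ} {w : b → ℂ} (h : vnorm v ^ 2 ≤ vnorm w ^ 2) :
    vnorm v ≤ vnorm w :=
  le_of_sq_le_sq h (vnorm_nonneg _)

end vnorm

/-! ### Contractions and the trace norm -/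

/-- A matrix whose sesquilinear form is bounded by one. -/
def IsContraction {a b : Type} [Fintype a] [Fintype b] (M : Matrix a b ℂ) : Prop :=
  ∀ v w, ‖star v ⬝ᵥ (M *ᵥ w)‖ ≤ vnorm v * vnorm w

section traceNorm

variable {a b : Type} [Fintype a] [DecidableEq a] [Fintype b] [DecidableEq b]

theorem star_dotProduct_mulVec (M : Matrix a b ℂ) (v : a → ℂ) (w : b → ℂ) :
    star v ⬝ᵥ (M *ᵥ w) = star (Mᴴ *ᵥ v) ⬝ᵥ w := by
  rw [Matrix.star_mulVec, Matrix.conjTranspose_conjTranspose, Matrix.dotProduct_mulVec]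

theorem isContraction_of_vnorm_le {M : Matrix a b ℂ} (h : ∀ w, vnorm (M *ᵥ w) ≤ vnorm w) :
    IsContraction M := fun v w =>
  (norm_dotProduct_le _ _).trans (mul_le_mul_of_nonneg_left (h w) (vnorm_nonneg v))

theorem isContraction_of_conjTranspose {M : Matrix a b ℂ}
    (h : ∀ w, vnorm (Mᴴ *ᵥ w) ≤ vnorm w) : IsContraction M := fun v w => by
  rw [star_dotProduct_mulVec]
  exact (norm_dotProduct_le _ _).trans (mul_le_mul_of_nonneg_right (h v) (vnorm_nonneg w))

theorem vnorm_mulVec_of_isometry {V : Matrix b a ℂ} (hV : Vᴴ * V = 1) (v : a → ℂ) :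
    vnorm (V *ᵥ v) = vnorm v := by
  have : vnorm (V *ᵥ v) ^ 2 = vnorm v ^ 2 := by
    apply Complex.ofReal_injective
    rw [vnorm_sq_eq_dotProduct, vnorm_sq_eq_dotProduct, star_dotProduct_mulVec,
      Matrix.mulVec_mulVec, hV, Matrix.one_mulVec]
  exact (sq_eq_sq₀ (vnorm_nonneg _) (vnorm_nonneg _)).mp this

theorem trace_eq_sum_unitary (U X : Matrix a a ℂ) (hU : U * Uᴴ = 1) :
    X.trace = ∑ i, star (U.col i) ⬝ᵥ (X *ᵥ U.col i) := by
  have : X.trace = (Uᴴ * (X * U)).trace := by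
    rw [Matrix.trace_mul_comm, Matrix.mul_assoc, hU, Matrix.mul_one]
  rw [this]
  refine Finset.sum_congr rfl fun i _ => ?_
  simp [Matrix.mul_apply, dotProduct, Matrix.mulVec]

/-- A basis in which `X† X` is diagonal, as a unitary. -/
noncomputable def svdUnitary (X : Matrix a a ℂ) : Matrix a a ℂ :=
  (Matrix.isHermitian_conjTranspose_mul_self X).eigenvectorUnitary

theorem svdUnitary_mul (X : Matrix a a ℂ) : svdUnitary X * (svdUnitary X)ᴴ = 1 :=
  Unitary.mul_star_self_of_mem
    (Matrix.isHermitian_conjTranspose_mul_self X).eigenvectorUnitary.2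

theorem svdUnitary_mul' (X : Matrix a a ℂ) : (svdUnitary X)ᴴ * svdUnitary X = 1 :=
  Unitary.star_mul_self_of_mem
    (Matrix.isHermitian_conjTranspose_mul_self X).eigenvectorUnitary.2

theorem svdUnitary_diag (X : Matrix a a ℂ) :
    (X * svdUnitary X)ᴴ * (X * svdUnitary X) = Matrix.diagonal fun i =>
      (((Matrix.isHermitian_conjTranspose_mul_self X).eigenvalues i : ℝ) : ℂ) := by
  have h := (Matrix.isHermitian_conjTranspose_mul_self X).conjStarAlgAut_star_eigenvectorUnitary
  rw [Unitary.conjStarAlgAut_star_apply] at h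
  rw [Matrix.conjTranspose_mul]
  calc (svdUnitary X)ᴴ * Xᴴ * (X * svdUnitary X)
      = (svdUnitary X)ᴴ * (Xᴴ * X) * svdUnitary X := by simp only [Matrix.mul_assoc]
    _ = _ := h

theorem eigenvalues_eq_vnorm (X : Matrix a a ℂ) (i : a) :
    (Matrix.isHermitian_conjTranspose_mul_self X).eigenvalues i =
      vnorm (X *ᵥ (svdUnitary X).col i) ^ 2 := by
  apply Complex.ofReal_injective
  have h := congrFun (congrFun (svdUnitary_diag X) i) i
  rw [Matrix.diagonal_apply_eq] at h
  rw [← h, vnorm_sq_eq_dotProduct, Matrix.mul_apply]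
  rfl

theorem traceNorm_eq_sum_vnorm (X : Matrix a a ℂ) :
    traceNorm X = ∑ i, vnorm (X *ᵥ (svdUnitary X).col i) := by
  refine Finset.sum_congr rfl fun i _ => ?_
  rw [eigenvalues_eq_vnorm, Real.sqrt_sq (vnorm_nonneg _)]

theorem traceNorm_nonneg (X : Matrix a a ℂ) : 0 ≤ traceNorm X :=
  Finset.sum_nonneg fun _ _ => Real.sqrt_nonneg _

theorem vnorm_col_of_isometry {V : Matrix b a ℂ} (hV : Vᴴ * V = 1) (i : a) :
    vnorm (V.col i) = 1 := by
  have : vnorm (V.col i) ^ 2 = 1 := by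
    apply Complex.ofReal_injective
    have h := congrFun (congrFun hV i) i
    rw [Matrix.one_apply_eq] at h
    rw [vnorm_sq_eq_dotProduct, Complex.ofReal_one, ← h, Matrix.mul_apply]
    rfl
  nlinarith [vnorm_nonneg (V.col i)]

/-- Evaluated in the basis of right singular vectors of `X`, the trace has terms bounded by the
lengths of the images of these vectors, which are the singular values. -/
theorem norm_trace_mul_le_traceNorm {M : Matrix a a ℂ} (hM : IsContraction M)
    (X : Matrix a a ℂ) : ‖(M * X).trace‖ ≤ traceNorm X := by
  rw [trace_eq_sum_unitary (svdUnitary X) (M * X) (svdUnitary_mul X), traceNorm_eq_sum_vnorm]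
  refine (norm_sum_le _ _).trans (Finset.sum_le_sum fun i _ => ?_)
  rw [← Matrix.mulVec_mulVec]
  refine (hM _ _).trans ?_
  rw [vnorm_col_of_isometry (svdUnitary_mul' X), one_mul]

/-- The polar decomposition: the maximizer is the adjoint of the partial isometry in it, written
through the singular vectors. -/
theorem exists_contraction_trace_eq (X : Matrix a a ℂ) :
    ∃ M : Matrix a a ℂ, IsContraction M ∧ (M * X).trace = (traceNorm X : ℂ) := by
  set U := svdUnitary X with hUdef
  set ev := (Matrix.isHermitian_conjTranspose_mul_self X).eigenvalues with hev
  have hev0 : ∀ i, 0 ≤ ev i := fun i => by rw [hev, eigenvalues_eq_vnorm]; positivity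
  -- The inverse singular values; `0⁻¹ = 0` makes the maximizer vanish on the kernel of `X`, so it
  -- is a contraction without any case distinction.
  set D : Matrix a a ℂ := Matrix.diagonal fun i => (((√(ev i))⁻¹ : ℝ) : ℂ) with hD
  have hDD : Dᴴ = D := by
    rw [hD, Matrix.diagonal_conjTranspose]
    congr 1
    ext i
    simp
  refine ⟨U * (D * (X * U)ᴴ), isContraction_of_conjTranspose fun w => ?_, ?_⟩
  · apply vnorm_le_of_sq_le
    have h1 : vnorm w = vnorm (Uᴴ *ᵥ w) := by
      rw [vnorm_mulVec_of_isometry]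
      rw [Matrix.conjTranspose_conjTranspose, svdUnitary_mul]
    rw [h1]
    set u := Uᴴ *ᵥ w
    have h2 : (U * (D * (X * U)ᴴ))ᴴ *ᵥ w = (X * U) *ᵥ (D *ᵥ u) := by
      simp only [u, Matrix.mulVec_mulVec, Matrix.conjTranspose_mul, hDD,
        Matrix.conjTranspose_conjTranspose, Matrix.mul_assoc]
    rw [h2]
    have h3 : vnorm ((X * U) *ᵥ (D *ᵥ u)) ^ 2 = ∑ i, (ev i * (√(ev i))⁻¹ ^ 2) * ‖u i‖ ^ 2 := by
      apply Complex.ofReal_injective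
      rw [vnorm_sq_eq_dotProduct, star_dotProduct_mulVec, Matrix.mulVec_mulVec, svdUnitary_diag]
      push_cast
      refine Finset.sum_congr rfl fun i _ => ?_
      rw [hD, Matrix.mulVec_diagonal, Pi.star_apply, Matrix.mulVec_diagonal,
        Matrix.mulVec_diagonal, ← Complex.mul_conj']
      simp only [star_mul', Complex.star_def, Complex.conj_ofReal]
      push_cast
      ring
    rw [h3, vnorm_sq]
    refine Finset.sum_le_sum fun i _ => ?_
    have : ev i * (√(ev i))⁻¹ ^ 2 ≤ 1 := by
      rw [inv_pow, Real.sq_sqrt (hev0 i)]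
      exact mul_inv_le_one
    nlinarith [sq_nonneg ‖u i‖]
  · have h1 : (U * (D * (X * U)ᴴ) * X).trace = (D * ((X * U)ᴴ * (X * U))).trace := by
      rw [Matrix.mul_assoc, Matrix.trace_mul_comm]
      simp only [Matrix.mul_assoc]
    rw [h1, svdUnitary_diag, hD, Matrix.diagonal_mul_diagonal, Matrix.trace_diagonal, traceNorm]
    push_cast
    refine Finset.sum_congr rfl fun i _ => ?_
    have : (√(ev i))⁻¹ * ev i = √(ev i) := by
      rcases eq_or_lt_of_le (hev0 i) with h | h
      · simp [← h]
      · rw [inv_mul_eq_iff_eq_mul₀ (Real.sqrt_pos.mpr h).ne', Real.mul_self_sqrt (hev0 i)]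
    exact_mod_cast this

/-- Duality of the trace norm and the operator norm. The triangle inequality, data processing and
the estimates for rank-one operators below are derived from it, without further reference to
eigenvalues. -/
theorem traceNorm_le_iff {X : Matrix a a ℂ} {r : ℝ} :
    traceNorm X ≤ r ↔ ∀ M, IsContraction M → ‖(M * X).trace‖ ≤ r := by
  refine ⟨fun h M hM => (norm_trace_mul_le_traceNorm hM X).trans h, fun h => ?_⟩
  obtain ⟨M, hM, hMX⟩ := exists_contraction_trace_eq X
  have := h M hM
  rw [hMX, Complex.norm_real, Real.norm_of_nonneg (traceNorm_nonneg X)] at this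
  exact this

theorem traceNorm_add_le (X Y : Matrix a a ℂ) :
    traceNorm (X + Y) ≤ traceNorm X + traceNorm Y := by
  rw [traceNorm_le_iff]
  intro M hM
  rw [Matrix.mul_add, Matrix.trace_add]
  exact (norm_add_le _ _).trans (add_le_add (norm_trace_mul_le_traceNorm hM X)
    (norm_trace_mul_le_traceNorm hM Y))

theorem traceNorm_sub_le (X Y Z : Matrix a a ℂ) :
    traceNorm (X - Z) ≤ traceNorm (X - Y) + traceNorm (Y - Z) := by
  rw [← sub_add_sub_cancel X Y Z]
  exact traceNorm_add_le _ _

theorem traceNorm_zero : traceNorm (0 : Matrix a a ℂ) = 0 := by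
  refine le_antisymm (traceNorm_le_iff.mpr fun M _ => ?_) (traceNorm_nonneg _)
  simp

/-- The trace norm does not increase under `X ↦ ∑ K X K†` if `∑ K† K ≤ 1`. -/
theorem traceNorm_kraus_le {ι : Type} [Fintype ι] (K : ι → Matrix b a ℂ)
    (hK : ∀ v, ∑ i, vnorm (K i *ᵥ v) ^ 2 ≤ vnorm v ^ 2) (X : Matrix a a ℂ) :
    traceNorm (∑ i, K i * X * (K i)ᴴ) ≤ traceNorm X := by
  rw [traceNorm_le_iff]
  intro M hM
  -- Passage to the Heisenberg picture: `∑ K† M K` is again a contraction, by the Cauchy–Schwarz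
  -- inequality for the sum over `i`.
  have h1 : (M * ∑ i, K i * X * (K i)ᴴ).trace = ((∑ i, (K i)ᴴ * M * K i) * X).trace := by
    rw [Matrix.mul_sum, Matrix.sum_mul, Matrix.trace_sum, Matrix.trace_sum]
    refine Finset.sum_congr rfl fun i _ => ?_
    rw [← Matrix.mul_assoc, Matrix.trace_mul_comm]
    simp only [Matrix.mul_assoc]
  rw [h1]
  refine norm_trace_mul_le_traceNorm (fun v w => ?_) X
  rw [Matrix.sum_mulVec, dotProduct_sum]
  have h2 : ∀ i, ‖star v ⬝ᵥ (((K i)ᴴ * M * K i) *ᵥ w)‖ ≤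
      vnorm (K i *ᵥ v) * vnorm (K i *ᵥ w) := fun i => by
    rw [Matrix.mul_assoc, ← Matrix.mulVec_mulVec, star_dotProduct_mulVec,
      Matrix.conjTranspose_conjTranspose, ← Matrix.mulVec_mulVec]
    exact hM _ _
  refine (norm_sum_le _ _).trans ((Finset.sum_le_sum fun i _ => h2 i).trans ?_)
  refine abs_le_of_sq_le_sq' ?_ (mul_nonneg (vnorm_nonneg _) (vnorm_nonneg _)) |>.2
  refine (Finset.sum_mul_sq_le_sq_mul_sq _ _ _).trans ?_
  rw [mul_pow]
  exact mul_le_mul (hK v) (hK w) (Finset.sum_nonneg fun _ _ => sq_nonneg _) (sq_nonneg _)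

/-- Data processing. Every later propagation of an error through a protocol rests on it. -/
theorem Channel.traceNorm_le (N : Channel a b) (X : Matrix a a ℂ) :
    traceNorm (N X) ≤ traceNorm X := by
  obtain ⟨ι, _, K, hK, hN⟩ := N.kraus
  rw [hN]
  refine traceNorm_kraus_le K (fun v => le_of_eq ?_) X
  apply Complex.ofReal_injective
  push_cast
  have : ∀ i, ((vnorm (K i *ᵥ v) : ℝ) : ℂ) ^ 2 = star v ⬝ᵥ (((K i)ᴴ * K i) *ᵥ v) := fun i => by
    rw [← Complex.ofReal_pow, vnorm_sq_eq_dotProduct, star_dotProduct_mulVec,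
      ← Matrix.mulVec_mulVec, star_dotProduct_mulVec, Matrix.conjTranspose_conjTranspose,
      star_dotProduct_mulVec]
  simp only [this]
  rw [← dotProduct_sum, ← Matrix.sum_mulVec, hK, Matrix.one_mulVec, ← vnorm_sq_eq_dotProduct]
  push_cast
  rfl

/-- The trace norm does not increase under `X ↦ K X K†` for a contraction `K`. -/
theorem traceNorm_compress_le (K : Matrix b a ℂ) (hK : ∀ v, vnorm (K *ᵥ v) ≤ vnorm v)
    (X : Matrix a a ℂ) : traceNorm (K * X * Kᴴ) ≤ traceNorm X := by
  have := traceNorm_kraus_le (ι := Unit) (fun _ => K) (fun v => by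
    simpa using pow_le_pow_left₀ (vnorm_nonneg _) (hK v) 2) X
  simpa using this

/-- The operator `|v⟩⟨w|`. -/
def outer (v w : a → ℂ) : Matrix a a ℂ := Matrix.of fun i j => v i * star (w j)

theorem trace_mul_outer (M : Matrix a a ℂ) (v w : a → ℂ) :
    (M * outer v w).trace = star w ⬝ᵥ (M *ᵥ v) := by
  simp only [Matrix.trace, Matrix.diag, Matrix.mul_apply, outer, Matrix.of_apply, dotProduct,
    Matrix.mulVec, Pi.star_apply, Finset.mul_sum]
  exact Finset.sum_congr rfl fun i _ => Finset.sum_congr rfl fun j _ => by ring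

/-- Replacing the ket and the bra one after the other costs one factor `vnorm (v - w)` each. -/
theorem traceNorm_outer_sub_le {v w : a → ℂ} (hv : vnorm v ≤ 1) (hw : vnorm w ≤ 1) :
    traceNorm (outer v v - outer w w) ≤ 2 * vnorm (v - w) := by
  rw [traceNorm_le_iff]
  intro M hM
  have h : (M * (outer v v - outer w w)).trace =
      star v ⬝ᵥ (M *ᵥ (v - w)) + star (v - w) ⬝ᵥ (M *ᵥ w) := by
    rw [Matrix.mul_sub, Matrix.trace_sub, trace_mul_outer, trace_mul_outer, Matrix.mulVec_sub,
      dotProduct_sub, star_sub, sub_dotProduct]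
    ring
  rw [h]
  refine (norm_add_le _ _).trans ?_
  have h1 := hM v (v - w)
  have h2 := hM (v - w) w
  nlinarith [vnorm_nonneg (v - w)]

/-- The operator `|v⟩⟨v|` is a contraction, so duality applies. In this form the decoupling
condition is tested on a single vector. -/
theorem norm_dotProduct_mulVec_le_traceNorm (X : Matrix a a ℂ) {v : a → ℂ} (hv : vnorm v ≤ 1) :
    ‖star v ⬝ᵥ (X *ᵥ v)‖ ≤ traceNorm X := by
  have h : star v ⬝ᵥ (X *ᵥ v) = (outer v v * X).trace := by
    rw [Matrix.trace_mul_comm, trace_mul_outer]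
  rw [h]
  refine norm_trace_mul_le_traceNorm (fun x y => ?_) X
  have : star x ⬝ᵥ (outer v v *ᵥ y) = (star x ⬝ᵥ v) * (star v ⬝ᵥ y) := by
    simp only [dotProduct, Matrix.mulVec, outer, Matrix.of_apply, Pi.star_apply,
      Finset.sum_mul, Finset.mul_sum]
    rw [Finset.sum_comm]
    exact Finset.sum_congr rfl fun i _ => Finset.sum_congr rfl fun j _ => by ring
  rw [this, norm_mul]
  have h1 := norm_dotProduct_le x v
  have h2 := norm_dotProduct_le v y
  have := vnorm_nonneg x
  have := vnorm_nonneg y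
  have := vnorm_nonneg v
  calc _ ≤ (vnorm x * vnorm v) * (vnorm v * vnorm y) := mul_le_mul h1 h2 (norm_nonneg _) (by positivity)
    _ ≤ (vnorm x * 1) * (1 * vnorm y) := by gcongr
    _ = _ := by ring

end traceNorm

/-! ### Elementary properties of quantum operations -/

namespace Channel

section basic

variable {a b c d : Type} [Fintype a] [DecidableEq a] [Fintype b] [DecidableEq b]
  [Fintype c] [DecidableEq c] [Fintype d] [DecidableEq d]

theorem ext_toFun {N M : Channel a b} (h : ∀ X, N X = M X) : N = M := by
  cases N
  cases M
  congr
  exact funext h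

/-- The linear map of a quantum operation. -/
def lin (N : Channel a b) : Matrix a a ℂ →ₗ[ℂ] Matrix b b ℂ where
  toFun := N
  map_add' X Y := by
    obtain ⟨ι, _, K, -, hN⟩ := N.kraus
    simp only [hN, Matrix.mul_add, Matrix.add_mul, Finset.sum_add_distrib]
  map_smul' z X := by
    obtain ⟨ι, _, K, -, hN⟩ := N.kraus
    simp only [hN, Matrix.mul_smul, Matrix.smul_mul, Finset.smul_sum, RingHom.id_apply]

theorem map_sub (N : Channel a b) (X Y : Matrix a a ℂ) : N (X - Y) = N X - N Y :=
  N.lin.map_sub X Y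

theorem map_smul (N : Channel a b) (z : ℂ) (X : Matrix a a ℂ) : N (z • X) = z • N X :=
  N.lin.map_smul z X

theorem map_zero (N : Channel a b) : N 0 = 0 := N.lin.map_zero

theorem map_sum (N : Channel a b) {ι : Type} (s : Finset ι) (X : ι → Matrix a a ℂ) :
    N (∑ i ∈ s, X i) = ∑ i ∈ s, N (X i) := _root_.map_sum N.lin X s

theorem trace_apply (N : Channel a b) (X : Matrix a a ℂ) : (N X).trace = X.trace := by
  obtain ⟨ι, _, K, hK, hN⟩ := N.kraus
  rw [hN, Matrix.trace_sum]
  have : ∀ i, (K i * X * (K i)ᴴ).trace = ((K i)ᴴ * K i * X).trace := fun i => by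
    rw [Matrix.trace_mul_comm, Matrix.mul_assoc]
  simp only [this]
  rw [← Matrix.trace_sum, ← Matrix.sum_mul, hK, Matrix.one_mul]

theorem isState (N : Channel a b) {X : Matrix a a ℂ} (hX : IsState X) : IsState (N X) := by
  refine ⟨?_, by rw [trace_apply, hX.trace_eq_one]⟩
  obtain ⟨ι, _, K, -, hN⟩ := N.kraus
  rw [hN]
  exact Matrix.posSemidef_sum _ fun i _ => hX.posSemidef.mul_mul_conjTranspose_same (K i)

theorem comp_apply (M : Channel b c) (N : Channel a b) (X : Matrix a a ℂ) :
    M.comp N X = M (N X) := rfl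

theorem relabel_apply (e : a ≃ b) (X : Matrix a a ℂ) :
    relabel e X = X.submatrix e.symm e.symm := rfl

theorem amp_apply (N : Channel a b) (X : Matrix (a × c) (a × c) ℂ) (p q : b × c) :
    N.amp c X p q = N (Matrix.of fun i j => X (i, p.2) (j, q.2)) p.1 q.1 := rfl

theorem ofIsometry_apply (V : Matrix b a ℂ) (hV : Vᴴ * V = 1) (X : Matrix a a ℂ) :
    ofIsometry V hV X = V * X * Vᴴ := rfl

theorem amp_kronecker (N : Channel a b) (X : Matrix a a ℂ) (Y : Matrix c c ℂ) :
    N.amp c (X ⊗ₖ Y) = N X ⊗ₖ Y := by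
  ext p q
  have : (Matrix.of fun i j => (X ⊗ₖ Y) (i, p.2) (j, q.2)) = Y p.2 q.2 • X := by
    ext i j
    simp [mul_comm]
  rw [amp_apply, this, map_smul]
  simp [mul_comm]

theorem tensor_kronecker (N : Channel a b) (M : Channel c d) (X : Matrix a a ℂ)
    (Y : Matrix c c ℂ) : N.tensor M (X ⊗ₖ Y) = N X ⊗ₖ M Y := by
  have h : ∀ {a b : Type} [Fintype a] [DecidableEq a] [Fintype b] [DecidableEq b]
      (X : Matrix a a ℂ) (Y : Matrix b b ℂ), relabel (Equiv.prodComm a b) (X ⊗ₖ Y) = Y ⊗ₖ X := by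
    intros
    ext p q
    simp [relabel_apply, mul_comm]
  simp only [tensor, comp_apply, amp_kronecker, h]

theorem ext_single {N M : Channel a b}
    (h : ∀ i j, N (Matrix.single i j 1) = M (Matrix.single i j 1)) : N = M := by
  apply ext_toFun
  intro X
  rw [Matrix.matrix_eq_sum_single X]
  simp only [map_sum]
  refine Finset.sum_congr rfl fun i _ => Finset.sum_congr rfl fun j _ => ?_
  have : Matrix.single i j (X i j) = X i j • Matrix.single i j (1 : ℂ) := by
    rw [Matrix.smul_single, smul_eq_mul, mul_one]
  rw [this, map_smul, map_smul, h]

/-- The matrix units of a composite system are products, so identities between operations on it can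
be checked on product operators. -/
theorem ext_kronecker {N M : Channel (a × c) b}
    (h : ∀ (X : Matrix a a ℂ) (Y : Matrix c c ℂ), N (X ⊗ₖ Y) = M (X ⊗ₖ Y)) : N = M := by
  refine ext_single fun i j => ?_
  have : Matrix.single i j (1 : ℂ) = Matrix.single i.1 j.1 (1 : ℂ) ⊗ₖ Matrix.single i.2 j.2 1 := by
    rw [Matrix.single_kronecker_single, mul_one]
  rw [this, h]

theorem trRight_amp (N : Channel a b) (X : Matrix (a × c) (a × c) ℂ) :
    trRight (N.amp c X) = N (trRight X) := by
  have : trRight X = ∑ k, Matrix.of fun i j => X (i, k) (j, k) := by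
    ext i j
    simp [trRight, Matrix.sum_apply]
  rw [this, map_sum]
  ext i j
  simp [trRight, Matrix.sum_apply, amp_apply]

/-- Discarding the second system. -/
def disc (a c : Type) [Fintype a] [DecidableEq a] [Fintype c] [DecidableEq c] :
    Channel (a × c) a where
  toFun := trRight
  kraus := by
    refine ⟨c, inferInstance, fun k => Matrix.of fun i p => if p = (i, k) then 1 else 0, ?_, ?_⟩
    · ext ⟨i, k⟩ ⟨j, l⟩
      simp only [Matrix.sum_apply, Matrix.mul_apply, Matrix.conjTranspose_apply, Matrix.of_apply,
        Matrix.one_apply, Prod.mk.injEq, ite_and]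
      by_cases hij : i = j <;> by_cases hkl : k = l <;>
        simp [hij, hkl, apply_ite, Finset.sum_ite_eq]
    · intro X
      ext i j
      simp [trRight, Matrix.sum_apply, Matrix.mul_apply, apply_ite]

theorem disc_apply (X : Matrix (a × c) (a × c) ℂ) : disc a c X = trRight X := rfl

/-- Every operation has an isometric extension. -/
theorem exists_dilation (N : Channel a b) :
    ∃ (E : Sys) (V : Matrix (b × E) a ℂ) (hV : Vᴴ * V = 1),
      N = (disc b E).comp (ofIsometry V hV) := by
  classical
  obtain ⟨ι, _, K, hK, hN⟩ := N.kraus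
  -- A zero Kraus operator is added because a system must be nonempty, whereas the family `K` need
  -- not be when `a` is empty.
  let K' : Option ι → Matrix b a ℂ := fun o => o.elim 0 K
  have hK' : ∑ i, (K' i)ᴴ * K' i = 1 := by
    rw [Fintype.sum_option]
    simpa [K'] using hK
  have hN' : ∀ X, N X = ∑ i, K' i * X * (K' i)ᴴ := fun X => by
    rw [hN, Fintype.sum_option]
    simp [K']
  refine ⟨.of (Option ι), Matrix.of fun p j => K' p.2 p.1 j, ?_, ?_⟩
  · rw [← hK']
    ext i j
    simp only [Matrix.mul_apply, Matrix.conjTranspose_apply, Matrix.of_apply, Matrix.sum_apply,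
      Fintype.sum_prod_type]
    exact Finset.sum_comm
  · apply ext_toFun
    intro X
    rw [hN']
    ext i j
    simp only [Matrix.sum_apply]
    rfl

/-- Operations that are conjugations by an isometry. -/
def IsIsometric (N : Channel a b) : Prop :=
  ∃ (V : Matrix b a ℂ) (hV : Vᴴ * V = 1), N = ofIsometry V hV

theorem isIsometric_ofIsometry (V : Matrix b a ℂ) (hV : Vᴴ * V = 1) :
    (ofIsometry V hV).IsIsometric := ⟨V, hV, rfl⟩

theorem IsIsometric.comp {M : Channel b c} {N : Channel a b} (hM : M.IsIsometric)
    (hN : N.IsIsometric) : (M.comp N).IsIsometric := by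
  obtain ⟨V, hV, rfl⟩ := hM
  obtain ⟨W, hW, rfl⟩ := hN
  refine ⟨V * W, ?_, ext_toFun fun X => ?_⟩
  · rw [Matrix.conjTranspose_mul, Matrix.mul_assoc, ← Matrix.mul_assoc Vᴴ, hV, Matrix.one_mul, hW]
  · simp only [comp_apply, ofIsometry_apply, Matrix.conjTranspose_mul, Matrix.mul_assoc]

theorem isIsometric_relabel (e : a ≃ b) : (relabel e).IsIsometric := by
  have h : ∀ (x : a) (k : b), (e x = k) = (x = e.symm k) := fun x k =>
    propext e.eq_symm_apply.symm
  have h' : ∀ (x : a) (k : b), (k = e x) = (x = e.symm k) := fun x k => by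
    rw [← h, @eq_comm _ k]
  refine ⟨(1 : Matrix b b ℂ).submatrix id e, ?_, ext_toFun fun X => ?_⟩
  · ext i j
    simp [Matrix.mul_apply, Matrix.one_apply, eq_comm]
  · ext i j
    simp [relabel_apply, ofIsometry_apply, Matrix.mul_apply, Matrix.one_apply, h, h']

theorem IsIsometric.amp {N : Channel a b} (hN : N.IsIsometric) : (N.amp c).IsIsometric := by
  obtain ⟨V, hV, rfl⟩ := hN
  refine ⟨V ⊗ₖ (1 : Matrix c c ℂ), ?_, ext_kronecker fun X Y => ?_⟩
  · rw [Matrix.conjTranspose_kronecker, ← Matrix.mul_kronecker_mul, hV]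
    simp
  · rw [amp_kronecker, ofIsometry_apply, ofIsometry_apply, Matrix.conjTranspose_kronecker,
      ← Matrix.mul_kronecker_mul, ← Matrix.mul_kronecker_mul]
    simp

/-- Operations on different systems commute. -/
theorem amp_comm (N : Channel a b) (M : Channel c d) (X : Matrix (a × c) (a × c) ℂ) :
    relabel (Equiv.prodComm d b) (M.amp b (relabel (Equiv.prodComm b c) (N.amp c X))) =
      N.amp d (relabel (Equiv.prodComm d a) (M.amp a (relabel (Equiv.prodComm a c) X))) := by
  have : (N.tensor M) = (N.amp d).comp ((relabel (Equiv.prodComm d a)).comp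
      ((M.amp a).comp (relabel (Equiv.prodComm a c)))) := by
    refine ext_kronecker fun X Y => ?_
    have h : ∀ {a b : Type} [Fintype a] [DecidableEq a] [Fintype b] [DecidableEq b]
        (X : Matrix a a ℂ) (Y : Matrix b b ℂ),
        relabel (Equiv.prodComm a b) (X ⊗ₖ Y) = Y ⊗ₖ X := by
      intros
      ext p q
      simp [relabel_apply, mul_comm]
    simp only [tensor_kronecker, comp_apply, amp_kronecker, h]
  exact congrArg (fun F : Channel (a × c) (b × d) => F X) this

end basic

end Channel

open Protocol.CohExt (swapEquiv)

/-! ### Manipulation of successive uses of resources -/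

/-- Carrying a side system `Z` along the uses of resources, with an isometric operation applied
first. -/
theorem Steps.exists_carry {l : Depth} {M M' : Sys} (st : Steps l M M') :
    ∀ (M₀ Z : Sys) (W : Channel M₀ (M × Z)), W.IsIsometric →
    ∃ (M₁ : Sys) (st' : Steps l M₀ M₁) (F : Channel M₁ (M' × Z)),
      (∀ ξ : Matrix (M₀ × srcSys l) (M₀ × srcSys l) ℂ,
        F.amp (bobSys l) (st'.run ξ) =
          (st.run.amp Z ((W.amp (srcSys l) ξ).submatrix (swapEquiv M (srcSys l) Z)
            (swapEquiv M (srcSys l) Z))).submatrix (swapEquiv M' Z (bobSys l))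
              (swapEquiv M' Z (bobSys l))) ∧
      ∀ (η : ℝ) (ξ : Matrix (M₀ × srcSys l) (M₀ × srcSys l) ℂ),
        st.Valid η (trRight ((W.amp (srcSys l) ξ).submatrix (swapEquiv M (srcSys l) Z)
            (swapEquiv M (srcSys l) Z))) → st'.Valid η ξ := by
  induction st with
  | done M =>
    intro M₀ Z W _
    -- With no use left, `W` is postponed to Alice's final operation `F`.
    exact ⟨M₀, .done M₀, W, fun ξ => rfl, fun _ _ _ => trivial⟩
  | use r l M M' X V hV rest ih =>
    intro M₀ Z W hW
    -- The new isometry before the use is `W` followed by `V ⊗ id`, with `Z` stored in the auxiliary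
    -- system. A step admits isometries only, hence the assumption on `W`.
    obtain ⟨V', hV', hVV⟩ : ((Channel.relabel (Equiv.prodAssoc (r.Arel × r.Aabs) X Z)).comp
        (((Channel.ofIsometry V hV).amp Z).comp W)).IsIsometric :=
      (Channel.isIsometric_relabel _).comp ((Channel.isIsometric_ofIsometry V hV).amp.comp hW)
    -- After the use, extracting `Z` from the auxiliary system is a relabelling; it plays the role
    -- of `W` for the remaining uses.
    obtain ⟨M₁, st', F, hF, hval⟩ := ih (.of (r.A × (.of (X × Z) : Sys))) Z
      (Channel.relabel (Equiv.prodAssoc r.A X Z).symm) (Channel.isIsometric_relabel _)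
    have hstep : ∀ ξ : Matrix (M₀ × (r.S × srcSys l)) (M₀ × (r.S × srcSys l)) ℂ,
        stepPre r M₀ (.of (X × Z)) (srcSys l) V' hV' ξ =
          ((stepPre r M X (srcSys l) V hV).amp Z ((W.amp (srcSys (r :: l)) ξ).submatrix
            (swapEquiv M (srcSys (r :: l)) Z) (swapEquiv M (srcSys (r :: l)) Z))).submatrix
            (fun p => ((p.1, (p.2.1.1, p.2.2)), p.2.1.2))
            (fun p => ((p.1, (p.2.1.1, p.2.2)), p.2.1.2)) := by
      intro ξ
      unfold stepPre
      rw [← hVV]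
      rfl
    have hlin : ∀ Ξ : Matrix ((M × (r.S × srcSys l)) × Z) ((M × (r.S × srcSys l)) × Z) ℂ,
        trRight ((stepPre r M X (srcSys l) V hV).amp Z Ξ) =
          stepPre r M X (srcSys l) V hV (trRight Ξ) := fun Ξ => Channel.trRight_amp _ _
    refine ⟨M₁, .use r l M₀ M₁ (.of (X × Z)) V' hV' st', F, fun ξ => ?_, fun η ξ hξ => ?_⟩
    · ext ⟨⟨m, z⟩, b, t⟩ ⟨⟨m', z'⟩, b', t'⟩
      have h := congrArg (fun Y => F.amp (bobSys l) (st'.run (Matrix.of fun i j =>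
        stepUse r (.of (X × Z)) (srcSys l) Y (i, b) (j, b'))) ((m, z), t) ((m', z'), t')) (hstep ξ)
      exact h.trans (congrFun (congrFun (hF _) ((m, z), t)) ((m', z'), t'))
    · obtain ⟨h1, h2⟩ := hξ
      refine ⟨?_, hval η _ ?_⟩
      · refine Eq.trans_le (congrArg (fun Y => traceNorm (Y - r.ω)) ?_) h1
        refine (congrArg relInput (hstep ξ)).trans (Eq.trans ?_ (congrArg relInput (hlin _)))
        ext i j
        simp only [relInput, trRight, Matrix.of_apply, Fintype.sum_prod_type, Matrix.submatrix_apply]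
        refine Finset.sum_congr rfl fun a _ => Finset.sum_congr rfl fun s _ =>
          Finset.sum_congr rfl fun x _ => Finset.sum_comm
      · refine Eq.mp (congrArg (rest.Valid η) (Eq.symm ?_)) h2
        refine (congrArg (fun Y => trRight ((((Channel.relabel
          (Equiv.prodAssoc r.A X Z).symm).amp (srcSys l)) (trRight (stepUse r (.of (X × Z))
          (srcSys l) Y))).submatrix (swapEquiv (r.A × X) (srcSys l) Z)
            (swapEquiv (r.A × X) (srcSys l) Z))) (hstep ξ)).trans (Eq.trans ?_
              (congrArg (fun Y => trRight (stepUse r X (srcSys l) Y)) (hlin _)))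
        refine Eq.trans ?_ (congrArg trRight (Channel.trRight_amp (stepUse r X (srcSys l)) _))
        ext i j
        exact Finset.sum_comm

/-! ### Concatenation of uses and stability of validity -/

open Protocol.CohExt (swapEquiv)

/-- The source systems of a concatenation. -/
def srcSplit : (l₁ l₂ : Depth) → srcSys (l₁ ++ l₂) ≃ srcSys l₁ × srcSys l₂
  | [], l₂ => ⟨fun t => ((), t), fun p => p.2, fun _ => rfl, fun _ => rfl⟩
  | r :: l, l₂ =>
    ⟨fun p => ((p.1, (srcSplit l l₂ p.2).1), (srcSplit l l₂ p.2).2),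
      fun p => (p.1.1, (srcSplit l l₂).symm (p.1.2, p.2)),
      fun p => Prod.ext rfl ((srcSplit l l₂).symm_apply_apply p.2),
      fun p => by simp; rfl⟩

/-- Bob's systems of a concatenation. -/
def bobSplit : (l₁ l₂ : Depth) → bobSys (l₁ ++ l₂) ≃ bobSys l₁ × bobSys l₂
  | [], l₂ => ⟨fun t => ((), t), fun p => p.2, fun _ => rfl, fun _ => rfl⟩
  | r :: l, l₂ =>
    ⟨fun p => ((p.1, (bobSplit l l₂ p.2).1), (bobSplit l l₂ p.2).2),
      fun p => (p.1.1, (bobSplit l l₂).symm (p.1.2, p.2)),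
      fun p => Prod.ext rfl ((bobSplit l l₂).symm_apply_apply p.2),
      fun p => by simp; rfl⟩

theorem srcState_append (l₁ l₂ : Depth) :
    srcState (l₁ ++ l₂) =
      (srcState l₁ ⊗ₖ srcState l₂).submatrix (srcSplit l₁ l₂) (srcSplit l₁ l₂) := by
  induction l₁ with
  | nil =>
    ext i j
    change srcState l₂ i j = (1 : Matrix Unit Unit ℂ) () () * srcState l₂ i j
    simp
  | cons r l ih =>
    ext i j
    change r.ρ i.1 j.1 * srcState (l ++ l₂) i.2 j.2 = _
    rw [ih]
    exact (mul_assoc _ _ _).symm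

/-- Regrouping after the first of two successive stages. -/
def midEquiv (M₂ Z B S : Type) : (M₂ × Z) × (B × S) ≃ (M₂ × S) × (Z × B) where
  toFun p := ((p.1.1, p.2.2), (p.1.2, p.2.1))
  invFun p := ((p.1.1, p.2.1), (p.2.2, p.1.2))
  left_inv _ := rfl
  right_inv _ := rfl

/-- Splitting the source systems of a concatenation. -/
def srcAssoc (M : Type) (l₁ l₂ : Depth) : M × srcSys (l₁ ++ l₂) ≃ (M × srcSys l₁) × srcSys l₂ where
  toFun p := ((p.1, (srcSplit l₁ l₂ p.2).1), (srcSplit l₁ l₂ p.2).2)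
  invFun p := (p.1.1, (srcSplit l₁ l₂).symm (p.1.2, p.2))
  left_inv p := by simp
  right_inv p := by simp

/-- Joining Bob's systems of a concatenation. -/
def bobJoin (M Z : Type) (l₁ l₂ : Depth) :
    (M × bobSys l₂) × (Z × bobSys l₁) ≃ (M × Z) × bobSys (l₁ ++ l₂) where
  toFun p := ((p.1.1, p.2.1), (bobSplit l₁ l₂).symm (p.2.2, p.1.2))
  invFun p := ((p.1.1, (bobSplit l₁ l₂ p.2).2), (p.1.2, (bobSplit l₁ l₂ p.2).1))
  left_inv p := by simp
  right_inv p := by simp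

/-- The uses `st` followed by the operation `C` of Alice, the source systems of `l₂` being
present. -/
def Steps.mid {l₁ : Depth} {M M₁ : Sys} (st : Steps l₁ M M₁) (l₂ : Depth) {M₂ Z : Sys}
    (C : Channel M₁ (M₂ × Z)) :
    Channel (M × srcSys (l₁ ++ l₂)) ((M₂ × srcSys l₂) × (Z × bobSys l₁)) :=
  (Channel.relabel (midEquiv M₂ Z (bobSys l₁) (srcSys l₂))).comp <|
    (C.amp (bobSys l₁ × srcSys l₂)).comp <|
      (Channel.relabel (Equiv.prodAssoc M₁ (bobSys l₁) (srcSys l₂))).comp <|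
        (st.run.amp (srcSys l₂)).comp <| Channel.relabel (srcAssoc M l₁ l₂)

theorem Channel.amp_sum_apply {a b ι : Type} [Fintype a] [DecidableEq a] [Fintype b] [DecidableEq b]
    [Fintype ι] (N : Channel a b)
    (X : ι → Matrix a a ℂ) (p q : b) :
    N (Matrix.of fun i j => ∑ e, X e i j) p q = ∑ e, N (X e) p q := by
  have : (Matrix.of fun i j => ∑ e, X e i j) = ∑ e, X e := by
    ext i j
    simp [Matrix.sum_apply]
  rw [this, map_sum, Matrix.sum_apply]

/-- Concatenation of uses of resources, with an operation of Alice in between. -/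
theorem Steps.exists_append {l₁ : Depth} {M M₁ : Sys} (st₁ : Steps l₁ M M₁) :
    ∀ {l₂ : Depth} {M₂ M₃ Z : Sys} (C : Channel M₁ (M₂ × Z)) (st₂ : Steps l₂ M₂ M₃),
    ∃ (M₄ : Sys) (st : Steps (l₁ ++ l₂) M M₄) (F : Channel M₄ (M₃ × Z)),
      (∀ ξ : Matrix (M × srcSys (l₁ ++ l₂)) (M × srcSys (l₁ ++ l₂)) ℂ,
        F.amp (bobSys (l₁ ++ l₂)) (st.run ξ) = Channel.relabel (bobJoin M₃ Z l₁ l₂)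
          (st₂.run.amp (Z × bobSys l₁) (st₁.mid l₂ C ξ))) ∧
      ∀ (η : ℝ) (ξ : Matrix (M × srcSys (l₁ ++ l₂)) (M × srcSys (l₁ ++ l₂)) ℂ),
        st₁.Valid η (trRight (Channel.relabel (srcAssoc M l₁ l₂) ξ)) →
        st₂.Valid η (trRight (st₁.mid l₂ C ξ)) → st.Valid η ξ := by
  induction st₁ with
  | done M =>
    intro l₂ M₂ M₃ Z C st₂
    -- `C` need not be isometric, but steps are. Its environment `E` is therefore carried along with
    -- `Z` through the second list and discarded at the end.
    obtain ⟨E, V, hV, rfl⟩ := C.exists_dilation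
    obtain ⟨M₄, st, F, hF, hval⟩ := st₂.exists_carry M (.of (Z × E))
      ((Channel.relabel (Equiv.prodAssoc M₂ Z E)).comp (Channel.ofIsometry V hV))
      ((Channel.isIsometric_relabel _).comp (Channel.isIsometric_ofIsometry _ _))
    refine ⟨M₄, st, (Channel.disc (M₃ × Z) E).comp
      ((Channel.relabel (Equiv.prodAssoc M₃ Z E).symm).comp F), fun ξ => ?_, fun η ξ _ h => ?_⟩
    · ext ⟨⟨m, z⟩, t⟩ ⟨⟨m', z'⟩, t'⟩
      have h1 : ∀ e : E, _ := fun e =>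
        congrFun (congrFun (hF ξ) ((m, (z, e)), t)) ((m', (z', e)), t')
      have h2 := Finset.sum_congr (s₁ := (Finset.univ : Finset E)) rfl fun e _ => h1 e
      exact h2.trans (Channel.amp_sum_apply st₂.run (fun e : E => Matrix.of fun i j =>
        ((Channel.relabel (Equiv.prodAssoc M₂ Z E)).comp (Channel.ofIsometry V hV)).amp (srcSys l₂) ξ
          ((i.1, (z, e)), i.2) ((j.1, (z', e)), j.2)) (m, t) (m', t')).symm
    · refine hval η ξ (Eq.mp (congrArg (st₂.Valid η) ?_) h)
      ext i j
      simp only [trRight, Matrix.of_apply, Fintype.sum_prod_type]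
      refine Finset.sum_congr rfl fun z _ => ?_
      exact Fintype.sum_unique (ι := Unit) _
  | use r l M M' X V hV rest ih =>
    intro l₂ M₂ M₃ Z C st₂
    obtain ⟨M₄, st, F, hF, hval⟩ := ih C st₂
    refine ⟨M₄, .use r (l ++ l₂) M M₄ X V hV st, F, fun ξ => ?_, fun η ξ h₁ h₂ => ⟨?_, hval η _ ?_ ?_⟩⟩
    · ext ⟨⟨m, z⟩, b, t⟩ ⟨⟨m', z'⟩, b', t'⟩
      exact congrFun (congrFun (hF (Matrix.of fun i j => stepUse r X (srcSys (l ++ l₂))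
        (stepPre r M X (srcSys (l ++ l₂)) V hV ξ) (i, b) (j, b'))) ((m, z), t)) ((m', z'), t')
    · refine Eq.trans_le (congrArg (fun Y => traceNorm (Y - r.ω)) ?_) h₁.1
      -- The source systems of `l₂` are spectators during the uses of the first list, so tracing
      -- them out commutes with these.
      refine Eq.trans ?_ (congrArg relInput (Channel.trRight_amp (stepPre r M X (srcSys l) V hV) _))
      ext i j
      simp only [relInput, trRight, Matrix.of_apply, Fintype.sum_prod_type]
      refine Finset.sum_congr rfl fun a _ => Finset.sum_congr rfl fun s _ =>
          Finset.sum_congr rfl fun x _ => ?_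
      rw [← (srcSplit l l₂).symm.sum_comp, Fintype.sum_prod_type]
      rfl
    · refine Eq.mp (congrArg (rest.Valid η) (Eq.symm ?_)) h₁.2
      refine Eq.trans ?_ (congrArg (fun Y => trRight (stepUse r X (srcSys l) Y))
        (Channel.trRight_amp (stepPre r M X (srcSys l) V hV) _))
      refine Eq.trans ?_ (congrArg trRight (Channel.trRight_amp (stepUse r X (srcSys l)) _))
      ext i j
      exact Finset.sum_comm
    · refine Eq.mp (congrArg (st₂.Valid η) (Eq.symm ?_)) h₂
      refine (congrArg trRight (Channel.trRight_amp (rest.mid l₂ C) _)).symm.trans ?_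
      ext i j
      simp only [trRight, Matrix.of_apply, Fintype.sum_prod_type]
      refine Finset.sum_congr rfl fun z _ => Finset.sum_comm.trans ?_
      exact (Fintype.sum_prod_type (α₁ := r.B) (α₂ := bobSys l) fun y =>
        (Steps.use r l M M' X V hV rest).mid l₂ C ξ (i, (z, y)) (j, (z, y))).symm

/-- A perturbation of the initial state perturbs the inputs of all resources at most as much. -/
theorem Steps.Valid.perturb {l : Depth} {M M' : Sys} {st : Steps l M M'} {η δ : ℝ}
    {ξ ξ' : Matrix (M × srcSys l) (M × srcSys l) ℂ} (h : st.Valid η ξ)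
    (hξ : traceNorm (ξ' - ξ) ≤ δ) : st.Valid (η + δ) ξ' := by
  induction st with
  | done M => trivial
  | use r l M M' X V hV rest ih =>
    obtain ⟨h1, h2⟩ := h
    have hpre : traceNorm (stepPre r M X (srcSys l) V hV ξ' - stepPre r M X (srcSys l) V hV ξ)
        ≤ δ := (congrArg traceNorm (Channel.map_sub _ ξ' ξ)).symm.trans_le
          ((Channel.traceNorm_le _ _).trans hξ)
    refine ⟨?_, ih h2 ?_⟩
    · have h3 := (Channel.traceNorm_le ((Channel.disc r.Arel r.Aabs).comp
        ((Channel.disc _ r.S).comp (Channel.disc _ (X × srcSys l)))) _).trans hpre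
      rw [Channel.map_sub] at h3
      refine (traceNorm_sub_le _ (relInput (stepPre r M X (srcSys l) V hV ξ)) _).trans ?_
      rw [add_comm η δ]
      exact add_le_add h3 h1
    · have h3 := (Channel.traceNorm_le ((Channel.disc _ r.B).comp (stepUse r X (srcSys l))) _).trans
        hpre
      rw [Channel.map_sub] at h3
      exact h3

theorem Steps.Valid.mono {l : Depth} {M M' : Sys} {st : Steps l M M'} {η η' : ℝ}
    {ξ : Matrix (M × srcSys l) (M × srcSys l) ℂ} (h : st.Valid η ξ) (hη : η ≤ η') :
    st.Valid η' ξ := by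
  have := h.perturb (ξ' := ξ) (δ := η' - η) (by rw [sub_self, traceNorm_zero]; linarith)
  rwa [add_sub_cancel] at this

/-! ### Creation of a resource up to an error -/

open Protocol.CohExt (swapEquiv)

/-- The resource `t` can be created from `l` by an `ε`-valid protocol with accuracy `ε`. -/
def Creates (l : Depth) (t : Resource) (ε : ℝ) : Prop :=
  ∃ P : Protocol l t, P.Valid ε ∧ P.Accurate ε

namespace Channel

variable {a b c d : Type} [Fintype a] [DecidableEq a] [Fintype b] [DecidableEq b]
  [Fintype c] [DecidableEq c] [Fintype d] [DecidableEq d]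

/-- The form of `amp_comm` in matrix entries. It moves operations of one party past those on other
systems without a choice of regroupings. -/
theorem comm_apply (N : Channel a b) (M : Channel c d) (X : a → a → c → c → ℂ) (j j' : b)
    (k k' : d) :
    M (Matrix.of fun x x' => N (Matrix.of fun i i' => X i i' x x') j j') k k' =
      N (Matrix.of fun i i' => M (Matrix.of fun x x' => X i i' x x') k k') j j' :=
  congrFun (congrFun (amp_comm N M (Matrix.of fun p q => X p.1 q.1 p.2 q.2)) (j, k)) (j', k')

end Channel

theorem trRight_unit {a : Type} (X : Matrix (a × Unit) (a × Unit) ℂ) :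
    trRight X = Matrix.of fun i j => X (i, ()) (j, ()) := by
  ext i j
  simp [trRight]

theorem Creates.mono {l : Depth} {t : Resource} {ε ε' : ℝ} (h : Creates l t ε) (hε : ε ≤ ε') :
    Creates l t ε' := by
  obtain ⟨P, hv, ha⟩ := h
  exact ⟨P, fun ξ hξ hm => (hv ξ hξ hm).mono hε, fun R ξ hξ hm => (ha R ξ hξ hm).trans hε⟩

/-! ### Sequential composition of protocols -/

section twoStep

variable {s t₁ t₂ : Resource} {X₁ X₂ : Sys}

/-- The preparation of the input of the first of two created resources. -/
def stageOne (e : Channel (s.Arel × s.Aabs) ((t₁.Arel × t₁.Aabs) × X₁))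
    (src : s.S ≃ t₁.S × t₂.S) :
    Channel ((s.Arel × s.Aabs) × s.S) (((t₁.Arel × t₁.Aabs) × t₁.S) × (X₁ × t₂.S)) :=
  (Channel.relabel (Equiv.prodProdProdComm (t₁.Arel × t₁.Aabs) X₁ t₁.S t₂.S)).comp
    (e.tensor (Channel.relabel src))

/-- The use of the first resource and the preparation of the input of the second one. -/
def stageTwo (m : Channel (t₁.A × X₁) ((t₂.Arel × t₂.Aabs) × X₂)) {i b : Type} [Fintype i]
    [DecidableEq i] [Fintype b] [DecidableEq b] (N : Channel i (t₁.A × b)) :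
    Channel (i × (X₁ × t₂.S)) (((t₂.Arel × t₂.Aabs) × t₂.S) × (X₂ × b)) :=
  (Channel.relabel (midEquiv (t₂.Arel × t₂.Aabs) X₂ b t₂.S)).comp <|
    (m.amp (b × t₂.S)).comp <|
      (Channel.relabel (Equiv.prodProdProdComm t₁.A b X₁ t₂.S)).comp (N.amp (X₁ × t₂.S))

/-- Regrouping after the use of the second resource. -/
def lastEquiv (a b x b' : Type) : (a × b) × (x × b') ≃ (a × x) × (b' × b) where
  toFun p := ((p.1.1, p.2.1), (p.2.2, p.1.2))
  invFun p := ((p.1.1, p.2.2), (p.1.2, p.2.1))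
  left_inv _ := rfl
  right_inv _ := rfl

/-- The use of the second resource and the final operations. -/
def stageThree (f : Channel (t₂.A × X₂) s.A) (d : Channel (t₁.B × t₂.B) s.B)
    (N : Channel ((t₂.Arel × t₂.Aabs) × t₂.S) (t₂.A × t₂.B)) :
    Channel (((t₂.Arel × t₂.Aabs) × t₂.S) × (X₂ × t₁.B)) (s.A × s.B) :=
  (f.tensor d).comp <|
    (Channel.relabel (lastEquiv t₂.A t₂.B X₂ t₁.B)).comp (N.amp (X₂ × t₁.B))

/-- Sequential composition: protocols creating `t₁` and `t₂` give a protocol creating `s`, if `s`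
is obtained from `t₁` and `t₂` by one use of each. -/
theorem Creates.comp {l₁ l₂ : Depth} {ε₁ ε₂ : ℝ} (h₁ : Creates l₁ t₁ ε₁)
    (h₂ : Creates l₂ t₂ ε₂) (hε₂ : 0 ≤ ε₂)
    (e : Channel (s.Arel × s.Aabs) ((t₁.Arel × t₁.Aabs) × X₁))
    (m : Channel (t₁.A × X₁) ((t₂.Arel × t₂.Aabs) × X₂))
    (f : Channel (t₂.A × X₂) s.A) (d : Channel (t₁.B × t₂.B) s.B)
    (src : s.S ≃ t₁.S × t₂.S) (hρ : s.ρ = (t₁.ρ ⊗ₖ t₂.ρ).submatrix src src)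
    (H₁ : ∀ ξ, IsState ξ → testMarginal ξ = s.ω ⊗ₖ s.ρ →
      testMarginal (trRight (stageOne e src ξ)) = t₁.ω ⊗ₖ t₁.ρ)
    (H₂ : ∀ ξ, IsState ξ → testMarginal ξ = s.ω ⊗ₖ s.ρ →
      testMarginal (trRight (stageTwo m t₁.N (stageOne e src ξ))) = t₂.ω ⊗ₖ t₂.ρ)
    (H₃ : s.N = (stageThree f d t₂.N).comp ((stageTwo m t₁.N).comp (stageOne e src))) :
    Creates (l₁ ++ l₂) s (ε₁ + ε₂) := by
  obtain ⟨P₁, hv₁, ha₁⟩ := h₁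
  obtain ⟨P₂, hv₂, ha₂⟩ := h₂
  -- Alice's side memory `X₁` has to survive the first protocol, which knows nothing of it.
  obtain ⟨M₁, st₁, F₁, hF₁, hst₁⟩ := P₁.steps.exists_carry (.of (P₁.M₀ × X₁)) X₁
    (Channel.relabel (Equiv.refl _)) (Channel.isIsometric_relabel _)
  -- Between the two lists Alice completes the first protocol, applies `m`, and starts the second
  -- protocol.
  let C : Channel M₁ (P₂.M₀ × X₂) :=
    (P₂.enc.amp X₂).comp (m.comp ((P₁.fin.amp X₁).comp F₁))
  obtain ⟨M₄, st, F, hF, hst⟩ := st₁.exists_append C P₂.steps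
  let srcE : s.S × (P₁.T × P₂.T) ≃ srcSys (P₁.order ++ P₂.order) :=
    ((src.prodCongr (Equiv.refl _)).trans (Equiv.prodProdProdComm t₁.S t₂.S P₁.T P₂.T)).trans
      ((P₁.src.prodCongr P₂.src).trans (srcSplit P₁.order P₂.order).symm)
  let P : Protocol (l₁ ++ l₂) s :=
    { order := P₁.order ++ P₂.order
      perm := P₁.perm.append P₂.perm
      M₀ := .of (P₁.M₀ × X₁)
      M₁ := M₄
      enc := (P₁.enc.amp X₁).comp e
      steps := st
      fin := f.comp ((P₂.fin.amp X₂).comp F)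
      dec := d.comp ((P₁.dec.tensor P₂.dec).comp (Channel.relabel (bobSplit _ _)))
      T := .of (P₁.T × P₂.T)
      src := srcE
      τ := P₁.τ ⊗ₖ P₂.τ
      isState_τ := P₁.isState_τ.kronecker P₂.isState_τ
      src_eq := by
        rw [srcState_append, P₁.src_eq, P₂.src_eq, hρ]
        ext i j
        simp only [Matrix.submatrix_apply, Matrix.kroneckerMap_apply, srcE]
        simp
        ring }
  let κ₂ : Channel t₂.S (srcSys P₂.order) :=
    (Channel.relabel P₂.src).comp (Channel.append t₂.S P₂.τ P₂.isState_τ)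
  -- The first protocol without Bob's decoding: in a single protocol Bob acts only at the very end.
  let run₁ : Channel (((t₁.Arel × t₁.Aabs) × t₁.S)) (t₁.A × bobSys P₁.order) :=
    (P₁.fin.amp (bobSys P₁.order)).comp (P₁.steps.run.comp P₁.input)
  have hin : ∀ ξ m x u v m' x' u' v',
      P.input ξ ((m, x), (srcSplit P₁.order P₂.order).symm (u, v))
        ((m', x'), (srcSplit P₁.order P₂.order).symm (u', v')) =
      κ₂ (Matrix.of fun σ σ' => P₁.input.amp (X₁ × t₂.S) (stageOne e src ξ) ((m, u), (x, σ))
        ((m', u'), (x', σ'))) v v' := by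
    intro ξ m x u v m' x' u' v'
    have h : ∀ u v, srcE.symm ((srcSplit P₁.order P₂.order).symm (u, v)) =
        (src.symm ((P₁.src.symm u).1, (P₂.src.symm v).1), ((P₁.src.symm u).2, (P₂.src.symm v).2)) :=
      fun u v => by simp [srcE]
    change P.enc (Matrix.of fun i i' => ξ
        (i, (srcE.symm ((srcSplit P₁.order P₂.order).symm (u, v))).1)
        (i', (srcE.symm ((srcSplit P₁.order P₂.order).symm (u', v'))).1)) (m, x) (m', x') *
      (P₁.τ ⊗ₖ P₂.τ) (srcE.symm ((srcSplit P₁.order P₂.order).symm (u, v))).2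
        (srcE.symm ((srcSplit P₁.order P₂.order).symm (u', v'))).2 = _
    rw [h, h]
    exact (mul_assoc _ _ _).symm
  have hmid : ∀ ξ, st₁.mid P₂.order C (P.input ξ) =
      P₂.input.amp (X₂ × bobSys P₁.order) (stageTwo m run₁ (stageOne e src ξ)) := by
    intro ξ
    let G : Channel ((P₁.M₀ × srcSys P₁.order) × X₁)
        (((t₂.Arel × t₂.Aabs) × X₂) × bobSys P₁.order) :=
      (m.amp (bobSys P₁.order)).comp <|
        (Channel.relabel (swapEquiv t₁.A (bobSys P₁.order) X₁)).comp <|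
          ((P₁.fin.amp (bobSys P₁.order)).comp P₁.steps.run).amp X₁
    have h1 : st₁.mid P₂.order C (P.input ξ) = Matrix.of fun p q =>
        P₂.enc (Matrix.of fun i i' => G (Matrix.of fun j j' =>
          P.input ξ ((j.1.1, j.2), (srcSplit P₁.order P₂.order).symm (j.1.2, p.1.2))
            ((j'.1.1, j'.2), (srcSplit P₁.order P₂.order).symm (j'.1.2, q.1.2)))
          ((i, p.2.1), p.2.2) ((i', q.2.1), q.2.2)) p.1.1 q.1.1 := by
      ext ⟨⟨m₂, v⟩, x₂, β⟩ ⟨⟨m₂', v'⟩, x₂', β'⟩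
      have h2 := congrArg (fun Y : Matrix ((P₁.M₁ × X₁) × bobSys P₁.order)
        ((P₁.M₁ × X₁) × bobSys P₁.order) ℂ => (P₂.enc.amp X₂).comp (m.comp (P₁.fin.amp X₁))
          (Matrix.of fun i i' => Y (i, β) (i', β')) (m₂, x₂) (m₂', x₂'))
        (hF₁ (Matrix.of fun i i' => P.input ξ (i.1, (srcSplit P₁.order P₂.order).symm (i.2, v))
            (i'.1, (srcSplit P₁.order P₂.order).symm (i'.2, v'))))
      exact h2
    rw [h1]
    ext ⟨⟨m₂, v⟩, x₂, β⟩ ⟨⟨m₂', v'⟩, x₂', β'⟩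
    simp only [hin]
    have h3 := Channel.comm_apply κ₂ (((P₂.enc.amp X₂).amp (bobSys P₁.order)).comp G)
      (fun σ σ' j j' => P₁.input.amp (X₁ × t₂.S) (stageOne e src ξ) (j.1, (j.2, σ))
        (j'.1, (j'.2, σ'))) v v' ((m₂, x₂), β) ((m₂', x₂'), β')
    exact h3
  -- Bob's first decoding commutes with Alice's operation `m`, so it may be postponed.
  have hY : ∀ ξ p q, stageTwo m P₁.op (stageOne e src ξ) p q =
      P₁.dec (Matrix.of fun β β' => stageTwo m run₁ (stageOne e src ξ) (p.1, (p.2.1, β))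
        (q.1, (q.2.1, β'))) p.2.2 q.2.2 := by
    intro ξ p q
    exact (Channel.comm_apply P₁.dec m (fun β β' j j' => run₁.amp (X₁ × t₂.S) (stageOne e src ξ)
      ((j.1, β), (j.2, p.1.2)) ((j'.1, β'), (j'.2, q.1.2))) p.2.2 q.2.2 (p.1.1, p.2.1)
        (q.1.1, q.2.1))
  have hop : P.op = (stageThree f d P₂.op).comp ((stageTwo m P₁.op).comp (stageOne e src)) := by
    apply Channel.ext_toFun
    intro ξ
    let Y : Matrix (((t₂.Arel × t₂.Aabs) × t₂.S) × (X₂ × bobSys P₁.order))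
      (((t₂.Arel × t₂.Aabs) × t₂.S) × (X₂ × bobSys P₁.order)) ℂ :=
        stageTwo m run₁ (stageOne e src ξ)
    let K : Channel (((t₂.Arel × t₂.Aabs) × t₂.S) × X₂) (s.A × bobSys P₂.order) :=
      (f.amp (bobSys P₂.order)).comp <|
        (Channel.relabel (swapEquiv t₂.A (bobSys P₂.order) X₂)).comp <|
          ((P₂.fin.amp (bobSys P₂.order)).comp (P₂.steps.run.comp P₂.input)).amp X₂
    have hL : P.op ξ = Matrix.of fun p q => d (Matrix.of fun β β' =>
        P₂.dec (Matrix.of fun γ γ' => P₁.dec (Matrix.of fun δ δ' =>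
          K (Matrix.of fun i i' => Y (i.1, (i.2, δ)) (i'.1, (i'.2, δ'))) (p.1, γ) (q.1, γ'))
            β.1 β'.1) β.2 β'.2) p.2 q.2 := by
      ext p q
      have h2 := congrArg (fun Z : Matrix ((P₂.M₁ × X₂) × bobSys (P₁.order ++ P₂.order))
        ((P₂.M₁ × X₂) × bobSys (P₁.order ++ P₂.order)) ℂ =>
          (d.comp ((P₁.dec.tensor P₂.dec).comp (Channel.relabel (bobSplit _ _))))
            (Matrix.of fun γ γ' => (f.comp (P₂.fin.amp X₂))
              (Matrix.of fun i i' => Z (i, γ) (i', γ')) p.1 q.1) p.2 q.2)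
        ((hF (P.input ξ)).trans (congrArg (fun Z => Channel.relabel (bobJoin P₂.M₁ X₂ P₁.order
          P₂.order) (P₂.steps.run.amp (X₂ × bobSys P₁.order) Z)) (hmid ξ)))
      refine h2.trans ?_
      have hb : ∀ (x : P₂.M₁) (z : X₂) (β : bobSys P₁.order × bobSys P₂.order),
          (bobJoin P₂.M₁ X₂ P₁.order P₂.order).symm
            ((x, z), (bobSplit P₁.order P₂.order).symm β) = ((x, β.2), (z, β.1)) := by
        intro x z β
        simp [bobJoin]
      let R := P₂.steps.run.amp (X₂ × bobSys P₁.order)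
        (P₂.input.amp (X₂ × bobSys P₁.order) Y)
      change d ((P₁.dec.tensor P₂.dec) (Matrix.of fun γ γ' => f (Matrix.of fun j j' => P₂.fin
        (Matrix.of fun i i' =>
          R ((bobJoin P₂.M₁ X₂ P₁.order P₂.order).symm
              ((i, j.2), (bobSplit P₁.order P₂.order).symm γ))
            ((bobJoin P₂.M₁ X₂ P₁.order P₂.order).symm
              ((i', j'.2), (bobSplit P₁.order P₂.order).symm γ'))) j.1 j'.1) p.1 q.1)) p.2 q.2 = _
      simp only [hb]
      rfl
    rw [hL]
    ext p q
    have hR : (stageThree f d P₂.op).comp ((stageTwo m P₁.op).comp (stageOne e src)) ξ p q =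
        d (Matrix.of fun β β' => f (Matrix.of fun j j' => P₂.dec (Matrix.of fun γ γ' =>
          ((P₂.fin.amp (bobSys P₂.order)).comp (P₂.steps.run.comp P₂.input))
            (Matrix.of fun i i' => stageTwo m P₁.op (stageOne e src ξ) (i, (j.2, β.1))
              (i', (j'.2, β'.1))) (j.1, γ) (j'.1, γ')) β.2 β'.2) p.1 q.1) p.2 q.2 := rfl
    rw [hR]
    simp only [hY, Matrix.of_apply]
    refine congrFun (congrFun (congrArg d.toFun ?_) p.2) q.2
    ext β β'
    refine Eq.trans ?_ (Channel.comm_apply P₂.dec f (fun γ γ' j j' => 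
          ((P₂.fin.amp (bobSys P₂.order)).comp (P₂.steps.run.comp P₂.input))
            (Matrix.of fun i i' => P₁.dec (Matrix.of fun δ δ' => Y (i, (j.2, δ)) (i', (j'.2, δ')))
              β.1 β'.1) (j.1, γ) (j'.1, γ')) β.2 β'.2 p.1 q.1).symm
    refine congrFun (congrFun (congrArg P₂.dec.toFun ?_) β.2) β'.2
    ext γ γ'
    exact (Channel.comm_apply P₁.dec K (fun δ δ' i i' => Y (i.1, (i.2, δ)) (i'.1, (i'.2, δ')))
      β.1 β'.1 (p.1, γ) (q.1, γ')).symm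
  -- The error of the first protocol, as seen in the input of the second resource.
  have hdist : ∀ (R : Sys) (ξ : Matrix (((s.Arel × s.Aabs) × s.S) × R)
      (((s.Arel × s.Aabs) × s.S) × R) ℂ), IsState ξ → testMarginal (trRight ξ) = s.ω ⊗ₖ s.ρ →
      traceNorm (((stageTwo m P₁.op).comp (stageOne e src)).amp R ξ -
        ((stageTwo m t₁.N).comp (stageOne e src)).amp R ξ) ≤ ε₁ := by
    intro R ξ hξ hm
    let Ξ := Channel.relabel (Equiv.prodAssoc ((t₁.Arel × t₁.Aabs) × t₁.S) (X₁ × t₂.S) R)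
      ((stageOne e src).amp R ξ)
    -- Everything that does not enter the first resource, including the source of the second, counts
    -- as reference; here the accuracy for arbitrary references is needed.
    have h1 := ha₁ (.of ((X₁ × t₂.S) × R)) Ξ (Channel.isState _ (Channel.isState _ hξ)) (by
      rw [← H₁ _ ((Channel.disc _ R).isState hξ) hm, Channel.disc_apply,
        ← Channel.trRight_amp (stageOne e src)]
      congr 1
      ext i j
      simp only [trRight, Matrix.of_apply, Fintype.sum_prod_type]
      rfl)
    refine le_trans (Eq.trans_le ?_ (Channel.traceNorm_le
      (((Channel.relabel (midEquiv (t₂.Arel × t₂.Aabs) X₂ t₁.B t₂.S)).comp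
        ((m.amp (t₁.B × t₂.S)).comp
          (Channel.relabel (Equiv.prodProdProdComm t₁.A t₁.B X₁ t₂.S)))).amp R |>.comp
        (Channel.relabel (Equiv.prodAssoc (t₁.A × t₁.B) (X₁ × t₂.S) R).symm)) _)) h1
    rw [Channel.map_sub]
    rfl
  refine ⟨P, fun ξ hξ hm => hst _ _ ?_ ?_, fun R ξ hξ hm => ?_⟩
  · refine hst₁ _ _ ?_
    have h1 := (hv₁ _ ((Channel.disc _ _).isState ((stageOne e src).isState hξ)) (H₁ ξ hξ hm)).mono
      (le_add_of_nonneg_right hε₂)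
    refine Eq.mp (congrArg (P₁.steps.Valid _) ?_) h1
    rw [Channel.disc_apply, ← Channel.trRight_amp P₁.input]
    ext i j
    simp only [trRight, Matrix.of_apply, Fintype.sum_prod_type]
    refine Finset.sum_congr rfl fun x _ => ?_
    refine Eq.trans ?_ (Finset.sum_congr rfl fun v _ => (hin ξ i.1 x i.2 v j.1 x j.2 v).symm)
    exact (κ₂.trace_apply (Matrix.of fun σ σ' => P₁.input.amp (X₁ × t₂.S) (stageOne e src ξ)
      (i, (x, σ)) (j, (x, σ')))).symm
  · have h1 := hv₂ _ ((Channel.disc _ _).isState ((stageTwo m t₁.N).isState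
      ((stageOne e src).isState hξ))) (H₂ ξ hξ hm)
    rw [add_comm ε₁, hmid, Channel.trRight_amp]
    -- `P₂` is valid for the ideal output of the first stage, and the actual output is `ε₁`-close to
    -- it.
    refine h1.perturb ?_
    rw [← Channel.map_sub]
    refine (Channel.traceNorm_le _ _).trans ?_
    have h2 := (Channel.traceNorm_le ((Channel.disc ((t₂.Arel × t₂.Aabs) × t₂.S) (X₂ × t₁.B)).comp
      (Channel.disc _ Unit)) _).trans (hdist (.of Unit)
        (Channel.relabel (Equiv.prodPUnit _).symm ξ) (Channel.isState _ hξ) (by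
          rw [← hm]
          congr 1
          exact trRight_unit _))
    rw [Channel.map_sub] at h2
    refine Eq.trans_le (congrArg traceNorm (congrArg₂ _ ?_ ?_)) h2
    · ext i j
      simp only [trRight, Matrix.of_apply, Fintype.sum_prod_type, Channel.comp_apply,
        Channel.disc_apply, Finset.univ_unique, Finset.sum_singleton]
      refine Finset.sum_congr rfl fun x _ => ?_
      refine Eq.trans ?_ (Finset.sum_congr rfl fun b _ => (hY ξ (i, (x, b)) (j, (x, b))).symm)
      exact (P₁.dec.trace_apply (Matrix.of fun β β' => stageTwo m run₁ (stageOne e src ξ)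
        (i, (x, β)) (j, (x, β')))).symm
    · ext i j
      refine Finset.sum_congr rfl fun x _ => ?_
      exact (congrFun (congrFun (trRight_unit (((stageTwo m t₁.N).comp (stageOne e src)).amp Unit
        (Channel.relabel (Equiv.prodPUnit _).symm ξ))) (i, x)) (j, x)).symm
  · unfold Protocol.op at hop
    have h1 := hdist R ξ hξ hm
    let Ξ := ((stageTwo m t₁.N).comp (stageOne e src)).amp R ξ
    have h2 := ha₂ (.of ((X₂ × t₁.B) × R)) (Channel.relabel
      (Equiv.prodAssoc ((t₂.Arel × t₂.Aabs) × t₂.S) (X₂ × t₁.B) R) Ξ)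
      (Channel.isState _ (Channel.isState _ hξ)) (by
        rw [← H₂ _ ((Channel.disc _ R).isState hξ) hm]
        refine Eq.trans ?_ (congrArg (fun Z => testMarginal (trRight Z)) (Channel.trRight_amp
          ((stageTwo m t₁.N).comp (stageOne e src)) ξ))
        congr 1
        ext i j
        simp only [trRight, Matrix.of_apply, Fintype.sum_prod_type]
        rfl)
    rw [show P.op = _ from hop, H₃]
    -- The hybrid in which the first resource is ideal and the second is the created one: the first
    -- replacement costs `ε₁`, the second `ε₂`.
    refine (traceNorm_sub_le _ ((stageThree f d P₂.op).amp R Ξ) _).trans (add_le_add ?_ ?_)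
    · refine le_trans (Eq.trans_le ?_ (Channel.traceNorm_le ((stageThree f d P₂.op).amp R) _)) h1
      rw [Channel.map_sub]
      rfl
    · refine le_trans (Eq.trans_le ?_ (Channel.traceNorm_le
        ((((f.tensor d).comp (Channel.relabel (lastEquiv t₂.A t₂.B X₂ t₁.B))).amp R).comp
          (Channel.relabel (Equiv.prodAssoc (t₂.A × t₂.B) (X₂ × t₁.B) R).symm)) _)) h2
      rw [Channel.map_sub]
      rfl

end twoStep

/-! ### Amplitudes of coherently extended protocols -/

theorem conj_outer {a b c : Type} [Fintype a] [Fintype b] (V : Matrix c a ℂ) (W : Matrix c b ℂ)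
    (g : a → ℂ) (h : b → ℂ) :
    V * (Matrix.of fun i j => g i * star (h j)) * Wᴴ =
      Matrix.of fun p q => (V *ᵥ g) p * star ((W *ᵥ h) q) := by
  ext p q
  simp only [Matrix.mul_apply, Matrix.of_apply, Matrix.conjTranspose_apply, Matrix.mulVec,
    dotProduct, star_sum, Finset.sum_mul, Finset.mul_sum, star_mul']
  exact Finset.sum_congr rfl fun j _ => Finset.sum_congr rfl fun i _ => by ring

theorem conj_sum_outer {a b c k : Type} [Fintype a] [Fintype b] [Fintype k] (V : Matrix c a ℂ)
    (W : Matrix c b ℂ) (g : k → a → ℂ) (h : k → b → ℂ) :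
    V * (Matrix.of fun i j => ∑ e, g e i * star (h e j)) * Wᴴ =
      Matrix.of fun p q => ∑ e, (V *ᵥ g e) p * star ((W *ᵥ h e) q) := by
  have : (Matrix.of fun i j => ∑ e, g e i * star (h e j)) =
      ∑ e, Matrix.of fun i j => g e i * star (h e j) := by
    ext
    simp [Matrix.sum_apply]
  rw [this, Matrix.mul_sum, Matrix.sum_mul]
  simp only [conj_outer]
  ext
  simp [Matrix.sum_apply]

/-- Selecting rows and columns is a compression to a coordinate subspace. It is used to single out
the right outcome of Bob. -/
theorem traceNorm_submatrix_le {a b : Type} [Fintype a] [DecidableEq a] [Fintype b]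
    [DecidableEq b] (X : Matrix a a ℂ) {ι : b → a} (hι : Function.Injective ι) :
    traceNorm (X.submatrix ι ι) ≤ traceNorm X := by
  have h : X.submatrix ι ι = ((1 : Matrix a a ℂ).submatrix ι id) * X *
      ((1 : Matrix a a ℂ).submatrix ι id)ᴴ := by
    ext i j
    simp [Matrix.mul_apply, Matrix.one_apply, apply_ite]
  rw [h]
  refine traceNorm_compress_le _ (fun v => ?_) X
  apply vnorm_le_of_sq_le
  rw [vnorm_sq, vnorm_sq]
  have h2 : ∀ i, (((1 : Matrix a a ℂ).submatrix ι id) *ᵥ v) i = v (ι i) := fun i => by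
    simp [Matrix.mulVec, dotProduct, Matrix.one_apply]
  simp only [h2]
  rw [← Finset.sum_image (f := fun k => ‖v k‖ ^ 2) (s := Finset.univ) (g := ι) (hι.injOn)]
  exact Finset.sum_le_sum_of_subset_of_nonneg (Finset.subset_univ _) fun _ _ _ => by positivity

theorem norm_trace_le_traceNorm {a : Type} [Fintype a] [DecidableEq a] (X : Matrix a a ℂ) :
    ‖X.trace‖ ≤ traceNorm X := by
  have := norm_trace_mul_le_traceNorm (M := 1)
    (isContraction_of_vnorm_le fun w => by rw [Matrix.one_mulVec]) X
  rwa [Matrix.one_mul] at this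

theorem trace_outer {a : Type} [Fintype a] (v : a → ℂ) :
    (outer v v).trace = ((vnorm v ^ 2 : ℝ) : ℂ) := by
  rw [vnorm_sq_eq_dotProduct, dotProduct_comm]
  rfl

theorem vnorm_of_isState_outer {a : Type} [Fintype a] {v : a → ℂ} (hv : IsState (outer v v)) :
    vnorm v = 1 := by
  have h := hv.trace_eq_one
  rw [trace_outer] at h
  have h2 : vnorm v ^ 2 = 1 := by exact_mod_cast h
  nlinarith [vnorm_nonneg v]

/-- Every positive operator is the restriction of a rank-one operator. -/
theorem exists_purification {a : Type} [Fintype a] {ρ : Matrix a a ℂ} (hρ : ρ.PosSemidef) :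
    ∃ (R : Sys) (v : a × R → ℂ), trRight (outer v v) = ρ := by
  obtain ⟨m, v, hv⟩ := Matrix.posSemidef_iff_eq_sum_vecMulVec.mp hρ
  -- The label `none`, with amplitude zero, makes the purifying system nonempty.
  let u : a × Option (Fin m) → ℂ := fun p => p.2.elim 0 fun k => v k p.1
  refine ⟨.of (Option (Fin m)), u, ?_⟩
  rw [hv]
  ext i j
  refine (Fintype.sum_option fun k => outer u u (i, k) (j, k)).trans ?_
  simp [u, outer, Matrix.vecMulVec_apply, Matrix.sum_apply]

namespace Protocol.CohExt

variable {l : Depth} {b c : Resource} {P : Protocol l (b.tensor c)}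

/-- The final amplitudes of the extended protocol for the message `x`. -/
def outVec (D : P.CohExt) (x : c.Arel × c.Aabs)
    (ψ : (b.Arel × b.Aabs) × srcSys P.order → ℂ) : c.B × D.Out → ℂ :=
  fun q : c.B × (((b.tensor c).A × b.B) × ((D.E₀ × D.E₁) × (D.E₂ × D.E₃))) =>
    (D.V *ᵥ fun β => (D.G x *ᵥ fun m => (D.W *ᵥ fun ms => (D.U x *ᵥ fun i => ψ (i, ms.2))
      (ms.1, q.2.2.1.1)) ((m, β), q.2.2.1.2)) (q.2.1.1, q.2.2.2.1)) ((q.2.1.2, q.1), q.2.2.2.2)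

/-- All operations of the extended protocol are isometries, so rank-one operators stay of rank one.
This allows a calculus with amplitudes. -/
theorem out_outer (D : P.CohExt) (x : c.Arel × c.Aabs)
    (ψ ψ' : (b.Arel × b.Aabs) × srcSys P.order → ℂ) :
    D.out x (outer ψ ψ') = outer (D.outVec x ψ) (D.outVec x ψ') := by
  ext p q
  have h1 : ∀ s s', D.U x * (Matrix.of fun i i' => ψ (i, s) * star (ψ' (i', s'))) * (D.U x)ᴴ = _ :=
    fun s s' => conj_outer _ _ _ _
  have h2 : ∀ e e', D.W * (Matrix.of fun (ms ms' : P.M₀ × srcSys P.order) =>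
      (D.U x * (Matrix.of fun i i' => ψ (i, ms.2) * star (ψ' (i', ms'.2))) * (D.U x)ᴴ)
        (ms.1, e) (ms'.1, e')) * D.Wᴴ = _ := fun e e' => by
    simp only [h1, Matrix.of_apply]
    exact conj_outer _ _ _ _
  have h3 : ∀ e e' f f' (β β' : bobSys P.order), D.G x * (Matrix.of fun m m' =>
      (D.W * (Matrix.of fun (ms ms' : P.M₀ × srcSys P.order) =>
      (D.U x * (Matrix.of fun i i' => ψ (i, ms.2) * star (ψ' (i', ms'.2))) * (D.U x)ᴴ)
        (ms.1, e) (ms'.1, e')) * D.Wᴴ) ((m, β), f) ((m', β'), f')) * (D.G x)ᴴ = _ :=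
      fun e e' f f' β β' => by
    simp only [h2, Matrix.of_apply]
    exact conj_outer _ _ _ _
  have h4 : ∀ e e' f f' g g' a a', D.V * (Matrix.of fun β β' => (D.G x * (Matrix.of fun m m' =>
      (D.W * (Matrix.of fun (ms ms' : P.M₀ × srcSys P.order) =>
      (D.U x * (Matrix.of fun i i' => ψ (i, ms.2) * star (ψ' (i', ms'.2))) * (D.U x)ᴴ)
        (ms.1, e) (ms'.1, e')) * D.Wᴴ) ((m, β), f) ((m', β'), f')) * (D.G x)ᴴ)
        (a, g) (a', g')) * D.Vᴴ = _ :=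
      fun e e' f f' g g' a a' => by
    simp only [h3, Matrix.of_apply]
    exact conj_outer _ _ _ _
  exact congrFun (congrFun (h4 p.2.2.1.1 q.2.2.1.1 p.2.2.1.2 q.2.2.1.2 p.2.2.2.1 q.2.2.2.1
    p.2.1.1 q.2.1.1) ((p.2.1.2, p.1), p.2.2.2.2)) ((q.2.1.2, q.1), q.2.2.2.2)

/-- The input amplitudes, for the amplitudes `v` of the input of `b` and `w` of the remaining
source systems. -/
def inVec (P : Protocol l (b.tensor c)) (v : (b.Arel × b.Aabs) × b.S → ℂ) (w : c.S × P.T → ℂ) :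
    (b.Arel × b.Aabs) × srcSys P.order → ℂ :=
  fun p => v (p.1, (P.src.symm p.2).1.1) * w ((P.src.symm p.2).1.2, (P.src.symm p.2).2)

/-- The final operator when the input operator of `b` is `Z`, in the extended protocol for the
messages `x` and `x'` on the two sides. -/
def cross (D : P.CohExt) (x x' : c.Arel × c.Aabs)
    (Z : Matrix ((b.Arel × b.Aabs) × b.S) ((b.Arel × b.Aabs) × b.S) ℂ) :
    Matrix ((b.tensor c).A × (b.B × c.B)) ((b.tensor c).A × (b.B × c.B)) ℂ :=
  Matrix.of fun p q => trRight (D.V * (Matrix.of fun β β' => trRight (D.G x *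
    (Matrix.of fun m m' => P.steps.run (Matrix.of fun s s' =>
      trRight (D.U x * (Matrix.of fun i i' => Z (i, (P.src.symm s.2).1.1)
        (i', (P.src.symm s'.2).1.1)) * (D.U x')ᴴ) s.1 s'.1 *
      (c.ρ ⊗ₖ P.τ) ((P.src.symm s.2).1.2, (P.src.symm s.2).2)
        ((P.src.symm s'.2).1.2, (P.src.symm s'.2).2)) (m, β) (m', β')) * (D.G x')ᴴ)
          p.1 q.1) * D.Vᴴ) p.2 q.2

/-- The remaining source systems are purified by `w`; what is discarded then shows up as a sum over
the labels of the environments and of the reference. Different messages on the two sides are the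
coherences needed for the coherent protocol. -/
theorem cross_outer (D : P.CohExt) (x x' : c.Arel × c.Aabs)
    (v v' : (b.Arel × b.Aabs) × b.S → ℂ) {R' : Type} [Fintype R'] (w : (c.S × P.T) × R' → ℂ)
    (hw : trRight (outer w w) = c.ρ ⊗ₖ P.τ) (p q : (b.tensor c).A × (b.B × c.B)) :
    D.cross x x' (outer v v') p q = ∑ e : (D.E₃ × D.E₂ × D.E₁ × D.E₀ × R'),
      D.outVec x (inVec P v fun t => w (t, e.2.2.2.2))
        (p.2.2, ((p.1, p.2.1), ((e.2.2.2.1, e.2.2.1), (e.2.1, e.1)))) *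
      star (D.outVec x' (inVec P v' fun t => w (t, e.2.2.2.2))
        (q.2.2, ((q.1, q.2.1), ((e.2.2.2.1, e.2.2.1), (e.2.1, e.1))))) := by
  have h1 : (Matrix.of fun (s s' : P.M₀ × srcSys P.order) =>
      trRight (D.U x * (Matrix.of fun i i' => outer v v' (i, (P.src.symm s.2).1.1)
        (i', (P.src.symm s'.2).1.1)) * (D.U x')ᴴ) s.1 s'.1 *
      (c.ρ ⊗ₖ P.τ) ((P.src.symm s.2).1.2, (P.src.symm s.2).2)
        ((P.src.symm s'.2).1.2, (P.src.symm s'.2).2)) =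
      Matrix.of fun (s s' : P.M₀ × srcSys P.order) => ∑ k : D.E₀ × R',
        (D.U x *ᵥ fun i => inVec P v (fun t => w (t, k.2)) (i, s.2)) (s.1, k.1) *
        star ((D.U x' *ᵥ fun i => inVec P v' (fun t => w (t, k.2)) (i, s'.2)) (s'.1, k.1)) := by
    ext s s'
    rw [Matrix.of_apply, Matrix.of_apply, ← hw]
    have := conj_outer (D.U x) (D.U x') (fun i => v (i, (P.src.symm s.2).1.1))
      (fun i => v' (i, (P.src.symm s'.2).1.1))
    have h0 : trRight (D.U x * (Matrix.of fun i i' => outer v v' (i, (P.src.symm s.2).1.1)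
        (i', (P.src.symm s'.2).1.1)) * (D.U x')ᴴ) s.1 s'.1 = ∑ e, _ :=
      congrArg (fun Z => trRight Z s.1 s'.1) this
    rw [h0, trRight, Matrix.of_apply, Finset.sum_mul_sum, Fintype.sum_prod_type]
    refine Finset.sum_congr rfl fun e _ => Finset.sum_congr rfl fun r _ => ?_
    have h2 : ∀ x (v : (b.Arel × b.Aabs) × b.S → ℂ) (s : P.M₀ × srcSys P.order),
        (D.U x *ᵥ fun i => inVec P v (fun t => w (t, r)) (i, s.2)) (s.1, e) =
        (D.U x *ᵥ fun i => v (i, (P.src.symm s.2).1.1)) (s.1, e) *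
          w (((P.src.symm s.2).1.2, (P.src.symm s.2).2), r) := fun x v s => by
      simp only [Matrix.mulVec, dotProduct, Finset.sum_mul, inVec, mul_assoc]
    rw [h2, h2, star_mul']
    simp only [outer, Matrix.of_apply]
    ring
  have h2 : ∀ X, P.steps.run X = trRight (D.W * X * D.Wᴴ) := fun X => (D.isDilation_W.2 X).symm
  have h3 := conj_sum_outer D.W D.W
    (fun (k : D.E₀ × R') (s : P.M₀ × srcSys P.order) =>
      (D.U x *ᵥ fun i => inVec P v (fun t => w (t, k.2)) (i, s.2)) (s.1, k.1))
    (fun (k : D.E₀ × R') (s : P.M₀ × srcSys P.order) =>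
      (D.U x' *ᵥ fun i => inVec P v' (fun t => w (t, k.2)) (i, s.2)) (s.1, k.1))
  rw [cross, h1, h2, h3]
  simp only [trRight, Matrix.of_apply]
  simp only [← Fintype.sum_prod_type' (f := fun (e : D.E₁) (k : D.E₀ × R') => _)]
  have h4 := fun β β' : bobSys P.order => conj_sum_outer (D.G x) (D.G x')
    (fun (k : D.E₁ × D.E₀ × R') m => (D.W *ᵥ fun s => (D.U x *ᵥ fun i => inVec P v
      (fun t => w (t, k.2.2)) (i, s.2)) (s.1, k.2.1)) ((m, β), k.1))
    (fun (k : D.E₁ × D.E₀ × R') m => (D.W *ᵥ fun s => (D.U x' *ᵥ fun i => inVec P v'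
      (fun t => w (t, k.2.2)) (i, s.2)) (s.1, k.2.1)) ((m, β'), k.1))
  simp only [h4, Matrix.of_apply]
  simp only [← Fintype.sum_prod_type' (f := fun (e : D.E₂) (k : D.E₁ × D.E₀ × R') => _)]
  rw [conj_sum_outer D.V D.V (fun (k : D.E₂ × D.E₁ × D.E₀ × R') β => (D.G x *ᵥ fun m =>
      (D.W *ᵥ fun s => (D.U x *ᵥ fun i => inVec P v
      (fun t => w (t, k.2.2.2)) (i, s.2)) (s.1, k.2.2.1)) ((m, β), k.2.1)) (p.1, k.1))
    (fun (k : D.E₂ × D.E₁ × D.E₀ × R') β => (D.G x' *ᵥ fun m =>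
      (D.W *ᵥ fun s => (D.U x' *ᵥ fun i => inVec P v'
      (fun t => w (t, k.2.2.2)) (i, s.2)) (s.1, k.2.2.1)) ((m, β), k.2.1)) (q.1, k.1))]
  rw [Fintype.sum_prod_type]
  rfl

end Protocol.CohExt

/-! ### Classical channels and the branches of the final amplitudes -/

/-- A resource that is a noiseless classical channel, with inputs and outputs identified
by `e`. -/
structure IsClassical (c : Resource) (e : c.Arel × c.Aabs ≃ c.B) : Prop where
  arel : Subsingleton c.Arel
  source : Subsingleton c.S
  alice : Subsingleton c.A
  apply : ∀ X (s : c.S) (p q : c.A × c.B), c.N X p q =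
    if p.2 = q.2 then X (e.symm p.2, s) (e.symm q.2, s) else 0

theorem trace_trRight {a b : Type} [Fintype a] [Fintype b] (X : Matrix (a × b) (a × b) ℂ) :
    (trRight X).trace = X.trace := by
  simp [Matrix.trace, trRight, Fintype.sum_prod_type]

theorem IsState.apply_of_subsingleton {a : Type} [Fintype a] [Subsingleton a]
    {ρ : Matrix a a ℂ} (hρ : IsState ρ) (i j : a) : ρ i j = 1 := by
  have h := hρ.trace_eq_one
  rw [Matrix.trace, Fintype.sum_subsingleton _ i] at h
  rw [← h, Subsingleton.elim j i]
  rfl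

theorem isState_single {a : Type} [Fintype a] [DecidableEq a] (x : a) :
    IsState (Matrix.single x x (1 : ℂ)) := by
  have h : Matrix.single x x (1 : ℂ) = outer (Pi.single x 1) (Pi.single x 1) := by
    ext i j
    simp only [Matrix.single_apply, outer, Matrix.of_apply, Pi.single_apply, eq_comm (a := x)]
    by_cases hi : i = x <;> by_cases hj : j = x <;> simp [hi, hj]
  refine ⟨h ▸ Matrix.posSemidef_vecMulVec_self_star _, by simp⟩

/-- The input `|x⟩⟨x|` for `c` is supplied. -/
noncomputable def supply (b c : Resource) (x : c.Arel × c.Aabs) :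
    Channel ((b.Arel × b.Aabs) × b.S)
      (((b.tensor c).Arel × (b.tensor c).Aabs) × (b.tensor c).S) :=
  (Channel.relabel (tensorInEquiv b.Arel c.Arel b.Aabs c.Aabs b.S c.S).symm).comp
    (Channel.append _ (Matrix.single x x (1 : ℂ) ⊗ₖ c.ρ) ((isState_single x).kronecker c.isState_ρ))

theorem supply_slice {b c : Resource} (x : c.Arel × c.Aabs) (Z) (s s' : (b.tensor c).S) :
    (Matrix.of fun i i' => supply b c x Z (i, s) (i', s')) =
      c.ρ s.2 s'.2 • msgInsert x (Matrix.of fun i i' => Z (i, s.1) (i', s'.1)) := by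
  ext i j
  change Z _ _ * (Matrix.single x x (1 : ℂ) (i.1.2, i.2.2) (j.1.2, j.2.2) * c.ρ s.2 s'.2) =
    c.ρ s.2 s'.2 * (if _ then _ else 0)
  rw [Matrix.single_apply]
  by_cases h : (i.1.2, i.2.2) = x ∧ (j.1.2, j.2.2) = x
  · rw [if_pos h, if_pos ⟨h.1.symm, h.2.symm⟩, one_mul]
    exact mul_comm _ _
  · rw [if_neg h, if_neg fun h' => h ⟨h'.1.symm, h'.2.symm⟩]
    ring

theorem tensor_supply {b c : Resource} {e : c.Arel × c.Aabs ≃ c.B} (hc : IsClassical c e)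
    (x : c.Arel × c.Aabs) (Z) (p q : (b.A × c.A) × (b.B × c.B)) :
    (b.tensor c).N (supply b c x Z) p q =
      if p.2.2 = e x ∧ q.2.2 = e x then b.N Z (p.1.1, p.2.1) (q.1.1, q.2.1) else 0 := by
  have h1 : (b.tensor c).N (supply b c x Z) p q =
      (b.N.tensor c.N (Z ⊗ₖ (Matrix.single x x (1 : ℂ) ⊗ₖ c.ρ)))
        ((p.1.1, p.2.1), (p.1.2, p.2.2)) ((q.1.1, q.2.1), (q.1.2, q.2.2)) := rfl
  rw [h1, Channel.tensor_kronecker, Matrix.kroneckerMap_apply, hc.apply _ (Classical.arbitrary c.S)]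
  have : Subsingleton c.S := hc.source
  simp only [Matrix.kroneckerMap_apply, c.isState_ρ.apply_of_subsingleton, Matrix.single_apply,
    Equiv.eq_symm_apply, @eq_comm _ (e x)]
  by_cases h1 : p.2.2 = e x <;> by_cases h2 : q.2.2 = e x <;> simp [h1, h2]

/-- A classical channel has no test system, so each basis message completes an admissible input of
`b` to one of `b.tensor c`. -/
theorem testMarginal_supply {b c : Resource} {e : c.Arel × c.Aabs ≃ c.B} (hc : IsClassical c e)
    (x : c.Arel × c.Aabs) (Z) (hZ : testMarginal Z = b.ω ⊗ₖ b.ρ) :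
    testMarginal (supply b c x Z) = (b.tensor c).ω ⊗ₖ (b.tensor c).ρ := by
  have : Subsingleton c.Arel := hc.arel
  ext ⟨⟨r, r'⟩, s, s'⟩ ⟨⟨t, t'⟩, u, u'⟩
  have hr : ∀ i j : c.Arel, i = j := fun i j => Subsingleton.elim i j
  change ∑ k : b.Aabs × c.Aabs, Z ((r, k.1), s) ((t, k.1), u) *
    (Matrix.single x x (1 : ℂ) (r', k.2) (t', k.2) * c.ρ s' u') =
      (b.ω r t * c.ω r' t') * (b.ρ s u * c.ρ s' u')
  have h1 := congrFun (congrFun hZ (r, s)) (t, u)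
  have h2 : ∑ k : c.Aabs, Matrix.single x x (1 : ℂ) (r', k) (t', k) = 1 := by
    rw [Finset.sum_eq_single x.2]
    · rw [hr r' x.1, hr t' x.1]
      simp
    · intro k _ hk
      rw [Matrix.single_apply, if_neg]
      intro h
      exact hk (congrArg Prod.snd h.1).symm
    · simp
  rw [Fintype.sum_prod_type]
  simp only [← mul_assoc, ← Finset.sum_mul]
  simp only [mul_assoc, ← Finset.mul_sum]
  rw [← Finset.sum_mul, h2, c.isState_ω.apply_of_subsingleton]
  have h3 : ∑ k, Z ((r, k), s) ((t, k), u) = b.ω r t * b.ρ s u := h1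
  refine (congrArg (fun t => t * 1 * c.ρ s' u') h3).trans ?_
  ring

namespace Protocol.CohExt

variable {l : Depth} {b c : Resource} {P : Protocol l (b.tensor c)}

/-- The link between the extension and the protocol itself. Only entries with equal outcomes `y` are
compared, since `D.V` extends Bob's instrument before the dephasing. -/
theorem op_supply (D : P.CohExt) (x : c.Arel × c.Aabs) (Z) (a a' : (b.tensor c).A) (z z' : b.B)
    (y : c.B) :
    P.op (supply b c x Z) (a, (z, y)) (a', (z', y)) = D.cross x x Z (a, (z, y)) (a', (z', y)) := by
  have h1 : ∀ X, P.fin X = trRight (D.G x * X * (D.G x)ᴴ) := fun X => ((D.isDilation_G x).2 X).symm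
  have h2 : ∀ X, P.enc (msgInsert x X) = trRight (D.U x * X * (D.U x)ᴴ) :=
    fun X => ((D.isDilation_U x).2 X).symm
  have h4 : P.op (supply b c x Z) (a, (z, y)) (a', (z', y)) =
      P.dec (Matrix.of fun β β' => P.fin (Matrix.of fun m m' => P.steps.run (Matrix.of fun s s' =>
        P.enc (Matrix.of fun i i' => supply b c x Z (i, (P.src.symm s.2).1)
          (i', (P.src.symm s'.2).1)) s.1 s'.1 * P.τ (P.src.symm s.2).2 (P.src.symm s'.2).2)
          (m, β) (m', β')) a a') (z, y) (z', y) := rfl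
  rw [h4, ← D.instrument_V]
  simp only [supply_slice, Channel.map_smul, h2, h1, cross, Matrix.of_apply, Matrix.smul_apply, smul_eq_mul,
    Matrix.kroneckerMap_apply]
  congr! 15 with β β' m m' s
  ext s'
  ring

/-- The final amplitudes, the references included. -/
def finVec (D : P.CohExt) (x : c.Arel × c.Aabs) {R R' : Sys}
    (v : ((b.Arel × b.Aabs) × b.S) × R → ℂ) (w : (c.S × P.T) × R' → ℂ) :
    c.B × D.Rest R R' → ℂ :=
  fun q : c.B × (D.Out × (R × R')) =>
    D.outVec x (inVec P (fun i => v (i, q.2.2.1)) fun t => w (t, q.2.2.2)) (q.1, q.2.1)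

theorem stateOf_outer (D : P.CohExt) (x : c.Arel × c.Aabs) {R R' : Sys}
    (v : ((b.Arel × b.Aabs) × b.S) × R → ℂ) (w : (c.S × P.T) × R' → ℂ) :
    D.stateOf x (outer v v) (outer w w) = outer (D.finVec x v w) (D.finVec x v w) := by
  ext p q
  have h := congrFun (congrFun (D.out_outer x
    (inVec P (fun i => v (i, p.2.2.1)) fun t => w (t, p.2.2.2))
    (inVec P (fun i => v (i, q.2.2.1)) fun t => w (t, q.2.2.2))) (p.1, p.2.1)) (q.1, q.2.1)
  refine Eq.trans ?_ h
  refine congrFun (congrFun (congrArg (D.out x).toFun ?_) (p.1, p.2.1)) (q.1, q.2.1)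
  ext i j
  simp only [outer, inVec, Matrix.of_apply, star_mul']
  exact mul_mul_mul_comm _ _ _ _

/-- The squared norms are traces of the rank-one operators, and the extended protocol preserves the
trace. -/
theorem vnorm_finVec (D : P.CohExt) (x : c.Arel × c.Aabs) {R R' : Sys}
    (v : ((b.Arel × b.Aabs) × b.S) × R → ℂ) (w : (c.S × P.T) × R' → ℂ) :
    vnorm (D.finVec x v w) = vnorm v * vnorm w := by
  have h := congrArg Matrix.trace (D.stateOf_outer x v w)
  have h1 : (D.stateOf x (outer v v) (outer w w)).trace = (outer v v ⊗ₖ outer w w).trace :=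
    (Channel.trace_apply _ _).trans ((Channel.trace_apply _ _).trans
      ((Channel.trace_apply _ _).trans (Channel.trace_apply _ _)))
  rw [trace_outer, h1, Matrix.trace_kronecker, trace_outer, trace_outer, ← Complex.ofReal_mul,
    ← mul_pow] at h
  have h2 := Complex.ofReal_injective h
  exact ((sq_eq_sq₀ (mul_nonneg (vnorm_nonneg _) (vnorm_nonneg _)) (vnorm_nonneg _)).mp h2).symm

theorem outVec_smul (D : P.CohExt) (x : c.Arel × c.Aabs) (z : ℂ)
    (ψ : (b.Arel × b.Aabs) × srcSys P.order → ℂ) :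
    D.outVec x (z • ψ) = z • D.outVec x ψ := by
  have hm : ∀ {a b : Type} [Fintype b] (V : Matrix a b ℂ) (ψ : b → ℂ),
    (V *ᵥ fun i => z • ψ i) = fun i => z • (V *ᵥ ψ) i := fun V ψ => V.mulVec_smul z ψ
  ext q
  simp only [outVec, Pi.smul_apply, hm]

theorem finVec_smul (D : P.CohExt) (x : c.Arel × c.Aabs) {R R' : Sys} (z : ℂ)
    (v : ((b.Arel × b.Aabs) × b.S) × R → ℂ) (w : (c.S × P.T) × R' → ℂ) :
    D.finVec x (z • v) w = z • D.finVec x v w := by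
  have h : ∀ (r : R) (w : c.S × P.T → ℂ), inVec P (fun i => (z • v) (i, r)) w =
      z • inVec P (fun i => v (i, r)) w := fun r w => by
    ext p
    simp [inVec, mul_assoc]
  funext q
  exact congrFun ((congrArg (D.outVec x) (h q.2.2.1 fun t => w (t, q.2.2.2))).trans
    (D.outVec_smul x z _)) (q.1, q.2.1)

/-- The environments of the extended protocol, with the reference of the remaining sources. -/
abbrev Env (D : P.CohExt) (R' : Sys) : Type := D.E₃ × D.E₂ × D.E₁ × D.E₀ × R'

/-- Regrouping of `Q E` if Alice's output of `c` is null. -/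
noncomputable def restEquiv (D : P.CohExt) (h : Subsingleton c.A) (R R' : Sys) :
    D.Rest R R' ≃ ((b.A × b.B) × R) × D.Env R' where
  toFun q := (((q.1.1.1.1, q.1.1.2), q.2.1), (q.1.2.2.2, q.1.2.2.1, q.1.2.1.2, q.1.2.1.1, q.2.2))
  invFun p := ((((p.1.1.1, Classical.arbitrary c.A), p.1.1.2),
    ((p.2.2.2.2.1, p.2.2.2.1), (p.2.2.1, p.2.1))), (p.1.2, p.2.2.2.2.2))
  left_inv q := by
    have : q.1.1.1.2 = Classical.arbitrary c.A := Subsingleton.elim _ _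
    simp only [← this]
    rfl
  right_inv p := rfl

/-- The component of the final amplitudes with outcome `y`. -/
noncomputable def branch (D : P.CohExt) (h : Subsingleton c.A) (x : c.Arel × c.Aabs) (y : c.B)
    {R R' : Sys} (v : ((b.Arel × b.Aabs) × b.S) × R → ℂ) (w : (c.S × P.T) × R' → ℂ) :
    ((b.A × b.B) × R) × D.Env R' → ℂ :=
  fun p => D.finVec x v w (y, (D.restEquiv h R R').symm p)

theorem cross_amp_outer (D : P.CohExt) (h : Subsingleton c.A) (x x' : c.Arel × c.Aabs)
    {R R' : Sys} (v v' : ((b.Arel × b.Aabs) × b.S) × R → ℂ) (w : (c.S × P.T) × R' → ℂ)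
    (hw : trRight (outer w w) = c.ρ ⊗ₖ P.τ) (a a' : b.A) (k k' : c.A) (z z' : b.B) (y y' : c.B)
    (r r' : R) :
    D.cross x x' (Matrix.of fun i i' => v (i, r) * star (v' (i', r'))) ((a, k), (z, y))
        ((a', k'), (z', y')) =
      ∑ e, D.branch h x y v w (((a, z), r), e) * star (D.branch h x' y' v' w (((a', z'), r'), e)) := by
  obtain rfl : k = Classical.arbitrary c.A := Subsingleton.elim _ _
  obtain rfl : k' = Classical.arbitrary c.A := Subsingleton.elim _ _
  exact D.cross_outer x x' (fun i => v (i, r)) (fun i => v' (i, r')) w hw _ _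

/-- For the message `x`, the branch with the right outcome is close to the operation of `b`. -/
theorem branch_close {ε : ℝ} (hP : P.Accurate ε) {e : c.Arel × c.Aabs ≃ c.B}
    (hc : IsClassical c e) (D : P.CohExt) (x : c.Arel × c.Aabs) {R R' : Sys}
    (v : ((b.Arel × b.Aabs) × b.S) × R → ℂ) (hv : IsState (outer v v))
    (hm : testMarginal (trRight (outer v v)) = b.ω ⊗ₖ b.ρ)
    (w : (c.S × P.T) × R' → ℂ) (hw : trRight (outer w w) = c.ρ ⊗ₖ P.τ) :
    traceNorm (trRight (outer (D.branch hc.alice x (e x) v w) (D.branch hc.alice x (e x) v w)) -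
      b.N.amp R (outer v v)) ≤ ε := by
  have h1 := hP R ((supply b c x).amp R (outer v v)) (Channel.isState _ hv) (by
    rw [Channel.trRight_amp]
    exact testMarginal_supply hc x _ hm)
  -- The coordinate subspace of the right outcome `e x`. On it the ideal output is that of `b`, and
  -- the protocol gives the branch.
  let ι : (b.A × b.B) × R → (((b.tensor c).A × (b.tensor c).B) × R) := fun p =>
    (((p.1.1, Classical.arbitrary c.A), (p.1.2, e x)), p.2)
  have hι : Function.Injective ι := fun p q hpq =>
    Prod.ext (Prod.ext (congrArg (fun t => t.1.1.1) hpq) (congrArg (fun t => t.1.2.1) hpq))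
      (by have := congrArg Prod.snd hpq; exact this)
  refine Eq.trans_le (congrArg traceNorm ?_) ((traceNorm_submatrix_le _ hι).trans h1)
  ext p q
  rw [Matrix.sub_apply, Matrix.submatrix_apply, Matrix.sub_apply]
  congr 1
  · refine Eq.trans ?_ (D.op_supply x (Matrix.of fun i i' => v (i, p.2) * star (v (i', q.2)))
      (p.1.1, Classical.arbitrary c.A) (q.1.1, Classical.arbitrary c.A) p.1.2 q.1.2 (e x)).symm
    exact (D.cross_amp_outer hc.alice x x v v w hw _ _ _ _ _ _ _ _ _ _).symm
  · have := tensor_supply hc x (Matrix.of fun i i' => v (i, p.2) * star (v (i', q.2))) (ι p).1 (ι q).1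
    rw [if_pos ⟨rfl, rfl⟩] at this
    exact this.symm

theorem vnorm_branch_sq (D : P.CohExt) (h : Subsingleton c.A) (x : c.Arel × c.Aabs) (y : c.B)
    {R R' : Sys} (v : ((b.Arel × b.Aabs) × b.S) × R → ℂ) (w : (c.S × P.T) × R' → ℂ) :
    vnorm (D.branch h x y v w) ^ 2 = ∑ q, ‖D.finVec x v w (y, q)‖ ^ 2 := by
  rw [vnorm_sq, ← (D.restEquiv h R R').sum_comp]
  simp only [branch, Equiv.symm_apply_apply]

theorem sum_vnorm_branch_sq (D : P.CohExt) (h : Subsingleton c.A) (x : c.Arel × c.Aabs)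
    {R R' : Sys} (v : ((b.Arel × b.Aabs) × b.S) × R → ℂ) (w : (c.S × P.T) × R' → ℂ) :
    ∑ y, vnorm (D.branch h x y v w) ^ 2 = (vnorm v * vnorm w) ^ 2 := by
  simp only [vnorm_branch_sq]
  rw [← Fintype.sum_prod_type', ← vnorm_finVec D x, vnorm_sq]

/-- The right outcome has probability close to one. -/
theorem le_vnorm_branch_sq {ε : ℝ} (hP : P.Accurate ε) {e : c.Arel × c.Aabs ≃ c.B}
    (hc : IsClassical c e) (D : P.CohExt) (x : c.Arel × c.Aabs) {R R' : Sys}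
    (v : ((b.Arel × b.Aabs) × b.S) × R → ℂ) (hv : IsState (outer v v))
    (hm : testMarginal (trRight (outer v v)) = b.ω ⊗ₖ b.ρ)
    (w : (c.S × P.T) × R' → ℂ) (hw : trRight (outer w w) = c.ρ ⊗ₖ P.τ) :
    1 - ε ≤ vnorm (D.branch hc.alice x (e x) v w) ^ 2 := by
  have h := (norm_trace_le_traceNorm _).trans (branch_close hP hc D x v hv hm w hw)
  rw [Matrix.trace_sub, Channel.trace_apply, trace_trRight, trace_outer,
    hv.trace_eq_one, ← Complex.ofReal_one, ← Complex.ofReal_sub, Complex.norm_real,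
    Real.norm_eq_abs] at h
  linarith [(abs_le.mp h).1]

end Protocol.CohExt

/-! ### Decoupling determines the branches up to phases -/

theorem dotProduct_mulVec_embed {a b : Type} [Fintype a] [Fintype b] [DecidableEq a]
    (X : Matrix (a × b) (a × b) ℂ) (i : a) (t : b → ℂ) :
    (star fun p : a × b => if p.1 = i then t p.2 else 0) ⬝ᵥ
        (X *ᵥ fun p : a × b => if p.1 = i then t p.2 else 0) =
      star t ⬝ᵥ ((Matrix.of fun q q' => X (i, q) (i, q')) *ᵥ t) := by
  simp [dotProduct, Matrix.mulVec, Fintype.sum_prod_type, apply_ite, Pi.star_apply, ite_mul]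

theorem vnorm_embed {a b : Type} [Fintype a] [Fintype b] [DecidableEq a] (i : a) (t : b → ℂ) :
    vnorm (fun p : a × b => if p.1 = i then t p.2 else 0) = vnorm t := by
  have : vnorm (fun p : a × b => if p.1 = i then t p.2 else 0) ^ 2 = vnorm t ^ 2 := by
    rw [vnorm_sq, vnorm_sq, Fintype.sum_prod_type]
    simp [apply_ite]
  exact (sq_eq_sq₀ (vnorm_nonneg _) (vnorm_nonneg _)).mp this

/-- The equal mixture of two messages. -/
noncomputable def mix {a : Type} [DecidableEq a] (x y : a) : Matrix a a ℂ :=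
  (2⁻¹ : ℂ) • (Matrix.single x x (1 : ℂ) + Matrix.single y y 1)

theorem isState_mix {a : Type} [Fintype a] [DecidableEq a] (x y : a) : IsState (mix x y) := by
  refine ⟨((isState_single x).posSemidef.add (isState_single y).posSemidef).smul (by
    simp), ?_⟩
  rw [mix, Matrix.trace_smul, Matrix.trace_add, (isState_single x).trace_eq_one,
    (isState_single y).trace_eq_one, smul_eq_mul]
  norm_num

/-- The pure input with amplitudes `v` extends the test and source states of `b`. -/
structure IsInput (b : Resource) {R : Sys} (v : ((b.Arel × b.Aabs) × b.S) × R → ℂ) : Prop where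
  isState : IsState (outer v v)
  marginal : testMarginal (trRight (outer v v)) = b.ω ⊗ₖ b.ρ

theorem testMarginal_add {r a s : Type} [Fintype a]
    (X Y : Matrix ((r × a) × s) ((r × a) × s) ℂ) :
    testMarginal (X + Y) = testMarginal X + testMarginal Y := by
  ext p q
  simp [testMarginal, Finset.sum_add_distrib]

theorem testMarginal_smul {r a s : Type} [Fintype a] (z : ℂ)
    (X : Matrix ((r × a) × s) ((r × a) × s) ℂ) :
    testMarginal (z • X) = z • testMarginal X := by
  ext p q
  simp [testMarginal, Finset.mul_sum]

/-- The equal superposition of two inputs with orthogonal references. -/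
noncomputable def superpose {i : Type} {R₁ R₂ : Sys} (v₁ : i × R₁ → ℂ) (v₂ : i × R₂ → ℂ) :
    i × (Sys.of (R₁ ⊕ R₂)) → ℂ :=
  fun p => Sum.elim (fun r => (((√2 : ℝ) : ℂ)⁻¹ • v₁) (p.1, r))
    (fun r => (((√2 : ℝ) : ℂ)⁻¹ • v₂) (p.1, r)) p.2

theorem inv_sqrt_two_mul_star :
    (((√2 : ℝ) : ℂ)⁻¹) * star (((√2 : ℝ) : ℂ)⁻¹) = 2⁻¹ := by
  rw [star_inv₀, Complex.star_def, Complex.conj_ofReal, ← mul_inv, ← Complex.ofReal_mul,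
    Real.mul_self_sqrt (by norm_num)]
  norm_num

theorem trRight_outer_superpose {i : Type} [Fintype i] {R₁ R₂ : Sys} (v₁ : i × R₁ → ℂ)
    (v₂ : i × R₂ → ℂ) : trRight (outer (superpose v₁ v₂) (superpose v₁ v₂)) =
      (2⁻¹ : ℂ) • (trRight (outer v₁ v₁) + trRight (outer v₂ v₂)) := by
  ext p q
  have h : ∀ z z' : ℂ, (((√2 : ℝ) : ℂ)⁻¹ * z) * star (((√2 : ℝ) : ℂ)⁻¹ * z') =
      2⁻¹ * (z * star z') := fun z z' => by
    rw [star_mul', mul_mul_mul_comm, inv_sqrt_two_mul_star]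
  refine (Fintype.sum_sum_type _).trans ?_
  change (∑ r, (((√2 : ℝ) : ℂ)⁻¹ * v₁ (p, r)) * star (((√2 : ℝ) : ℂ)⁻¹ * v₁ (q, r))) +
    (∑ r, (((√2 : ℝ) : ℂ)⁻¹ * v₂ (p, r)) * star (((√2 : ℝ) : ℂ)⁻¹ * v₂ (q, r))) = _
  simp only [h, ← Finset.mul_sum, ← mul_add]
  rfl

/-- As the references are orthogonal, the marginal of the superposition is the average of the
marginals. Two inputs can so be compared within one admissible input. -/
theorem IsInput.superpose {b : Resource} {R₁ R₂ : Sys} {v₁ : ((b.Arel × b.Aabs) × b.S) × R₁ → ℂ}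
    {v₂ : ((b.Arel × b.Aabs) × b.S) × R₂ → ℂ} (h₁ : IsInput b v₁) (h₂ : IsInput b v₂) :
    IsInput b (superpose v₁ v₂) := by
  have h := trRight_outer_superpose v₁ v₂
  refine ⟨⟨Matrix.posSemidef_vecMulVec_self_star _, ?_⟩, ?_⟩
  · rw [← trace_trRight, h, Matrix.trace_smul, Matrix.trace_add, trace_trRight, trace_trRight,
      h₁.isState.trace_eq_one, h₂.isState.trace_eq_one, smul_eq_mul]
    norm_num
  · rw [h, testMarginal_smul, testMarginal_add, h₁.marginal, h₂.marginal, ← two_smul ℂ, smul_smul]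
    norm_num

/-- The parallelogram law: two points of the unit disc whose midpoint is close to the circle are
close to each other. -/
theorem norm_sub_le_of_norm_add {f g : ℂ} {η : ℝ} (hf : ‖f‖ ≤ 1) (hg : ‖g‖ ≤ 1)
    (h : 1 - η ≤ ‖2⁻¹ * (f + g)‖ ^ 2) : ‖f - g‖ ≤ 2 * √η := by
  have h1 := parallelogram_law_with_norm ℝ f g
  rw [norm_mul, mul_pow, norm_inv, Complex.norm_two] at h
  have h2 : ‖f - g‖ ^ 2 ≤ 4 * η := by nlinarith [norm_nonneg f, norm_nonneg g]
  have h0 : 0 ≤ η := by nlinarith [sq_nonneg ‖f - g‖]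
  refine le_of_sq_le_sq ?_ (by positivity)
  rw [mul_pow, Real.sq_sqrt h0]
  linarith

theorem vnorm_smul_sub_sq_le {a : Type} [Fintype a] {A B : a → ℂ} {u : ℂ} (hu : ‖u‖ = 1)
    (hA : vnorm A ≤ 1) (hB : vnorm B ≤ 1) :
    vnorm (u • A - B) ^ 2 ≤ 2 - 2 * (u * (star B ⬝ᵥ A)).re := by
  have h : ((vnorm (u • A - B) ^ 2 : ℝ) : ℂ) = ((vnorm A ^ 2 : ℝ) : ℂ) + ((vnorm B ^ 2 : ℝ) : ℂ) -
      (u * (star B ⬝ᵥ A) + star (u * (star B ⬝ᵥ A))) := by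
    have hu' : star u * u = 1 := by
      rw [Complex.star_def, ← Complex.normSq_eq_conj_mul_self, Complex.normSq_eq_norm_sq, hu]
      simp
    have hBA : star (star B ⬝ᵥ A) = star A ⬝ᵥ B := by
      rw [← Matrix.star_dotProduct]
    rw [vnorm_sq_eq_dotProduct, vnorm_sq_eq_dotProduct, vnorm_sq_eq_dotProduct, star_sub,
      star_smul, sub_dotProduct, dotProduct_sub, dotProduct_sub, smul_dotProduct, smul_dotProduct,
      dotProduct_smul, dotProduct_smul, star_mul', hBA]
    simp only [smul_eq_mul]
    linear_combination (star A ⬝ᵥ A) * hu'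
  have h2 := congrArg Complex.re h
  simp only [Complex.ofReal_re, Complex.add_re, Complex.sub_re, Complex.star_def,
    Complex.conj_re] at h2
  nlinarith [vnorm_nonneg A, vnorm_nonneg B]

namespace Protocol.CohExt

variable {l : Depth} {b c : Resource} {P : Protocol l (b.tensor c)}

/-- The bound on the deviation of the final state from a product state in the definition of
coherent decoupling. -/
def Decoupled (D : P.CohExt) (ε : ℝ) : Prop :=
  ∀ μ : Matrix (c.Arel × c.Aabs) (c.Arel × c.Aabs) ℂ, IsState μ → trRight μ = c.ω →
  ∀ (R : Sys)
    (ξ : Matrix (((b.Arel × b.Aabs) × b.S) × R) (((b.Arel × b.Aabs) × b.S) × R) ℂ),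
    IsState ξ → testMarginal (trRight ξ) = b.ω ⊗ₖ b.ρ →
  ∀ (R' : Sys) (ψ : Matrix ((c.S × P.T) × R') ((c.S × P.T) × R') ℂ),
    IsState ψ → trRight ψ = c.ρ ⊗ₖ P.τ →
  traceNorm (D.sigma (fun x => μ x x) ξ ψ -
    trRight (D.sigma (fun x => μ x x) ξ ψ) ⊗ₖ trLeft (D.sigma (fun x => μ x x) ξ ψ)) ≤ ε

/-- The component of the final amplitudes with outcome `y`, before regrouping. -/
def leg (D : P.CohExt) (x : c.Arel × c.Aabs) (y : c.B) {R R' : Sys}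
    (v : ((b.Arel × b.Aabs) × b.S) × R → ℂ) (w : (c.S × P.T) × R' → ℂ) : D.Rest R R' → ℂ :=
  fun q => D.finVec x v w (y, q)

theorem vnorm_leg_sq (D : P.CohExt) (h : Subsingleton c.A) (x : c.Arel × c.Aabs) (y : c.B)
    {R R' : Sys} (v : ((b.Arel × b.Aabs) × b.S) × R → ℂ) (w : (c.S × P.T) × R' → ℂ) :
    vnorm (D.leg x y v w) ^ 2 = vnorm (D.branch h x y v w) ^ 2 := by
  rw [vnorm_branch_sq, vnorm_sq]
  rfl

theorem leg_le_one (D : P.CohExt) (x : c.Arel × c.Aabs) (y : c.B) {R R' : Sys}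
    {v : ((b.Arel × b.Aabs) × b.S) × R → ℂ} (hv : vnorm v = 1) {w : (c.S × P.T) × R' → ℂ}
    (hw : vnorm w = 1) : vnorm (D.leg x y v w) ≤ 1 := by
  have h1 := D.vnorm_finVec x v w
  rw [hv, hw, one_mul] at h1
  rw [← h1]
  refine vnorm_le_of_sq_le ?_
  rw [vnorm_sq, vnorm_sq, Fintype.sum_prod_type]
  exact Finset.single_le_sum (f := fun y => ∑ q, ‖D.finVec x v w (y, q)‖ ^ 2)
    (fun _ _ => Finset.sum_nonneg fun _ _ => sq_nonneg _) (Finset.mem_univ y)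

/-- The deviation from a product is evaluated in `|x⟩|y⟩ ⊗ t`. In the block of `(x, y)` the state is
`p x` times the projector on the leg, while the product state contributes `p x * ‖leg‖ ^ 2` times
the state of `Q E`. -/
theorem decoupled_test (D : P.CohExt) (p : c.Arel × c.Aabs → ℂ) {R R' : Sys}
    (v : ((b.Arel × b.Aabs) × b.S) × R → ℂ) (w : (c.S × P.T) × R' → ℂ) {ε : ℝ}
    (h : traceNorm (D.sigma p (outer v v) (outer w w) -
      trRight (D.sigma p (outer v v) (outer w w)) ⊗ₖ
        trLeft (D.sigma p (outer v v) (outer w w))) ≤ ε)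
    (x : c.Arel × c.Aabs) (y : c.B) {t : D.Rest R R' → ℂ} (ht : vnorm t ≤ 1) :
    ‖p x * (‖star t ⬝ᵥ D.leg x y v w‖ ^ 2 - vnorm (D.leg x y v w) ^ 2 *
      (star t ⬝ᵥ (trLeft (D.sigma p (outer v v) (outer w w)) *ᵥ t)))‖ ≤ ε := by
  refine le_trans (le_of_eq (congrArg norm ?_))
    ((norm_dotProduct_mulVec_le_traceNorm _ (v := fun q : ((c.Arel × c.Aabs) × c.B) × D.Rest R R' =>
      if q.1 = (x, y) then t q.2 else 0) ((vnorm_embed _ _).trans_le ht)).trans h)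
  rw [dotProduct_mulVec_embed]
  have h1 : (Matrix.of fun q q' => (D.sigma p (outer v v) (outer w w) -
      trRight (D.sigma p (outer v v) (outer w w)) ⊗ₖ
        trLeft (D.sigma p (outer v v) (outer w w))) ((x, y), q) ((x, y), q')) =
      p x • outer (D.leg x y v w) (D.leg x y v w) - (p x * ((vnorm (D.leg x y v w) ^ 2 : ℝ) : ℂ)) •
        trLeft (D.sigma p (outer v v) (outer w w)) := by
    have h2 : ∀ q q', D.sigma p (outer v v) (outer w w) ((x, y), q) ((x, y), q') =
        p x * outer (D.leg x y v w) (D.leg x y v w) q q' := by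
      intro q q'
      simp only [sigma, Matrix.of_apply, if_true, stateOf_outer]
      rfl
    ext q q'
    simp only [Matrix.of_apply, Matrix.sub_apply, Matrix.smul_apply, smul_eq_mul,
      Matrix.kroneckerMap_apply, h2]
    congr 2
    rw [trRight, Matrix.of_apply]
    simp only [h2, ← Finset.mul_sum]
    rw [← trace_outer]
    rfl
  have h3 : star t ⬝ᵥ (outer (D.leg x y v w) (D.leg x y v w) *ᵥ t) =
      ((‖star t ⬝ᵥ D.leg x y v w‖ ^ 2 : ℝ) : ℂ) := by
    have h4 : outer (D.leg x y v w) (D.leg x y v w) *ᵥ t =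
        (star (D.leg x y v w) ⬝ᵥ t) • D.leg x y v w := by
      ext q
      simp only [Matrix.mulVec, dotProduct, outer, Matrix.of_apply, Pi.smul_apply, smul_eq_mul,
        Finset.sum_mul, Pi.star_apply]
      exact Finset.sum_congr rfl fun _ _ => by ring
    rw [h4, dotProduct_smul, smul_eq_mul, ← Complex.normSq_eq_norm_sq,
      Complex.normSq_eq_conj_mul_self, ← Complex.star_def, ← Matrix.star_dotProduct]
  rw [h1, Matrix.sub_mulVec, dotProduct_sub, Matrix.smul_mulVec, Matrix.smul_mulVec,
    dotProduct_smul, dotProduct_smul, h3]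
  push_cast
  simp only [smul_eq_mul]
  ring

/-- The overlap of the final amplitudes for the messages `x` and `x₀`. -/
def overlap (D : P.CohExt) (e : c.Arel × c.Aabs ≃ c.B) (x₀ x : c.Arel × c.Aabs) {R R' : Sys}
    (v : ((b.Arel × b.Aabs) × b.S) × R → ℂ) (w : (c.S × P.T) × R' → ℂ) : ℂ :=
  star (D.leg x₀ (e x₀) v w) ⬝ᵥ D.leg x (e x) v w

theorem norm_overlap_le (D : P.CohExt) (e : c.Arel × c.Aabs ≃ c.B) (x₀ x : c.Arel × c.Aabs)
    {R R' : Sys} {v : ((b.Arel × b.Aabs) × b.S) × R → ℂ} (hv : vnorm v = 1)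
    {w : (c.S × P.T) × R' → ℂ} (hw : vnorm w = 1) : ‖D.overlap e x₀ x v w‖ ≤ 1 :=
  (norm_dotProduct_le _ _).trans
    (mul_le_one₀ (D.leg_le_one _ _ hv hw) (vnorm_nonneg _) (D.leg_le_one _ _ hv hw))

/-- The mixture of `x` and `x₀` is tested on the leg `t` of `x₀`. The block of `x₀` shows that the
state of `Q E` has expectation nearly one in `t`; the block of `x` then forces the leg of `x` to lie
almost along `t`. -/
theorem le_norm_overlap_sq {ε : ℝ} (hε₁ : ε ≤ 1 / 8) (hP : P.Accurate ε)
    {e : c.Arel × c.Aabs ≃ c.B} (hc : IsClassical c e) (D : P.CohExt) (hD : D.Decoupled ε)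
    (x₀ x : c.Arel × c.Aabs) {R R' : Sys} {v : ((b.Arel × b.Aabs) × b.S) × R → ℂ}
    (hv : IsInput b v) {w : (c.S × P.T) × R' → ℂ} (hw : trRight (outer w w) = c.ρ ⊗ₖ P.τ) :
    1 - 8 * ε ≤ ‖D.overlap e x₀ x v w‖ ^ 2 := by
  have hw' : IsState (outer w w) := ⟨Matrix.posSemidef_vecMulVec_self_star _, by
    rw [← trace_trRight, hw]
    exact (c.isState_ρ.kronecker P.isState_τ).trace_eq_one⟩
  have hv1 := vnorm_of_isState_outer hv.isState
  have hw1 := vnorm_of_isState_outer hw'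
  have hA := le_vnorm_branch_sq hP hc D x v hv.isState hv.marginal w hw
  have hB := le_vnorm_branch_sq hP hc D x₀ v hv.isState hv.marginal w hw
  rw [← vnorm_leg_sq] at hA hB
  have hA1 := pow_le_one₀ (vnorm_nonneg _) (D.leg_le_one x (e x) hv1 hw1) (n := 2)
  have hB1 := pow_le_one₀ (vnorm_nonneg _) (D.leg_le_one x₀ (e x₀) hv1 hw1) (n := 2)
  have hε : 0 ≤ ε := by linarith
  -- For equal messages the overlap is the squared norm of the leg, and decoupling is not needed.
  by_cases hx : x = x₀
  · subst hx
    rw [overlap, ← vnorm_sq_eq_dotProduct, Complex.norm_real, Real.norm_eq_abs, sq_abs]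
    nlinarith
  have : Subsingleton c.Arel := hc.arel
  have hμ := isState_mix x x₀
  have hμr : trRight (mix x x₀) = c.ω := by
    ext i j
    rw [c.isState_ω.apply_of_subsingleton]
    exact (Channel.isState (Channel.disc c.Arel c.Aabs) hμ).apply_of_subsingleton i j
  have hpx : mix x x₀ x x = 2⁻¹ := by
    simp [mix, Ne.symm hx]
  have hpx₀ : mix x x₀ x₀ x₀ = 2⁻¹ := by
    simp [mix, hx]
  have h := hD _ hμ hμr R (outer v v) hv.isState hv.marginal R' (outer w w) hw' hw
  have t1 := D.decoupled_test _ v w h x (e x) (D.leg_le_one x₀ (e x₀) hv1 hw1)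
  have t2 := D.decoupled_test _ v w h x₀ (e x₀) (D.leg_le_one x₀ (e x₀) hv1 hw1)
  -- The expectation of the state of `Q E` in the leg of `x₀`, common to both tests.
  set K := star (D.leg x₀ (e x₀) v w) ⬝ᵥ (trLeft (D.sigma (fun x' =>
    mix x x₀ x' x') (outer v v)
      (outer w w)) *ᵥ D.leg x₀ (e x₀) v w)
  rw [hpx] at t1
  rw [hpx₀, ← vnorm_sq_eq_dotProduct, Complex.norm_real, Real.norm_eq_abs,
    abs_of_nonneg (sq_nonneg _)] at t2
  have t1' := (Complex.abs_re_le_norm _).trans t1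
  have t2' := (Complex.abs_re_le_norm _).trans t2
  have e1 : ∀ r s : ℝ, ((2⁻¹ : ℂ) * ((r : ℂ) ^ 2 - (s : ℂ) ^ 2 * K)).re =
      2⁻¹ * (r ^ 2 - s ^ 2 * K.re) := by
    intro r s
    have : ((2⁻¹ : ℂ) * ((r : ℂ) ^ 2 - (s : ℂ) ^ 2 * K)) =
      ((2⁻¹ : ℝ) : ℂ) * (((r ^ 2 : ℝ) : ℂ) - ((s ^ 2 : ℝ) : ℂ) * K) := by push_cast; rfl
    rw [this, Complex.re_ofReal_mul, Complex.sub_re, Complex.re_ofReal_mul, Complex.ofReal_re]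
  rw [e1, abs_le] at t1' t2'
  change 1 - 8 * ε ≤ ‖star (D.leg x₀ (e x₀) v w) ⬝ᵥ D.leg x (e x) v w‖ ^ 2
  set F := ‖star (D.leg x₀ (e x₀) v w) ⬝ᵥ D.leg x (e x) v w‖ ^ 2
  set α := vnorm (D.leg x (e x) v w) ^ 2
  set β := vnorm (D.leg x₀ (e x₀) v w) ^ 2
  -- Both messages have probability `1 / 2`, whence the factor two. With `α`, `β` at least `1 - ε`
  -- and `ε ≤ 1 / 8`, this gives `K ≥ 1 - 5 ε`, and then `F ≥ (1 - ε) (1 - 5 ε) - 2 ε ≥ 1 - 8 ε`.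
  have k1 : β * (β - K.re) ≤ 2 * ε := by nlinarith [t2'.2]
  have k2 : 1 - 5 * ε ≤ K.re := by
    by_contra hK
    push Not at hK
    nlinarith
  have k3 : α * K.re - 2 * ε ≤ F := by linarith [t1'.1]
  nlinarith

/-- The protocol does not act on the reference, so orthogonal components of it do not interfere in
the overlap. -/
theorem overlap_superpose (D : P.CohExt) (e : c.Arel × c.Aabs ≃ c.B) (x₀ x : c.Arel × c.Aabs)
    {R₁ R₂ R' : Sys} (v₁ : ((b.Arel × b.Aabs) × b.S) × R₁ → ℂ)
    (v₂ : ((b.Arel × b.Aabs) × b.S) × R₂ → ℂ) (w : (c.S × P.T) × R' → ℂ) :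
    D.overlap e x₀ x (superpose v₁ v₂) w =
      2⁻¹ * (D.overlap e x₀ x v₁ w + D.overlap e x₀ x v₂ w) := by
  have h1 : ∀ (x : c.Arel × c.Aabs) y o r r', D.finVec x (superpose v₁ v₂) w
      (y, ((o, (Sum.inl r, r')) : D.Out × ((R₁ ⊕ R₂) × R'))) =
      ((√2 : ℝ) : ℂ)⁻¹ * D.finVec x v₁ w (y, ((o, (r, r')) : D.Out × (R₁ × R'))) :=
    fun x y o r r' => congrFun (D.finVec_smul x _ v₁ w) (y, ((o, (r, r')) : D.Out × (R₁ × R')))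
  have h2 : ∀ (x : c.Arel × c.Aabs) y o r r', D.finVec x (superpose v₁ v₂) w
      (y, ((o, (Sum.inr r, r')) : D.Out × ((R₁ ⊕ R₂) × R'))) =
      ((√2 : ℝ) : ℂ)⁻¹ * D.finVec x v₂ w (y, ((o, (r, r')) : D.Out × (R₂ × R'))) :=
    fun x y o r r' => congrFun (D.finVec_smul x _ v₂ w) (y, ((o, (r, r')) : D.Out × (R₂ × R')))
  have h : ∀ z z' : ℂ, star (((√2 : ℝ) : ℂ)⁻¹ * z) * (((√2 : ℝ) : ℂ)⁻¹ * z') =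
      2⁻¹ * (star z * z') := fun z z' => by
    rw [star_mul', mul_mul_mul_comm, mul_comm (star _), inv_sqrt_two_mul_star]
  have h3 : D.overlap e x₀ x (superpose v₁ v₂) w = ∑ o : D.Out, ∑ r : R₁ ⊕ R₂, ∑ r' : R',
      star (D.finVec x₀ (superpose v₁ v₂) w
        (e x₀, ((o, (r, r')) : D.Out × ((R₁ ⊕ R₂) × R')))) *
      D.finVec x (superpose v₁ v₂) w
        (e x, ((o, (r, r')) : D.Out × ((R₁ ⊕ R₂) × R'))) := by
    refine (Fintype.sum_prod_type _).trans (Finset.sum_congr rfl fun o _ => ?_)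
    exact Fintype.sum_prod_type _
  have h4 : ∀ {R : Sys} (v : ((b.Arel × b.Aabs) × b.S) × R → ℂ), D.overlap e x₀ x v w =
      ∑ o : D.Out, ∑ r : R, ∑ r' : R',
      star (D.finVec x₀ v w (e x₀, ((o, (r, r')) : D.Out × (R × R')))) *
      D.finVec x v w (e x, ((o, (r, r')) : D.Out × (R × R'))) := by
    intro R v
    refine (Fintype.sum_prod_type _).trans (Finset.sum_congr rfl fun o _ => ?_)
    exact Fintype.sum_prod_type _
  rw [h3, h4 v₁, h4 v₂, ← Finset.sum_add_distrib, Finset.mul_sum]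
  refine Finset.sum_congr rfl fun o _ => ?_
  rw [Fintype.sum_sum_type]
  simp only [h1, h2, h, ← Finset.mul_sum, mul_add]

/-- Up to a phase which depends on the message only, the final amplitudes do not depend on the
message, apart from Bob's outcome. -/
theorem exists_phase {ε : ℝ} (hε₁ : ε < 1 / 8) (hP : P.Accurate ε)
    {e : c.Arel × c.Aabs ≃ c.B} (hc : IsClassical c e) (D : P.CohExt) (hD : D.Decoupled ε)
    (x₀ : c.Arel × c.Aabs) {R' : Sys} {w : (c.S × P.T) × R' → ℂ}
    (hw : trRight (outer w w) = c.ρ ⊗ₖ P.τ) :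
    ∃ u : c.Arel × c.Aabs → ℂ, (∀ x, ‖u x‖ = 1) ∧
      ∀ (x) (R : Sys) (v : ((b.Arel × b.Aabs) × b.S) × R → ℂ), IsInput b v →
        ∑ y, vnorm (u x • D.branch hc.alice x y v w -
          if y = e x then D.branch hc.alice x₀ (e x₀) v w else 0) ^ 2 ≤
            17 * ε + 4 * √(8 * ε) := by
  have hw1 : vnorm w = 1 := vnorm_of_isState_outer ⟨Matrix.posSemidef_vecMulVec_self_star _, by
    rw [← trace_trRight, hw]
    exact (c.isState_ρ.kronecker P.isState_τ).trace_eq_one⟩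
  have key : ∀ x, ∃ u : ℂ, ‖u‖ = 1 ∧ ∀ (R : Sys) (v : ((b.Arel × b.Aabs) × b.S) × R → ℂ),
      IsInput b v → 1 - 8 * ε - 2 * √(8 * ε) ≤ (u * D.overlap e x₀ x v w).re := by
    intro x
    -- An arbitrary admissible input `v₁` fixes the phase, as the conjugate phase of its overlap
    -- `f`.
    by_cases hex : ∃ (R : Sys) (v : ((b.Arel × b.Aabs) × b.S) × R → ℂ), IsInput b v
    · obtain ⟨R₁, v₁, hv₁⟩ := hex
      have h1 := D.le_norm_overlap_sq hε₁.le hP hc hD x₀ x hv₁ hw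
      have h1' := D.norm_overlap_le e x₀ x (vnorm_of_isState_outer hv₁.isState) hw1
      set f := D.overlap e x₀ x v₁ w with hf
      have hf0 : ‖f‖ ≠ 0 := fun h => by
        rw [h] at h1
        linarith
      have hu : ‖star f / (‖f‖ : ℂ)‖ = 1 := by
        rw [norm_div, norm_star, Complex.norm_real, norm_norm, div_self hf0]
      refine ⟨star f / (‖f‖ : ℂ), hu, fun R v hv => ?_⟩
      -- Applied to the superposition, the bound says that the average of the two overlaps has
      -- modulus nearly one, so the overlap for `v` is within `2 √(8 ε)` of `f`.
      have h2 := D.le_norm_overlap_sq hε₁.le hP hc hD x₀ x (hv₁.superpose hv) hw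
      rw [overlap_superpose] at h2
      have h3 := norm_sub_le_of_norm_add h1'
        (D.norm_overlap_le e x₀ x (vnorm_of_isState_outer hv.isState) hw1) h2
      have h4 : (star f / (‖f‖ : ℂ)) * f = ((‖f‖ : ℝ) : ℂ) := by
        have : (‖f‖ : ℂ) ≠ 0 := by exact_mod_cast hf0
        rw [div_mul_eq_mul_div, Complex.star_def, ← Complex.normSq_eq_conj_mul_self,
          Complex.normSq_eq_norm_sq]
        push_cast
        field_simp
      have h5 : (star f / (‖f‖ : ℂ)) * D.overlap e x₀ x v w = ((‖f‖ : ℝ) : ℂ) -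
          (star f / (‖f‖ : ℂ)) * (f - D.overlap e x₀ x v w) := by
        rw [mul_sub, h4]
        ring
      rw [h5, Complex.sub_re, Complex.ofReal_re]
      have h6 := (Complex.re_le_norm ((star f / (‖f‖ : ℂ)) * (f - D.overlap e x₀ x v w)))
      rw [norm_mul, hu, one_mul] at h6
      have h7 : ‖f‖ ^ 2 ≤ ‖f‖ := by nlinarith [norm_nonneg f]
      linarith
    · exact ⟨1, norm_one, fun R v hv => (hex ⟨R, v, hv⟩).elim⟩
  choose u hu hu' using key
  refine ⟨u, hu, fun x R v hv => ?_⟩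
  have hv1 := vnorm_of_isState_outer hv.isState
  have hA := le_vnorm_branch_sq hP hc D x v hv.isState hv.marginal w hw
  have hs := D.sum_vnorm_branch_sq hc.alice x v w
  have hd : star (D.branch hc.alice x₀ (e x₀) v w) ⬝ᵥ D.branch hc.alice x (e x) v w =
      D.overlap e x₀ x v w := by
    refine ((D.restEquiv hc.alice R R').sum_comp _).symm.trans ?_
    exact Finset.sum_congr rfl fun q _ => by
      simp only [branch, Pi.star_apply, Equiv.symm_apply_apply]
      rfl
  have hb : ∀ x y, vnorm (D.branch hc.alice x y v w) ≤ 1 := fun x y =>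
    (vnorm_le_of_sq_le (vnorm_leg_sq D hc.alice x y v w).ge).trans (D.leg_le_one x y hv1 hw1)
  rw [hv1, hw1, ← Finset.add_sum_erase _ _ (Finset.mem_univ (e x))] at hs
  rw [← Finset.add_sum_erase _ _ (Finset.mem_univ (e x)), if_pos rfl]
  have h1 := vnorm_smul_sub_sq_le (hu x) (hb x (e x)) (hb x₀ (e x₀))
  rw [hd] at h1
  have h2 : ∑ y ∈ Finset.univ.erase (e x), vnorm (u x • D.branch hc.alice x y v w -
          if y = e x then D.branch hc.alice x₀ (e x₀) v w else 0) ^ 2 =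
      ∑ y ∈ Finset.univ.erase (e x), vnorm (D.branch hc.alice x y v w) ^ 2 := by
    refine Finset.sum_congr rfl fun y hy => ?_
    rw [if_neg (Finset.ne_of_mem_erase hy), sub_zero, vnorm_smul, hu, one_mul]
  rw [h2]
  -- The wrong outcomes contribute at most `ε`. The right one contributes at most `2 - 2 (1 - 8 ε -
  -- 2 √(8 ε))`, which gives `17 ε + 4 √(8 ε)` in total.
  have := hu' x R v hv
  linarith

end Protocol.CohExt

/-! ### From classical to coherent communication -/

open Protocol.CohExt (swapEquiv)

section ctrl

variable {y a b : Type} [Fintype y] [DecidableEq y] [Fintype a] [DecidableEq a] [Fintype b]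
  [DecidableEq b]

/-- The matrix acting as `V k` on the block `k`. -/
def ctrl (V : y → Matrix b a ℂ) : Matrix (y × b) (y × a) ℂ :=
  Matrix.of fun p q => if p.1 = q.1 then V p.1 p.2 q.2 else 0

theorem ctrl_isometry {V : y → Matrix b a ℂ} (hV : ∀ k, (V k)ᴴ * V k = 1) :
    (ctrl V)ᴴ * ctrl V = 1 := by
  ext ⟨k, i⟩ ⟨k', j⟩
  have h := congrFun (congrFun (hV k) i) j
  simp only [Matrix.mul_apply, Matrix.conjTranspose_apply] at h
  simp only [Matrix.mul_apply, Matrix.conjTranspose_apply, ctrl, Matrix.of_apply,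
    Fintype.sum_prod_type, apply_ite star, star_zero, ite_mul, zero_mul, mul_ite, mul_zero]
  rw [Finset.sum_eq_single k]
  · by_cases hk : k = k'
    · subst hk
      simp only [if_true]
      rw [h]
      simp [Matrix.one_apply]
    · simp [hk]
  · intro k₁ _ hk
    simp [hk]
  · simp

/-- The operation controlled by a system that is left unchanged. -/
def Channel.controlled (V : y → Matrix b a ℂ) (hV : ∀ k, (V k)ᴴ * V k = 1) :
    Channel (y × a) (y × b) :=
  Channel.ofIsometry (ctrl V) (ctrl_isometry hV)

theorem Channel.controlled_apply (V : y → Matrix b a ℂ) (hV : ∀ k, (V k)ᴴ * V k = 1)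
    (X : Matrix (y × a) (y × a) ℂ) (k k' : y) (i j : b) :
    Channel.controlled V hV X (k, i) (k', j) =
      (V k * (Matrix.of fun m n => X (k, m) (k', n)) * (V k')ᴴ) i j := by
  rw [controlled, ofIsometry_apply]
  simp [Matrix.mul_apply, ctrl, Fintype.sum_prod_type, apply_ite star, Finset.sum_ite_eq]

end ctrl

/-- The matrix of `|i⟩ ↦ |i⟩|i⟩`. -/
def copyMatrix (y : Type) [DecidableEq y] : Matrix (y × y) ((y × Unit) × Unit) ℂ :=
  Matrix.of fun p i => if p = (i.1.1, i.1.1) then 1 else 0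

theorem copyMatrix_isometry (y : Type) [Fintype y] [DecidableEq y] :
    (copyMatrix y)ᴴ * copyMatrix y = 1 := by
  ext ⟨⟨i, _⟩, _⟩ ⟨⟨j, _⟩, _⟩
  rw [Matrix.mul_apply, Finset.sum_eq_single (j, j)]
  · simp [copyMatrix, Matrix.one_apply, eq_comm]
  · intro p _ hp
    simp [copyMatrix, hp]
  · simp

theorem isState_maximallyMixed (y : Type) [Fintype y] [DecidableEq y] [Nonempty y] :
    IsState ((Fintype.card y : ℂ)⁻¹ • (1 : Matrix y y ℂ)) := by
  refine ⟨Matrix.PosSemidef.one.smul ?_, ?_⟩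
  · simp
  · rw [Matrix.trace_smul, Matrix.trace_one, smul_eq_mul, inv_mul_cancel₀]
    exact_mod_cast Fintype.card_ne_zero

/-- The coherent channel `|y⟩ ↦ |y⟩|y⟩` from Alice to Alice and Bob, for inputs which restrict to
the maximally mixed state. -/
noncomputable def cohRes (y : Sys) : Resource where
  Arel := y
  Aabs := .of Unit
  S := .of Unit
  A := y
  B := y
  N := Channel.ofIsometry (copyMatrix y) (copyMatrix_isometry y)
  ω := (Fintype.card y : ℂ)⁻¹ • (1 : Matrix y y ℂ)
  isState_ω := isState_maximallyMixed y
  ρ := (1 : Matrix Unit Unit ℂ)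
  isState_ρ := isState_one_unit

theorem cohRes_apply (y : Sys) (X : Matrix ((y × Unit) × Unit) ((y × Unit) × Unit) ℂ)
    (p q : y × y) : (cohRes y).N X p q =
      if p.2 = p.1 ∧ q.2 = q.1 then X ((p.1, ()), ()) ((q.1, ()), ()) else 0 := by
  change (copyMatrix y * X * (copyMatrix y)ᴴ) p q = _
  simp only [copyMatrix, Matrix.mul_apply, Matrix.of_apply, Fintype.sum_prod_type, Matrix.conjTranspose_apply,
    apply_ite star, star_zero, star_one, mul_ite, mul_one, mul_zero, ite_mul, one_mul, zero_mul,
    Finset.univ_unique, Finset.sum_singleton, Prod.ext_iff]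
  obtain ⟨p, p'⟩ := p
  obtain ⟨q, q'⟩ := q
  by_cases hp : p' = p
  · subst hp
    by_cases hq : q' = q
    · subst hq
      simp [and_self]
    · have : ∀ x, ¬(q = x ∧ q' = x) := fun x hx => hq (hx.2.trans hx.1.symm)
      simp [hq, this]
  · have : ∀ x, ¬(p = x ∧ p' = x) := fun x hx => hp (hx.2.trans hx.1.symm)
    simp [hp, this]

/-- The amplitudes, or the block of a matrix, for the value `y` of the control system. -/
def ctrlIn (b : Resource) {Y : Sys} (y : Y) (i : (b.Arel × b.Aabs) × b.S) :
    ((b.tensor (cohRes Y)).Arel × (b.tensor (cohRes Y)).Aabs) × (b.tensor (cohRes Y)).S :=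
  (((i.1.1, y), (i.1.2, ())), (i.2, ()))

theorem tensor_cohRes_apply (b : Resource) (Y : Sys) (Z) (p q : (b.A × Y) × (b.B × Y)) :
    (b.tensor (cohRes Y)).N Z p q = if p.2.2 = p.1.2 ∧ q.2.2 = q.1.2 then
      b.N (Z.submatrix (ctrlIn b p.1.2) (ctrlIn b q.1.2)) (p.1.1, p.2.1) (q.1.1, q.2.1) else 0 :=
  cohRes_apply Y (Matrix.of fun j j' => b.N (Matrix.of fun i i' =>
    Z (((i.1.1, j.1.1), (i.1.2, j.1.2)), (i.2, j.2))
      (((i'.1.1, j'.1.1), (i'.1.2, j'.1.2)), (i'.2, j'.2))) (p.1.1, p.2.1) (q.1.1, q.2.1))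
        (p.1.2, p.2.2) (q.1.2, q.2.2)

/-- The test state of the tensor product excludes correlations between the control and the test
system of `b`. Each block is therefore, up to the weight `1 / card Y`, an admissible input of `b`,
so that the properties of the classical protocol apply to it. -/
theorem testMarginal_ctrlIn {b : Resource} {Y : Sys} {Z}
    (hZ : testMarginal Z = (b.tensor (cohRes Y)).ω ⊗ₖ (b.tensor (cohRes Y)).ρ) (y : Y) :
    testMarginal (Z.submatrix (ctrlIn b y) (ctrlIn b y)) =
      (Fintype.card Y : ℂ)⁻¹ • (b.ω ⊗ₖ b.ρ) := by
  ext ⟨r, s⟩ ⟨r', s'⟩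
  have h := congrFun (congrFun hZ ((r, y), (s, ()))) ((r', y), (s', ()))
  have h1 : testMarginal Z ((r, y), (s, ())) ((r', y), (s', ())) =
      testMarginal (Z.submatrix (ctrlIn b y) (ctrlIn b y)) (r, s) (r', s') :=
    (Fintype.sum_prod_type _).trans (Finset.sum_congr rfl fun _ _ =>
      Fintype.sum_unique (ι := Unit) _)
  refine h1.symm.trans (h.trans ?_)
  change (b.ω r r' * ((Fintype.card Y : ℂ)⁻¹ * (1 : Matrix Y Y ℂ) y y)) *
    (b.ρ s s' * (1 : Matrix Unit Unit ℂ) () ()) = (Fintype.card Y : ℂ)⁻¹ * (b.ω r r' * b.ρ s s')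
  rw [Matrix.one_apply_eq, Matrix.one_apply_eq]
  ring

/-- `X` may be any operator on the range of the injective relabelling `ι`. -/
theorem traceNorm_extend_le {a b : Type} [Fintype a] [DecidableEq a] [Fintype b] [DecidableEq b]
    {ι : a → b} (hι : Function.Injective ι) {X : Matrix a a ℂ} {Y : Matrix b b ℂ}
    (h : ∀ p q, Y p q = ∑ i, ∑ j, if p = ι i ∧ q = ι j then X i j else 0) :
    traceNorm Y ≤ traceNorm X := by
  have hY : Y = ((1 : Matrix b b ℂ).submatrix id ι) * X * ((1 : Matrix b b ℂ).submatrix id ι)ᴴ := by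
    ext p q
    rw [h, Matrix.mul_apply, Finset.sum_comm]
    refine Finset.sum_congr rfl fun j _ => ?_
    rw [Matrix.mul_apply, Finset.sum_mul]
    refine Finset.sum_congr rfl fun i _ => ?_
    by_cases hp : p = ι i <;> by_cases hq : q = ι j <;>
      simp [Matrix.one_apply, Matrix.conjTranspose_apply, hp, hq]
  rw [hY]
  refine traceNorm_compress_le _ (fun v => (vnorm_mulVec_of_isometry ?_ v).le) X
  ext i j
  simp [Matrix.mul_apply, Matrix.one_apply, hι.eq_iff, eq_comm]

/-- It suffices to compare two operations on pure inputs. -/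
theorem distLE_of_outer {r a s b : Type} [Fintype r] [DecidableEq r] [Fintype a] [DecidableEq a]
    [Fintype s] [DecidableEq s] [Fintype b] [DecidableEq b]
    {M N : Channel ((r × a) × s) b} {ω : Matrix r r ℂ} {ρ : Matrix s s ℂ} {ε : ℝ}
    (h : ∀ (R : Sys) (v : ((r × a) × s) × R → ℂ), IsState (outer v v) →
      testMarginal (trRight (outer v v)) = ω ⊗ₖ ρ →
      traceNorm (M.amp R (outer v v) - N.amp R (outer v v)) ≤ ε) :
    DistLE M N ω ρ ε := by
  intro R ξ hξ hm
  obtain ⟨R₂, v, rfl⟩ := exists_purification hξ.posSemidef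
  -- The purifying system joins the reference; discarding it afterwards does not increase the
  -- distance.
  let w : ((r × a) × s) × (Sys.of (R × R₂)) → ℂ := fun p => v ((p.1, p.2.1), p.2.2)
  have h1 : trRight (outer w w) = trRight (trRight (outer v v)) := by
    ext i j
    exact Fintype.sum_prod_type _
  have h2 := h (.of (R × R₂)) w ⟨Matrix.posSemidef_vecMulVec_self_star _, by
    rw [← trace_trRight, h1, trace_trRight, hξ.trace_eq_one]⟩ (h1 ▸ hm)
  refine le_trans ?_ h2
  rw [← Channel.trRight_amp, ← Channel.trRight_amp]
  refine Eq.trans_le (congrArg traceNorm ?_) (((Channel.disc (b × R) R₂).traceNorm_le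
    ((M.amp (Sys.of (R × R₂)) (outer w w) - N.amp (Sys.of (R × R₂)) (outer w w)).submatrix
      (Equiv.prodAssoc b R R₂) (Equiv.prodAssoc b R R₂))).trans
        (traceNorm_submatrix_le _ (Equiv.prodAssoc b R R₂).injective))
  ext p q
  exact (Finset.sum_sub_distrib _ _).symm

namespace Protocol

variable {l : Depth} {b c : Resource}

/-- The messages are sent coherently: the protocol consuming the same resources, in which Alice's
message is a control system that she keeps. -/
theorem exists_coherent (P : Protocol l (b.tensor c)) (e : c.Arel × c.Aabs ≃ c.B) (D : P.CohExt)
    (u : c.Arel × c.Aabs → ℂ) (hu : ∀ x, ‖u x‖ = 1) :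
    ∃ P' : Protocol l (b.tensor (cohRes c.B)),
      (∀ Z (p q : (b.A × c.B) × (b.B × c.B)), P'.op Z p q =
        u (e.symm p.1.2) * star (u (e.symm q.1.2)) * ∑ k : c.A,
          D.cross (e.symm p.1.2) (e.symm q.1.2)
            (Z.submatrix (ctrlIn b p.1.2) (ctrlIn b q.1.2)) ((p.1.1, k), p.2) ((q.1.1, k), q.2)) ∧
      ∀ η Z, P.steps.Valid η (P.input (∑ y, supply b c (e.symm y)
        (Z.submatrix (ctrlIn b y) (ctrlIn b y)))) → P'.steps.Valid η (P'.input Z) := by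
  have huu : ∀ x, u x * star (u x) = 1 := fun x => by
    rw [Complex.star_def, Complex.mul_conj, Complex.normSq_eq_norm_sq, hu]
    simp
  have hU : ∀ y : c.B, (u (e.symm y) • D.U (e.symm y))ᴴ * (u (e.symm y) • D.U (e.symm y)) = 1 :=
    fun y => by
      rw [Matrix.conjTranspose_smul, Matrix.smul_mul, Matrix.mul_smul, (D.isDilation_U _).1,
        smul_smul, mul_comm, huu, one_smul]
  let t := b.tensor (cohRes c.B)
  let regroup : (b.Arel × c.B) × (b.Aabs × Unit) ≃ c.B × (b.Arel × b.Aabs) :=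
    { toFun := fun p => (p.1.2, (p.1.1, p.2.1))
      invFun := fun p => ((p.2.1, p.1), (p.2.2, ()))
      left_inv := fun _ => rfl
      right_inv := fun _ => rfl }
  let regroup₂ : c.B × (P.M₀ × D.E₀) ≃ P.M₀ × (c.B × D.E₀) :=
    { toFun := fun p => (p.2.1, (p.1, p.2.2))
      invFun := fun p => (p.2.1, (p.1, p.2.2))
      left_inv := fun _ => rfl
      right_inv := fun _ => rfl }
  -- Alice's encoding controlled by the message, with the correcting phases included. The control
  -- and the environment `E₀` are carried through the uses.
  let W : Channel ((b.Arel × c.B) × (b.Aabs × Unit)) (P.M₀ × (c.B × D.E₀)) :=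
    (Channel.relabel regroup₂).comp ((Channel.controlled _ hU).comp (Channel.relabel regroup))
  have hW : W.IsIsometric := (Channel.isIsometric_relabel _).comp
    ((Channel.isIsometric_ofIsometry _ _).comp (Channel.isIsometric_relabel _))
  obtain ⟨M₁, st, F, hF, hval⟩ := P.steps.exists_carry (.of ((b.Arel × c.B) × (b.Aabs × Unit)))
    (.of (c.B × D.E₀)) W hW
  let regroup₃ : P.M₁ × (c.B × D.E₀) ≃ (c.B × P.M₁) × D.E₀ :=
    { toFun := fun p => ((p.2.1, p.1), p.2.2)
      invFun := fun p => (p.1.2, (p.1.1, p.2))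
      left_inv := fun _ => rfl
      right_inv := fun _ => rfl }
  let regroup₄ : c.B × ((b.A × c.A) × D.E₂) ≃ (b.A × c.B) × (c.A × D.E₂) :=
    { toFun := fun p => ((p.2.1.1, p.1), (p.2.1.2, p.2.2))
      invFun := fun p => (p.1.2, ((p.1.1, p.2.1), p.2.2))
      left_inv := fun _ => rfl
      right_inv := fun _ => rfl }
  -- Alice's environments may be discarded, as they will turn out nearly independent of the message;
  -- the control itself is her output.
  let G : Channel (P.M₁ × (c.B × D.E₀)) (b.A × c.B) :=
    (Channel.disc (b.A × c.B) (c.A × D.E₂)).comp ((Channel.relabel regroup₄).comp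
      ((Channel.controlled _ fun y : c.B => (D.isDilation_G (e.symm y)).1).comp
        ((Channel.disc (c.B × P.M₁) D.E₀).comp (Channel.relabel regroup₃))))
  -- The coherent channel has a null source, so the source of `c` joins the unused source systems.
  let src : (b.S × Unit) × (c.S × P.T) ≃ srcSys P.order :=
    { toFun := fun p => P.src ((p.1.1, p.2.1), p.2.2)
      invFun := fun s => (((P.src.symm s).1.1, ()), ((P.src.symm s).1.2, (P.src.symm s).2))
      left_inv := fun p => by simp
      right_inv := fun s => P.src.apply_symm_apply s }
  let P' : Protocol l t :=
    { order := P.order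
      perm := P.perm
      M₀ := .of ((b.Arel × c.B) × (b.Aabs × Unit))
      M₁ := M₁
      enc := Channel.relabel (Equiv.refl _)
      steps := st
      fin := G.comp F
      -- Bob decodes by the isometry and omits the dephasing of his outcome.
      dec := (Channel.disc (b.B × c.B) D.E₃).comp (Channel.ofIsometry D.V D.isometry_V)
      T := .of (c.S × P.T)
      src := src
      τ := c.ρ ⊗ₖ P.τ
      isState_τ := c.isState_ρ.kronecker P.isState_τ
      src_eq := by
        rw [P.src_eq]
        ext s s'
        have h : ∀ x y z : ℂ, (x * y) * z = (x * 1) * (y * z) := fun x y z => by ring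
        exact h _ _ _ }
  have hin : ∀ Z (y y' : c.B) (m m' : P.M₀) (e₀ e₀' : D.E₀) (s s' : srcSys P.order),
      W.amp (srcSys P.order) (P'.input Z) ((m, (y, e₀)), s) ((m', (y', e₀')), s') =
        (u (e.symm y) * star (u (e.symm y'))) * ((D.U (e.symm y) * (Matrix.of fun i i' =>
          Z.submatrix (ctrlIn b y) (ctrlIn b y') (i, (P.src.symm s).1.1)
            (i', (P.src.symm s').1.1)) * (D.U (e.symm y'))ᴴ) (m, e₀) (m', e₀') *
          (c.ρ ⊗ₖ P.τ) ((P.src.symm s).1.2, (P.src.symm s).2)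
            ((P.src.symm s').1.2, (P.src.symm s').2)) := by
    intro Z y y' m m' e₀ e₀' s s'
    refine (Channel.controlled_apply _ hU _ y y' (m, e₀) (m', e₀')).trans ?_
    have h1 : (Matrix.of fun (i i' : b.Arel × b.Aabs) => P'.input Z (regroup.symm (y, i), s)
        (regroup.symm (y', i'), s')) = (c.ρ ⊗ₖ P.τ) ((P.src.symm s).1.2, (P.src.symm s).2)
            ((P.src.symm s').1.2, (P.src.symm s').2) • (Matrix.of fun i i' =>
          Z.submatrix (ctrlIn b y) (ctrlIn b y') (i, (P.src.symm s).1.1)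
            (i', (P.src.symm s').1.1)) := by
      ext i i'
      exact mul_comm _ _
    refine (congrArg (fun Y => ((u (e.symm y) • D.U (e.symm y)) * Y *
      (u (e.symm y') • D.U (e.symm y'))ᴴ) (m, e₀) (m', e₀')) h1).trans ?_
    rw [Matrix.conjTranspose_smul, Matrix.mul_smul, Matrix.smul_mul, Matrix.mul_smul,
      Matrix.smul_mul, Matrix.smul_mul]
    simp only [Matrix.smul_apply, smul_eq_mul]
    ring
  refine ⟨P', fun Z p q => ?_, fun η Z h => hval η _ ?_⟩
  · obtain ⟨⟨a, y⟩, z⟩ := p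
    obtain ⟨⟨a', y'⟩, z'⟩ := q
    have hsum : ∀ (X : D.E₀ → Matrix (P.M₀ × srcSys P.order) (P.M₀ × srcSys P.order) ℂ) i j,
        ∑ e₀, P.steps.run (X e₀) i j = P.steps.run (∑ e₀, X e₀) i j := fun X i j => by
      rw [Channel.map_sum, Matrix.sum_apply]
    have h1 : ∀ β β', (G.comp F) (Matrix.of fun m m' => st.run (P'.input Z) (m, β) (m', β'))
        (a, y) (a', y') = ∑ k : c.A × D.E₂, (D.G (e.symm y) * (Matrix.of fun m m' => ∑ e₀,
          F.amp (bobSys P.order) (st.run (P'.input Z)) ((m, (y, e₀)), β) ((m', (y', e₀)), β')) *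
            (D.G (e.symm y'))ᴴ) ((a, k.1), k.2) ((a', k.1), k.2) := fun β β' =>
      Finset.sum_congr rfl fun k _ => Channel.controlled_apply _
        (fun y : c.B => (D.isDilation_G (e.symm y)).1) _ y y' _ _
    have h2 : ∀ β β', (Matrix.of fun m m' => ∑ e₀,
          F.amp (bobSys P.order) (st.run (P'.input Z)) ((m, (y, e₀)), β) ((m', (y', e₀)), β')) =
        (u (e.symm y) * star (u (e.symm y'))) • Matrix.of fun m m' =>
          P.steps.run (Matrix.of fun s s' =>
      trRight (D.U (e.symm y) * (Matrix.of fun i i' => Z.submatrix (ctrlIn b y) (ctrlIn b y')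
        (i, (P.src.symm s.2).1.1)
        (i', (P.src.symm s'.2).1.1)) * (D.U (e.symm y'))ᴴ) s.1 s'.1 *
      (c.ρ ⊗ₖ P.τ) ((P.src.symm s.2).1.2, (P.src.symm s.2).2)
        ((P.src.symm s'.2).1.2, (P.src.symm s'.2).2)) (m, β) (m', β') := by
      intro β β'
      ext m m'
      rw [Matrix.of_apply, Matrix.smul_apply, Matrix.of_apply, ← Matrix.smul_apply,
        ← Channel.map_smul]
      refine (Finset.sum_congr rfl fun e₀ _ =>
        congrFun (congrFun (hF (P'.input Z)) ((m, (y, e₀)), β)) ((m', (y', e₀)), β')).trans ?_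
      refine (hsum (fun e₀ => Matrix.of fun s s' => W.amp (srcSys P.order) (P'.input Z)
        ((s.1, (y, e₀)), s.2) ((s'.1, (y', e₀)), s'.2)) (m, β) (m', β')).trans ?_
      refine congrFun (congrFun (congrArg P.steps.run.toFun ?_) _) _
      ext s s'
      rw [Matrix.sum_apply, Matrix.smul_apply, smul_eq_mul, Matrix.of_apply, trRight,
        Matrix.of_apply, Finset.sum_mul, Finset.mul_sum]
      exact Finset.sum_congr rfl fun e₀ _ => hin Z y y' s.1 s'.1 e₀ e₀ s.2 s'.2
    have h3 : P'.op Z ((a, y), z) ((a', y'), z') = trRight (D.V * (Matrix.of fun β β' =>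
        (G.comp F) (Matrix.of fun m m' => st.run (P'.input Z) (m, β) (m', β'))
        (a, y) (a', y')) * D.Vᴴ) z z' := rfl
    refine h3.trans ?_
    simp only [h1, h2, Matrix.mul_smul, Matrix.smul_mul, Matrix.smul_apply, smul_eq_mul,
      ← Finset.mul_sum, Fintype.sum_prod_type]
    have h4 : ∀ (z : ℂ) (X : c.A → Matrix (bobSys P.order) (bobSys P.order) ℂ) i j,
        trRight (D.V * (Matrix.of fun β β' => z * ∑ k, X k β β') * D.Vᴴ) i j =
          z * ∑ k, trRight (D.V * X k * D.Vᴴ) i j := fun z X i j => by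
      have : (Matrix.of fun β β' => z * ∑ k, X k β β') = z • ∑ k, X k := by
        ext β β'
        simp [Matrix.sum_apply]
      rw [this, Matrix.mul_smul, Matrix.smul_mul, Matrix.mul_sum, Matrix.sum_mul]
      simp only [trRight, Matrix.of_apply, Matrix.smul_apply, Matrix.sum_apply, smul_eq_mul]
      rw [← Finset.mul_sum, Finset.sum_comm]
    exact h4 _ (fun k => Matrix.of fun β β' => ∑ e₂, _) _ _
  -- Tracing out the carried control leaves only the diagonal blocks, where the phases cancel. The
  -- resources see the same mixture of inputs as in the classical protocol.
  · refine Eq.mp (congrArg (P.steps.Valid η) ?_) h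
    rw [Channel.map_sum]
    ext ⟨m, s⟩ ⟨m', s'⟩
    rw [Matrix.sum_apply]
    refine Eq.symm ((Fintype.sum_prod_type _).trans (Finset.sum_congr rfl fun y _ => ?_))
    refine (Finset.sum_congr rfl fun e₀ _ => hin Z y y m m' e₀ e₀ s s').trans ?_
    simp only [huu, one_mul, ← Finset.sum_mul]
    have h1 : P.input (supply b c (e.symm y) (Z.submatrix (ctrlIn b y) (ctrlIn b y)))
        (m, s) (m', s') = P.enc (Matrix.of fun i i' => supply b c (e.symm y)
          (Z.submatrix (ctrlIn b y) (ctrlIn b y)) (i, (P.src.symm s).1)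
            (i', (P.src.symm s').1)) m m' * P.τ (P.src.symm s).2 (P.src.symm s').2 := rfl
    have h2 : ∀ X, P.enc (msgInsert (e.symm y) X) =
        trRight (D.U (e.symm y) * X * (D.U (e.symm y))ᴴ) :=
      fun X => ((D.isDilation_U (e.symm y)).2 X).symm
    rw [h1, supply_slice, Channel.map_smul, h2, Matrix.smul_apply, smul_eq_mul,
      Matrix.kroneckerMap_apply]
    simp only [trRight, Matrix.of_apply]
    ring

end Protocol

theorem trace_testMarginal {r a s : Type} [Fintype r] [Fintype a] [Fintype s]
    (X : Matrix ((r × a) × s) ((r × a) × s) ℂ) : (testMarginal X).trace = X.trace := by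
  simp only [Matrix.trace, Matrix.diag, testMarginal, Matrix.of_apply, Fintype.sum_prod_type]
  exact Finset.sum_congr rfl fun _ _ => Finset.sum_comm

theorem testMarginal_sum {r a s k : Type} [Fintype a] [Fintype k]
    (X : k → Matrix ((r × a) × s) ((r × a) × s) ℂ) :
    testMarginal (∑ i, X i) = ∑ i, testMarginal (X i) := by
  ext p q
  simp only [testMarginal, Matrix.of_apply, Matrix.sum_apply]
  exact Finset.sum_comm

/-- The dephased input of a coherent channel, as a mixture of inputs of the classical channel. -/
theorem isState_sum_supply {b c : Resource} {e : c.Arel × c.Aabs ≃ c.B} (hc : IsClassical c e) {Z}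
    (hZ : IsState Z)
    (hm : testMarginal Z = (b.tensor (cohRes c.B)).ω ⊗ₖ (b.tensor (cohRes c.B)).ρ) :
    IsState (∑ y, supply b c (e.symm y) (Z.submatrix (ctrlIn b y) (ctrlIn b y))) ∧
      testMarginal (∑ y, supply b c (e.symm y) (Z.submatrix (ctrlIn b y) (ctrlIn b y))) =
        (b.tensor c).ω ⊗ₖ (b.tensor c).ρ := by
  have hcard : (Fintype.card c.B : ℂ) ≠ 0 := by exact_mod_cast Fintype.card_ne_zero
  have h1 : ∀ y, testMarginal (supply b c (e.symm y) (Z.submatrix (ctrlIn b y) (ctrlIn b y))) =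
      (Fintype.card c.B : ℂ)⁻¹ • ((b.tensor c).ω ⊗ₖ (b.tensor c).ρ) := by
    intro y
    have h2 := testMarginal_supply hc (e.symm y)
      ((Fintype.card c.B : ℂ) • Z.submatrix (ctrlIn b y) (ctrlIn b y)) (by
        rw [testMarginal_smul, testMarginal_ctrlIn hm, smul_smul, mul_inv_cancel₀ hcard, one_smul])
    rw [Channel.map_smul, testMarginal_smul] at h2
    rw [← h2, smul_smul, inv_mul_cancel₀ hcard, one_smul]
  have h2 : testMarginal (∑ y, supply b c (e.symm y) (Z.submatrix (ctrlIn b y) (ctrlIn b y))) =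
        (b.tensor c).ω ⊗ₖ (b.tensor c).ρ := by
    rw [testMarginal_sum]
    simp only [h1]
    rw [Finset.sum_const, Finset.card_univ, ← Nat.cast_smul_eq_nsmul ℂ, smul_smul,
      mul_inv_cancel₀ hcard, one_smul]
  refine ⟨⟨Matrix.posSemidef_sum _ fun y _ => ?_, ?_⟩, h2⟩
  · obtain ⟨ι, _, K, -, hK⟩ := (supply b c (e.symm y)).kraus
    rw [hK]
    exact Matrix.posSemidef_sum _ fun i _ =>
      (hZ.posSemidef.submatrix _).mul_mul_conjTranspose_same (K i)
  · rw [← trace_testMarginal, h2]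
    exact ((b.tensor c).isState_ω.kronecker (b.tensor c).isState_ρ).trace_eq_one

theorem traceNorm_trRight_outer_sub_le {a k : Type} [Fintype a] [DecidableEq a] [Fintype k]
    {v w : a × k → ℂ} (hv : vnorm v ≤ 1) (hw : vnorm w ≤ 1) :
    traceNorm (trRight (outer v v) - trRight (outer w w)) ≤ 2 * vnorm (v - w) := by
  classical
  rw [← Channel.disc_apply, ← Channel.disc_apply, ← Channel.map_sub]
  exact (Channel.traceNorm_le _ _).trans (traceNorm_outer_sub_le hv hw)

/-- Coherently decoupled classical communication can be made coherent. -/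
theorem creates_tensor_cohRes {l : Depth} {b c : Resource} {ε : ℝ} (hε : ε < 1 / 8)
    {P : Protocol l (b.tensor c)} (hval : P.Valid ε) (hacc : P.Accurate ε)
    (hdec : P.CoherentlyDecoupled ε) {e : c.Arel × c.Aabs ≃ c.B} (hc : IsClassical c e) :
    Creates l (b.tensor (cohRes c.B)) (ε + 2 * √(17 * ε + 4 * √(8 * ε))) := by
  obtain ⟨D, hD⟩ := hdec
  have : Subsingleton c.A := hc.alice
  obtain ⟨R', w, hw⟩ := exists_purification (c.isState_ρ.kronecker P.isState_τ).posSemidef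
  have hw1 : vnorm w = 1 := vnorm_of_isState_outer ⟨Matrix.posSemidef_vecMulVec_self_star _, by
    rw [← trace_trRight, hw]
    exact (c.isState_ρ.kronecker P.isState_τ).trace_eq_one⟩
  let x₀ : c.Arel × c.Aabs := Classical.arbitrary _
  obtain ⟨u, hu, hclose⟩ := D.exists_phase hε hacc hc hD x₀ hw
  obtain ⟨P', hop, hP'⟩ := P.exists_coherent e D u hu
  refine ⟨P', fun ξ hξ hm => ?_, distLE_of_outer fun R v hv hm => ?_⟩
  · obtain ⟨h1, h2⟩ := isState_sum_supply hc hξ hm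
    exact (hP' ε ξ (hval _ h1 h2)).mono (by linarith [Real.sqrt_nonneg (17 * ε + 4 * √(8 * ε))])
  have hv1 := vnorm_of_isState_outer hv
  obtain ⟨n, hn⟩ : ∃ n : ℝ, n = (Fintype.card c.B : ℕ) := ⟨_, rfl⟩
  have hn0 : 0 < n := by
    rw [hn]
    exact_mod_cast Fintype.card_pos
  let v' : c.B → ((b.Arel × b.Aabs) × b.S) × R → ℂ := fun y p => v (ctrlIn b y p.1, p.2)
  have hm' : ∀ y, testMarginal (trRight (outer (v' y) (v' y))) =
      (Fintype.card c.B : ℂ)⁻¹ • (b.ω ⊗ₖ b.ρ) := fun y => testMarginal_ctrlIn hm y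
  -- the blocks of the input, normalised
  have hv' : ∀ y, IsInput b (((√n : ℝ) : ℂ) • v' y) := by
    intro y
    have h1 : trRight (outer (((√n : ℝ) : ℂ) • v' y) (((√n : ℝ) : ℂ) • v' y)) =
        (Fintype.card c.B : ℂ) • trRight (outer (v' y) (v' y)) := by
      ext p q
      simp only [trRight, outer, Matrix.of_apply, Pi.smul_apply, smul_eq_mul, Matrix.smul_apply,
        Finset.mul_sum]
      refine Finset.sum_congr rfl fun r _ => ?_
      have h2 : ((√n : ℝ) : ℂ) * ((√n : ℝ) : ℂ) = (Fintype.card c.B : ℂ) := by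
        rw [← Complex.ofReal_mul, Real.mul_self_sqrt hn0.le, hn, Complex.ofReal_natCast]
      rw [star_mul', Complex.star_def, Complex.conj_ofReal, ← h2]
      ring
    have h2 : testMarginal (trRight (outer (((√n : ℝ) : ℂ) • v' y) (((√n : ℝ) : ℂ) • v' y))) =
        b.ω ⊗ₖ b.ρ := by
      rw [h1, testMarginal_smul, hm', smul_smul, mul_inv_cancel₀, one_smul]
      exact_mod_cast Fintype.card_ne_zero
    refine ⟨⟨Matrix.posSemidef_vecMulVec_self_star _, ?_⟩, h2⟩
    rw [← trace_trRight, ← trace_testMarginal, h2]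
    exact (b.isState_ω.kronecker b.isState_ρ).trace_eq_one
  have hvn : ∀ y, vnorm (v' y) ^ 2 = n⁻¹ := by
    intro y
    have h1 := vnorm_of_isState_outer (hv' y).isState
    rw [vnorm_smul, Complex.norm_real, Real.norm_eq_abs, abs_of_nonneg (Real.sqrt_nonneg _)] at h1
    have h2 : (√n * vnorm (v' y)) ^ 2 = 1 := by rw [h1, one_pow]
    rw [mul_pow, Real.sq_sqrt hn0.le] at h2
    field_simp
    linarith
  -- the final amplitudes of the new protocol, and those for the message `x₀`
  let Φ : (((b.A × c.B) × (b.B × c.B)) × R) × D.Env R' → ℂ := fun p =>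
    u (e.symm p.1.1.1.2) * D.branch hc.alice (e.symm p.1.1.1.2) p.1.1.2.2 (v' p.1.1.1.2) w
      (((p.1.1.1.1, p.1.1.2.1), p.1.2), p.2)
  let Ψ : (((b.A × c.B) × (b.B × c.B)) × R) × D.Env R' → ℂ := fun p =>
    if p.1.1.2.2 = p.1.1.1.2 then D.branch hc.alice x₀ (e x₀) (v' p.1.1.1.2) w
      (((p.1.1.1.1, p.1.1.2.1), p.1.2), p.2) else 0
  have hmul : ∀ x y z t : ℂ, x * star y * (z * star t) = x * z * star (y * t) := fun x y z t => by
    rw [star_mul']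
    ring
  -- `Φ` purifies the output of the new protocol: the environments and the reference of the
  -- remaining sources are traced out.
  have hΦ : P'.op.amp R (outer v v) = trRight (outer Φ Φ) := by
    ext ⟨⟨⟨a, y⟩, z, y₁⟩, r⟩ ⟨⟨⟨a', y'⟩, z', y₁'⟩, r'⟩
    refine (hop (Matrix.of fun i i' => v (i, r) * star (v (i', r'))) ((a, y), (z, y₁))
      ((a', y'), (z', y₁'))).trans ?_
    rw [Fintype.sum_subsingleton _ (Classical.arbitrary c.A)]
    refine (congrArg (fun t => u (e.symm y) * star (u (e.symm y')) * t) (D.cross_amp_outer hc.alice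
      (e.symm y) (e.symm y') (v' y) (v' y') w hw a a' _ _ z z' y₁ y₁' r r')).trans ?_
    rw [Finset.mul_sum]
    refine Finset.sum_congr rfl fun f _ => ?_
    exact hmul _ _ _ _
  have hsum : ∀ f : (((b.A × c.B) × (b.B × c.B)) × R) × D.Env R' → ℂ, vnorm f ^ 2 =
      ∑ y, ∑ y₁, vnorm (fun q : ((b.A × b.B) × R) × D.Env R' =>
        f ((((q.1.1.1, y), (q.1.1.2, y₁)), q.1.2), q.2)) ^ 2 := by
    intro f
    let τ : c.B × c.B × (((b.A × b.B) × R) × D.Env R') ≃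
        (((b.A × c.B) × (b.B × c.B)) × R) × D.Env R' :=
      { toFun := fun p => ((((p.2.2.1.1.1, p.1), (p.2.2.1.1.2, p.2.1)), p.2.2.1.2), p.2.2.2)
        invFun := fun p => (p.1.1.1.2, p.1.1.2.2, (((p.1.1.1.1, p.1.1.2.1), p.1.2), p.2))
        left_inv := fun _ => rfl
        right_inv := fun _ => rfl }
    rw [vnorm_sq, ← τ.sum_comp, Fintype.sum_prod_type]
    refine Finset.sum_congr rfl fun y _ => ?_
    rw [Fintype.sum_prod_type]
    exact Finset.sum_congr rfl fun y₁ _ => (vnorm_sq _).symm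
  have hcn : (Fintype.card c.B : ℝ) * n⁻¹ = 1 := by
    rw [← hn, mul_inv_cancel₀ hn0.ne']
  have hΦ1 : vnorm Φ ≤ 1 := by
    have h1 : vnorm Φ ^ 2 = 1 := by
      have h2 : ∀ y, ∑ y₁, vnorm (fun q : ((b.A × b.B) × R) × D.Env R' =>
          Φ ((((q.1.1.1, y), (q.1.1.2, y₁)), q.1.2), q.2)) ^ 2 = n⁻¹ := by
        intro y
        rw [← hvn y, ← mul_one (vnorm (v' y)), ← hw1, ← D.sum_vnorm_branch_sq hc.alice (e.symm y)]
        refine Finset.sum_congr rfl fun y₁ _ => ?_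
        refine (congrArg (· ^ 2) (vnorm_smul (u (e.symm y))
          (D.branch hc.alice (e.symm y) y₁ (v' y) w))).trans ?_
        rw [hu, one_mul]
      rw [hsum]
      simp only [h2, Finset.sum_const, Finset.card_univ, nsmul_eq_mul]
      exact hcn
    exact (pow_le_one_iff_of_nonneg (vnorm_nonneg _) two_ne_zero).mp h1.le
  have hΨ1 : vnorm Ψ ≤ 1 := by
    have h1 : vnorm Ψ ^ 2 ≤ 1 := by
      have h2 : ∀ y, ∑ y₁, vnorm (fun q : ((b.A × b.B) × R) × D.Env R' =>
          Ψ ((((q.1.1.1, y), (q.1.1.2, y₁)), q.1.2), q.2)) ^ 2 ≤ n⁻¹ := by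
        intro y
        rw [Finset.sum_eq_single y]
        · refine Eq.trans_le (b := vnorm (D.branch hc.alice x₀ (e x₀) (v' y) w) ^ 2) ?_ ?_
          · simp only [Ψ, if_true]
          · rw [← hvn y, ← mul_one (vnorm (v' y)), ← hw1, ← D.sum_vnorm_branch_sq hc.alice x₀]
            exact Finset.single_le_sum
              (f := fun y₁ => vnorm (D.branch hc.alice x₀ y₁ (v' y) w) ^ 2)
              (fun _ _ => sq_nonneg _) (Finset.mem_univ (e x₀))
        · intro y₁ _ hy
          simp only [Ψ, if_neg hy]
          rw [vnorm_sq]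
          simp
        · simp
      rw [hsum]
      refine (Finset.sum_le_sum fun y _ => h2 y).trans ?_
      rw [Finset.sum_const, Finset.card_univ, nsmul_eq_mul]
      exact hcn.le
    exact (pow_le_one_iff_of_nonneg (vnorm_nonneg _) two_ne_zero).mp h1
  -- The squared distance is the average over the blocks `y` of the bound in `exists_phase`, applied
  -- to the normalized blocks.
  have hΦΨ : vnorm (Φ - Ψ) ≤ √(17 * ε + 4 * √(8 * ε)) := by
    refine Real.le_sqrt_of_sq_le ?_
    have h2 : ∀ y, ∑ y₁, vnorm (fun q : ((b.A × b.B) × R) × D.Env R' =>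
          (Φ - Ψ) ((((q.1.1.1, y), (q.1.1.2, y₁)), q.1.2), q.2)) ^ 2 ≤
            n⁻¹ * (17 * ε + 4 * √(8 * ε)) := by
      intro y
      have h3 := hclose (e.symm y) R _ (hv' y)
      refine le_trans (le_of_eq ?_) (mul_le_mul_of_nonneg_left h3 (inv_nonneg.mpr hn0.le))
      rw [Finset.mul_sum]
      refine Finset.sum_congr rfl fun y₁ _ => ?_
      have h4 : ∀ x y₁, D.branch hc.alice x y₁ (((√n : ℝ) : ℂ) • v' y) w =
          ((√n : ℝ) : ℂ) • D.branch hc.alice x y₁ (v' y) w := fun x y₁ =>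
        funext fun q => congrFun (D.finVec_smul x _ (v' y) w) _
      have h5 : (u (e.symm y) • D.branch hc.alice (e.symm y) y₁ (((√n : ℝ) : ℂ) • v' y) w -
          if y₁ = e (e.symm y) then D.branch hc.alice x₀ (e x₀) (((√n : ℝ) : ℂ) • v' y) w else 0) =
          ((√n : ℝ) : ℂ) • (fun q : ((b.A × b.B) × R) × D.Env R' =>
          (Φ - Ψ) ((((q.1.1.1, y), (q.1.1.2, y₁)), q.1.2), q.2)) := by
        rw [h4, h4, e.apply_symm_apply, smul_comm]
        by_cases hy : y₁ = y
        · rw [if_pos hy, ← smul_sub]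
          congr 1
          funext q
          simp only [Φ, Ψ, Pi.sub_apply, if_pos hy]
          rfl
        · rw [if_neg hy, sub_zero]
          congr 1
          funext q
          simp only [Φ, Ψ, Pi.sub_apply, if_neg hy, sub_zero]
          rfl
      rw [h5, vnorm_smul, Complex.norm_real, Real.norm_eq_abs, abs_of_nonneg (Real.sqrt_nonneg _),
        mul_pow, Real.sq_sqrt hn0.le, ← mul_assoc, inv_mul_cancel₀ hn0.ne', one_mul]
    rw [hsum]
    refine (Finset.sum_le_sum fun y _ => h2 y).trans ?_
    rw [Finset.sum_const, Finset.card_univ, nsmul_eq_mul, ← mul_assoc, hcn, one_mul]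
  -- for the message `x₀`, the control system is part of the reference
  let ν : ((b.Arel × b.Aabs) × b.S) × (Sys.of (c.B × R)) → ℂ := fun p => v' p.2.1 (p.1, p.2.2)
  have hν : IsInput b ν := by
    have h1 : trRight (outer ν ν) = ∑ y, trRight (outer (v' y) (v' y)) := by
      ext p q
      rw [Matrix.sum_apply]
      exact Fintype.sum_prod_type _
    have h2 : testMarginal (trRight (outer ν ν)) = b.ω ⊗ₖ b.ρ := by
      rw [h1, testMarginal_sum]
      simp only [hm']
      rw [Finset.sum_const, Finset.card_univ, ← Nat.cast_smul_eq_nsmul ℂ, smul_smul,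
        mul_inv_cancel₀, one_smul]
      exact_mod_cast Fintype.card_ne_zero
    refine ⟨⟨Matrix.posSemidef_vecMulVec_self_star _, ?_⟩, h2⟩
    rw [← trace_trRight, ← trace_testMarginal, h2]
    exact (b.isState_ω.kronecker b.isState_ρ).trace_eq_one
  let Ω : Matrix (((b.A × c.B) × (b.B × c.B)) × R) (((b.A × c.B) × (b.B × c.B)) × R) ℂ :=
    (b.tensor (cohRes c.B)).N.amp R (outer v v)
  -- In `Ψ` only the message `x₀` is ever sent, and the control is copied ideally. The accuracy for
  -- this single message suffices.
  have hΨN : traceNorm (trRight (outer Ψ Ψ) - Ω) ≤ ε := by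
    refine le_trans ?_ (Protocol.CohExt.branch_close hacc hc D x₀ ν hν.isState hν.marginal w hw)
    let ι : (b.A × b.B) × (Sys.of (c.B × R)) → ((b.A × c.B) × (b.B × c.B)) × R := fun p =>
      (((p.1.1, p.2.1), (p.1.2, p.2.1)), p.2.2)
    have hι : Function.Injective ι := fun p q hpq =>
      Prod.ext (Prod.ext (congrArg (fun t => t.1.1.1) hpq) (congrArg (fun t => t.1.2.1) hpq))
        (Prod.ext (congrArg (fun t => t.1.1.2) hpq) (by have := congrArg Prod.snd hpq; exact this))
    refine traceNorm_extend_le hι fun p q => ?_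
    obtain ⟨⟨⟨a, y⟩, z, y₁⟩, r⟩ := p
    obtain ⟨⟨⟨a', y'⟩, z', y₁'⟩, r'⟩ := q
    have hN := tensor_cohRes_apply b c.B (Matrix.of fun i i' => v (i, r) * star (v (i', r')))
      ((a, y), (z, y₁)) ((a', y'), (z', y₁'))
    by_cases hy : y₁ = y ∧ y₁' = y'
    · obtain ⟨rfl, rfl⟩ := hy
      rw [if_pos ⟨rfl, rfl⟩] at hN
      rw [Finset.sum_eq_single ((a, z), (y₁, r)), Finset.sum_eq_single ((a', z'), (y₁', r')),
        if_pos ⟨rfl, rfl⟩]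
      · refine congrArg₂ (· - ·) (Finset.sum_congr rfl fun f _ => ?_) hN
        simp only [Ψ, outer, Matrix.of_apply, if_true]
        rfl
      · intro j _ hj
        rw [if_neg fun h => hj (hι h.2.symm)]
      · simp
      · intro j _ hj
        exact Finset.sum_eq_zero fun k _ => if_neg fun h => hj (hι h.1.symm)
      · simp
    · rw [if_neg hy] at hN
      refine Eq.trans ?_ (Eq.symm (Finset.sum_eq_zero fun j _ => Finset.sum_eq_zero fun k _ =>
        if_neg fun h => hy ?_))
      · have h1 : trRight (outer Ψ Ψ) (((a, y), z, y₁), r) (((a', y'), z', y₁'), r') = 0 := by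
          refine Finset.sum_eq_zero fun f _ => ?_
          rcases not_and_or.mp hy with hy | hy
          · exact (congrArg (· * _) (if_neg hy)).trans (zero_mul _)
          · exact (congrArg (fun t : ℂ => Ψ ((((a, y), z, y₁), r), f) * star t) (if_neg hy)).trans
              (by rw [star_zero, mul_zero])
        exact (congrArg₂ (· - ·) h1 hN).trans (sub_zero 0)
      · exact ⟨(congrArg (fun t => t.1.2.2) h.1).trans (congrArg (fun t => t.1.1.2) h.1).symm,
          (congrArg (fun t => t.1.2.2) h.2).trans (congrArg (fun t => t.1.1.2) h.2).symm⟩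
  have h1 : traceNorm (trRight (outer Φ Φ) - trRight (outer Ψ Ψ)) ≤
      2 * √(17 * ε + 4 * √(8 * ε)) := by
    refine (traceNorm_trRight_outer_sub_le hΦ1 hΨ1).trans ?_
    linarith
  have h2 : traceNorm (trRight (outer Φ Φ) - Ω) ≤ ε + 2 * √(17 * ε + 4 * √(8 * ε)) :=
    (traceNorm_sub_le _ (trRight (outer Ψ Ψ)) Ω).trans (by linarith)
  rw [← hΦ] at h2
  exact h2

/-! ### Reductions of depth-one resources -/

namespace Channel

variable {a b c d a' b' c' d' : Type} [Fintype a] [DecidableEq a] [Fintype b] [DecidableEq b]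
  [Fintype c] [DecidableEq c] [Fintype d] [DecidableEq d] [Fintype a'] [DecidableEq a']
  [Fintype b'] [DecidableEq b'] [Fintype c'] [DecidableEq c'] [Fintype d'] [DecidableEq d']

theorem tensor_comp_tensor (N' : Channel b a') (M' : Channel d c') (N : Channel a b)
    (M : Channel c d) :
    (N'.tensor M').comp (N.tensor M) = (N'.comp N).tensor (M'.comp M) :=
  ext_kronecker fun X Y => by simp only [comp_apply, tensor_kronecker]

/-- An operation with one-dimensional output is the trace. -/
theorem eq_of_subsingleton [Subsingleton b] (N M : Channel a b) : N = M := by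
  apply ext_toFun
  intro X
  ext p q
  have h : ∀ N : Channel a b, N X p q = X.trace := fun N => by
    rw [← N.trace_apply X, Matrix.trace, Fintype.sum_subsingleton _ p, Subsingleton.elim q p]
    rfl
  rw [h, h]

/-- Discarding a system. -/
def discard (a : Type) [Fintype a] [DecidableEq a] : Channel a Unit :=
  (disc Unit a).comp (relabel (Equiv.punitProd a).symm)

end Channel

/-- Polarization: over the complex numbers an operator is determined by its quadratic form. -/
theorem eq_zero_of_forall_dotProduct {a : Type} [Fintype a] [DecidableEq a] {A : Matrix a a ℂ}
    (h : ∀ w : a → ℂ, star w ⬝ᵥ (A *ᵥ w) = 0) : A = 0 := by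
  have h1 : Matrix.toEuclideanLin A = 0 := by
    rw [← inner_map_self_eq_zero]
    intro x
    rw [← inner_conj_symm, EuclideanSpace.inner_eq_star_dotProduct, dotProduct_comm]
    have := h (WithLp.ofLp x)
    simp only [Matrix.ofLp_toLpLin, Matrix.toLin'_apply]
    rw [this, map_zero]
  exact (Matrix.toEuclideanLin.map_eq_zero_iff).mp h1

theorem contract_apply {a s : Type} [Fintype a] [DecidableEq a] [Fintype s] (w : s → ℂ)
    (X : Matrix (a × s) (a × s) ℂ) (i j : a) :
    ((Matrix.of fun (i : a) (p : a × s) => if i = p.1 then star (w p.2) else 0) * X *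
      (Matrix.of fun (i : a) (p : a × s) => if i = p.1 then star (w p.2) else 0)ᴴ) i j =
        ∑ k, ∑ l, star (w k) * X (i, k) (j, l) * w l := by
  simp only [Matrix.mul_apply, Matrix.of_apply, Matrix.conjTranspose_apply, ite_mul, zero_mul,
    Fintype.sum_prod_type, apply_ite star, star_star, star_zero, mul_ite, mul_zero,
    Finset.sum_mul, Finset.sum_const_zero, Finset.sum_ite_irrel, Finset.sum_ite_eq,
    Finset.mem_univ, if_true]
  exact Finset.sum_comm

/-- An operation which takes every extension of `ω'` to an extension of `ω` does so in the presence
of an independent system. -/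
theorem testMarginal_amp {r a r' a' s : Type} [Fintype r] [DecidableEq r] [Fintype a]
    [DecidableEq a] [Fintype r'] [DecidableEq r'] [Fintype a'] [DecidableEq a'] [Fintype s]
    [DecidableEq s] {E : Channel (r' × a') (r × a)} {ω' : Matrix r' r' ℂ} {ω : Matrix r r ℂ}
    (hω' : ω'.trace = 1)
    (hE : ∀ ξ, IsState ξ → trRight ξ = ω' → trRight (E ξ) = ω) {σ : Matrix s s ℂ}
    {X : Matrix ((r' × a') × s) ((r' × a') × s) ℂ} (hX : X.PosSemidef)
    (h : testMarginal X = ω' ⊗ₖ σ) : testMarginal (E.amp s X) = ω ⊗ₖ σ := by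
  -- By polarization it is enough to contract the side system with a vector `w`. The contracted `X`
  -- is positive and its restriction is a multiple of `ω'`, so after normalization the hypothesis on
  -- `E` applies.
  have key : ∀ (w : s → ℂ) (p q : r),
      star w ⬝ᵥ ((Matrix.of fun k l => testMarginal (E.amp s X) (p, k) (q, l)) *ᵥ w) =
        ω p q * (star w ⬝ᵥ (σ *ᵥ w)) := by
    intro w p q
    obtain ⟨K, hK⟩ : ∃ K : Matrix (r' × a') ((r' × a') × s) ℂ, ∀ i j,
      (K * X * Kᴴ) i j = ∑ k, ∑ l, star (w k) * X (i, k) (j, l) * w l :=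
        ⟨_, contract_apply w X⟩
    have hY : (K * X * Kᴴ).PosSemidef := hX.mul_mul_conjTranspose_same K
    have hYr : trRight (K * X * Kᴴ) = (star w ⬝ᵥ (σ *ᵥ w)) • ω' := by
      ext i j
      have h1 := fun k l => congrFun (congrFun h (i, k)) (j, l)
      simp only [testMarginal, Matrix.of_apply, Matrix.kroneckerMap_apply] at h1
      simp only [trRight, Matrix.of_apply, hK, Matrix.smul_apply, smul_eq_mul, dotProduct,
        Matrix.mulVec, Pi.star_apply, Finset.sum_mul, Finset.mul_sum]
      rw [Finset.sum_comm]
      refine Finset.sum_congr rfl fun k _ => ?_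
      rw [Finset.sum_comm]
      refine Finset.sum_congr rfl fun l _ => ?_
      rw [← Finset.sum_mul, ← Finset.mul_sum, h1]
      ring
    have hEr : trRight (E (K * X * Kᴴ)) = (star w ⬝ᵥ (σ *ᵥ w)) • ω := by
      set z := star w ⬝ᵥ (σ *ᵥ w)
      have hz : (K * X * Kᴴ).trace = z := by
        rw [← trace_trRight, hYr, Matrix.trace_smul, hω', smul_eq_mul, mul_one]
      -- Without normalization when the weight vanishes: a positive operator of trace zero is zero.
      by_cases hz0 : z = 0
      · have h0 : K * X * Kᴴ = 0 := hY.trace_eq_zero_iff.mp (hz.trans hz0)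
        rw [h0, Channel.map_zero, hz0, zero_smul]
        ext i j
        simp [trRight]
      · have hznn : 0 ≤ z := hz ▸ hY.trace_nonneg
        have h2 := hE (z⁻¹ • (K * X * Kᴴ)) ⟨hY.smul (inv_nonneg.mpr hznn), by
          rw [Matrix.trace_smul, hz, smul_eq_mul, inv_mul_cancel₀ hz0]⟩ (by
            rw [← Channel.disc_apply, Channel.map_smul, Channel.disc_apply, hYr, smul_smul,
              inv_mul_cancel₀ hz0, one_smul])
        rw [← Channel.disc_apply, Channel.map_smul, Channel.map_smul, Channel.disc_apply] at h2
        rw [← h2, smul_smul, mul_inv_cancel₀ hz0, one_smul]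
    have h3 : K * X * Kᴴ = ∑ k, ∑ l, (star (w k) * w l) • Matrix.of fun i j => X (i, k) (j, l) := by
      ext i j
      rw [hK]
      simp only [Matrix.sum_apply, Matrix.smul_apply, smul_eq_mul, Matrix.of_apply]
      exact Finset.sum_congr rfl fun k _ => Finset.sum_congr rfl fun l _ => by ring
    have h4 := congrFun (congrFun hEr p) q
    rw [h3] at h4
    simp only [Channel.map_sum, Channel.map_smul, trRight, Matrix.of_apply, Matrix.sum_apply,
      Matrix.smul_apply, smul_eq_mul] at h4
    rw [mul_comm, ← h4]
    simp only [dotProduct, Matrix.mulVec, Pi.star_apply, testMarginal, Matrix.of_apply,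
      Finset.sum_mul, Finset.mul_sum]
    refine Eq.symm (Finset.sum_comm.trans (Finset.sum_congr rfl fun k _ => ?_))
    refine Finset.sum_comm.trans (Finset.sum_congr rfl fun l _ => ?_)
    refine Finset.sum_congr rfl fun x _ => ?_
    rw [Channel.amp_apply]
    ring
  ext ⟨p, k⟩ ⟨q, l⟩
  have h5 : (Matrix.of fun k l => testMarginal (E.amp s X) (p, k) (q, l)) - ω p q • σ = 0 := by
    refine eq_zero_of_forall_dotProduct fun w => ?_
    rw [Matrix.sub_mulVec, dotProduct_sub, key, Matrix.smul_mulVec, dotProduct_smul, smul_eq_mul,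
      sub_self]
  have h6 := congrFun (congrFun h5 k) l
  simp only [Matrix.sub_apply, Matrix.of_apply, Matrix.smul_apply, smul_eq_mul,
    Matrix.zero_apply] at h6
  exact sub_eq_zero.mp h6

namespace Resource

variable {r r' r'' : Resource}

/-- The condition on the encoding in a reduction concerns Alice's system alone; the joint extension
of test and source state is handled by `testMarginal_amp`. -/
theorem testMarginal_encode {E : Channel (r'.Arel × r'.Aabs) (r.Arel × r.Aabs)} {T : Sys}
    {e : r'.S × T ≃ r.S} {τ : Matrix T T ℂ} {hτ : IsState τ}
    (hρ : r.ρ = (r'.ρ ⊗ₖ τ).submatrix e.symm e.symm)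
    (hE : ∀ ξ, IsState ξ → trRight ξ = r'.ω → trRight (E ξ) = r.ω) {ξ} (hξ : IsState ξ)
    (h : testMarginal ξ = r'.ω ⊗ₖ r'.ρ) :
    testMarginal (E.tensor ((Channel.relabel e).comp (Channel.append r'.S τ hτ)) ξ) =
      r.ω ⊗ₖ r.ρ := by
  have h1 := testMarginal_amp r'.isState_ω.trace_eq_one hE hξ.posSemidef h
  ext ⟨p, s⟩ ⟨q, s'⟩
  have h2 := congrFun (congrFun h1 (p, (e.symm s).1)) (q, (e.symm s').1)
  have h3 : testMarginal (E.tensor ((Channel.relabel e).comp (Channel.append r'.S τ hτ)) ξ)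
      (p, s) (q, s') = ∑ k, E.amp r'.S ξ ((p, k), (e.symm s).1) ((q, k), (e.symm s').1) *
        τ (e.symm s).2 (e.symm s').2 := rfl
  rw [h3, ← Finset.sum_mul, hρ]
  refine (congrArg (· * τ (e.symm s).2 (e.symm s').2) h2).trans ?_
  exact mul_assoc _ _ _

theorem reduces_of_relabel (eR : r'.Arel ≃ r.Arel) (eX : r'.Aabs ≃ r.Aabs) (eS : r'.S ≃ r.S)
    (eA : r'.A ≃ r.A) (eB : r'.B ≃ r.B) (hω : ∀ i j, r'.ω i j = r.ω (eR i) (eR j))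
    (hρ : ∀ i j, r'.ρ i j = r.ρ (eS i) (eS j))
    (hN : ∀ X p q, r'.N X p q = r.N (X.submatrix ((eR.prodCongr eX).prodCongr eS).symm
      ((eR.prodCongr eX).prodCongr eS).symm) (eA p.1, eB p.2) (eA q.1, eB q.2)) :
    r.Reduces r' := by
  refine ⟨Channel.relabel (eR.prodCongr eX), Channel.relabel eA.symm, Channel.relabel eB.symm,
    .of Unit, (Equiv.prodPUnit r'.S).trans eS, 1, isState_one_unit, ?_, fun ξ hξ h => ?_, ?_⟩
  · ext i j
    have : r.ρ i j = r'.ρ (eS.symm i) (eS.symm j) * 1 := by simp [hρ]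
    exact this
  · ext i j
    have h1 := congrFun (congrFun h (eR.symm i)) (eR.symm j)
    rw [hω, eR.apply_symm_apply, eR.apply_symm_apply] at h1
    rw [← h1]
    exact (Equiv.sum_comp eX.symm fun k => ξ (eR.symm i, k) (eR.symm j, k))
  · apply Channel.ext_toFun
    intro X
    ext p q
    rw [hN]
    refine congrFun (congrFun (congrArg r.N.toFun ?_) (eA p.1, eB p.2)) (eA q.1, eB q.2)
    ext i j
    exact (mul_one _).symm

theorem Reduces.refl (r : Resource) : r.Reduces r :=
  reduces_of_relabel (Equiv.refl _) (Equiv.refl _) (Equiv.refl _) (Equiv.refl _) (Equiv.refl _)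
    (fun _ _ => rfl) (fun _ _ => rfl) fun _ _ _ => rfl

theorem Reduces.trans (h₁ : r.Reduces r') (h₂ : r'.Reduces r'') : r.Reduces r'' := by
  obtain ⟨E₁, A₁, B₁, T₁, e₁, τ₁, hτ₁, hρ₁, hE₁, hN₁⟩ := h₁
  obtain ⟨E₂, A₂, B₂, T₂, e₂, τ₂, hτ₂, hρ₂, hE₂, hN₂⟩ := h₂
  let e : r''.S × (T₂ × T₁) ≃ r.S :=
    (Equiv.prodAssoc r''.S T₂ T₁).symm.trans ((e₂.prodCongr (Equiv.refl T₁)).trans e₁)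
  refine ⟨E₁.comp E₂, A₂.comp A₁, B₂.comp B₁, .of (T₂ × T₁), e, τ₂ ⊗ₖ τ₁, hτ₂.kronecker hτ₁, ?_,
    fun ξ hξ h => hE₁ _ (E₂.isState hξ) (hE₂ ξ hξ h), ?_⟩
  · rw [hρ₁, hρ₂]
    ext i j
    exact mul_assoc _ _ _
  · have h3 : (Channel.relabel e).comp (Channel.append r''.S (τ₂ ⊗ₖ τ₁) (hτ₂.kronecker hτ₁)) =
        ((Channel.relabel e₁).comp (Channel.append r'.S τ₁ hτ₁)).comp
          ((Channel.relabel e₂).comp (Channel.append r''.S τ₂ hτ₂)) := by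
      apply Channel.ext_toFun
      intro X
      ext i j
      exact (mul_assoc _ _ _).symm
    refine Eq.trans ?_ (congrArg (fun S => (((A₂.comp A₁).tensor (B₂.comp B₁)).comp r.N).comp
      ((E₁.comp E₂).tensor S)) h3.symm)
    rw [← Channel.tensor_comp_tensor, ← Channel.tensor_comp_tensor, hN₂, hN₁]
    rfl

/-- Reductions act on the second factor of a tensor product. -/
theorem Reduces.tensor_left (s : Resource) (h : r.Reduces r') :
    (s.tensor r).Reduces (s.tensor r') := by
  obtain ⟨E, A, B, T, e, τ, hτ, hρ, hE, hN⟩ := h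
  let E' : Channel ((s.Arel × r'.Arel) × (s.Aabs × r'.Aabs))
      ((s.Arel × r.Arel) × (s.Aabs × r.Aabs)) :=
    (Channel.relabel (Equiv.prodProdProdComm s.Arel s.Aabs r.Arel r.Aabs)).comp
      ((Channel.relabel (Equiv.prodComm _ _)).comp ((E.amp (s.Arel × s.Aabs)).comp
        ((Channel.relabel (Equiv.prodComm _ _)).comp
          (Channel.relabel (Equiv.prodProdProdComm s.Arel r'.Arel s.Aabs r'.Aabs)))))
  let A' : Channel (s.A × r.A) (s.A × r'.A) :=
    (Channel.relabel (Equiv.prodComm _ _)).comp ((A.amp s.A).comp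
      (Channel.relabel (Equiv.prodComm _ _)))
  let B' : Channel (s.B × r.B) (s.B × r'.B) :=
    (Channel.relabel (Equiv.prodComm _ _)).comp ((B.amp s.B).comp
      (Channel.relabel (Equiv.prodComm _ _)))
  let e' : (s.S × r'.S) × T ≃ s.S × r.S :=
    (Equiv.prodAssoc s.S r'.S T).trans ((Equiv.refl s.S).prodCongr e)
  refine ⟨E', A', B', T, e', τ, hτ, ?_, fun ξ hξ h => ?_, ?_⟩
  · ext i j
    refine (congrArg (s.ρ i.1 j.1 * ·) (congrFun (congrFun hρ i.2) j.2)).trans ?_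
    exact (mul_assoc _ _ _).symm
  · let ζ : Matrix (((r'.Arel × r'.Aabs) × s.Arel) × s.Aabs)
        (((r'.Arel × r'.Aabs) × s.Arel) × s.Aabs) ℂ :=
      Matrix.of fun p q => ξ ((p.1.2, p.1.1.1), (p.2, p.1.1.2)) ((q.1.2, q.1.1.1), (q.2, q.1.1.2))
    have hζ : (trRight ζ).PosSemidef := by
      let f : (((r'.Arel × r'.Aabs) × s.Arel) × s.Aabs) →
          ((s.Arel × r'.Arel) × (s.Aabs × r'.Aabs)) :=
        fun p => ((p.1.2, p.1.1.1), (p.2, p.1.1.2))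
      have h1 : (∑ k, (ξ.submatrix f f).submatrix (fun p => (p, k)) (fun p => (p, k))).PosSemidef :=
        Matrix.posSemidef_sum _ fun k _ => (hξ.posSemidef.submatrix f).submatrix _
      convert h1 using 1
      ext p q
      rw [Matrix.sum_apply]
      rfl
    have h1 : testMarginal (trRight ζ) = r'.ω ⊗ₖ s.ω := by
      ext p q
      have h2 := congrFun (congrFun h (p.2, p.1)) (q.2, q.1)
      refine Eq.trans ?_ (h2.trans (mul_comm _ _))
      refine Eq.trans ?_ (Fintype.sum_prod_type _).symm
      exact Finset.sum_comm
    have h2 := testMarginal_amp r'.isState_ω.trace_eq_one hE hζ h1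
    ext p q
    have h3 := congrFun (congrFun h2 (p.2, p.1)) (q.2, q.1)
    refine Eq.trans ?_ (h3.trans (mul_comm _ _))
    refine (Fintype.sum_prod_type _).trans ?_
    refine Finset.sum_comm.trans (Finset.sum_congr rfl fun k _ => ?_)
    have h4 : (Matrix.of fun i j => trRight ζ (i, p.1) (j, q.1)) = ∑ α : s.Aabs,
        Matrix.of fun i j => ζ ((i, p.1), α) ((j, q.1), α) := by
      ext i j
      simp [trRight, Matrix.sum_apply]
    refine Eq.trans ?_ (congrArg (fun Y => E Y (p.2, k) (q.2, k)) h4.symm)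
    rw [Channel.map_sum, Matrix.sum_apply]
    rfl
  · apply Channel.ext_toFun
    intro Z
    ext p q
    have h1 : (s.tensor r').N Z p q = r'.N (Matrix.of fun j j' => s.N (Matrix.of fun i i' =>
        Z (((i.1.1, j.1.1), (i.1.2, j.1.2)), (i.2, j.2))
          (((i'.1.1, j'.1.1), (i'.1.2, j'.1.2)), (i'.2, j'.2))) (p.1.1, p.2.1) (q.1.1, q.2.1))
            (p.1.2, p.2.2) (q.1.2, q.2.2) := rfl
    rw [h1, hN]
    -- The operation of `s` commutes with the encoding for `r`, being on other systems.
    have h2 : E.tensor ((Channel.relabel e).comp (Channel.append r'.S τ hτ))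
        (Matrix.of fun j j' => s.N (Matrix.of fun i i' =>
        Z (((i.1.1, j.1.1), (i.1.2, j.1.2)), (i.2, j.2))
          (((i'.1.1, j'.1.1), (i'.1.2, j'.1.2)), (i'.2, j'.2))) (p.1.1, p.2.1) (q.1.1, q.2.1)) =
        Matrix.of fun k k' => s.N (Matrix.of fun i i' =>
          E.tensor ((Channel.relabel e).comp (Channel.append r'.S τ hτ)) (Matrix.of fun j j' =>
          Z (((i.1.1, j.1.1), (i.1.2, j.1.2)), (i.2, j.2))
          (((i'.1.1, j'.1.1), (i'.1.2, j'.1.2)), (i'.2, j'.2))) k k') (p.1.1, p.2.1)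
            (q.1.1, q.2.1) := by
      ext k k'
      exact Channel.comm_apply s.N
        (E.tensor ((Channel.relabel e).comp (Channel.append r'.S τ hτ)))
        (fun i i' j j' => Z (((i.1.1, j.1.1), (i.1.2, j.1.2)), (i.2, j.2))
          (((i'.1.1, j'.1.1), (i'.1.2, j'.1.2)), (i'.2, j'.2))) (p.1.1, p.2.1) (q.1.1, q.2.1) k k'
    exact congrArg (fun Y => A.tensor B (r.N Y) (p.1.2, p.2.2) (q.1.2, q.2.2)) h2

theorem reduces_comm (r s : Resource) : (r.tensor s).Reduces (s.tensor r) := by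
  refine reduces_of_relabel (Equiv.prodComm _ _) (Equiv.prodComm _ _) (Equiv.prodComm _ _)
    (Equiv.prodComm _ _) (Equiv.prodComm _ _) (fun _ _ => mul_comm _ _) (fun _ _ => mul_comm _ _)
    fun Z p q => ?_
  exact Channel.comm_apply s.N r.N (fun j j' i i' =>
    Z (((j.1.1, i.1.1), (j.1.2, i.1.2)), (j.2, i.2))
      (((j'.1.1, i'.1.1), (j'.1.2, i'.1.2)), (j'.2, i'.2))) (p.1.1, p.2.1) (q.1.1, q.2.1)
        (p.1.2, p.2.2) (q.1.2, q.2.2)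

theorem reduces_assoc (r s t : Resource) :
    ((r.tensor s).tensor t).Reduces (r.tensor (s.tensor t)) :=
  reduces_of_relabel (Equiv.prodAssoc _ _ _).symm (Equiv.prodAssoc _ _ _).symm
    (Equiv.prodAssoc _ _ _).symm (Equiv.prodAssoc _ _ _).symm (Equiv.prodAssoc _ _ _).symm
    (fun _ _ => (mul_assoc _ _ _).symm) (fun _ _ => (mul_assoc _ _ _).symm) fun _ _ _ => rfl

theorem reduces_assoc' (r s t : Resource) :
    (r.tensor (s.tensor t)).Reduces ((r.tensor s).tensor t) :=
  reduces_of_relabel (Equiv.prodAssoc _ _ _) (Equiv.prodAssoc _ _ _)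
    (Equiv.prodAssoc _ _ _) (Equiv.prodAssoc _ _ _) (Equiv.prodAssoc _ _ _)
    (fun _ _ => mul_assoc _ _ _) (fun _ _ => mul_assoc _ _ _) fun _ _ _ => rfl

theorem reduces_tensor_trivial (r : Resource) : r.Reduces (r.tensor trivial) :=
  reduces_of_relabel (Equiv.prodPUnit _) (Equiv.prodPUnit _) (Equiv.prodPUnit _)
    (Equiv.prodPUnit _) (Equiv.prodPUnit _) (fun _ _ => mul_one _) (fun _ _ => mul_one _)
    fun _ _ _ => rfl

theorem tensor_trivial_reduces (r : Resource) : (r.tensor trivial).Reduces r :=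
  reduces_of_relabel (Equiv.prodPUnit _).symm (Equiv.prodPUnit _).symm (Equiv.prodPUnit _).symm
    (Equiv.prodPUnit _).symm (Equiv.prodPUnit _).symm (fun _ _ => (mul_one _).symm)
    (fun _ _ => (mul_one _).symm) fun _ _ _ => rfl

/-- Alice supplies a fixed input with the right test state, and all outputs are discarded. -/
theorem reduces_trivial (r : Resource) : r.Reduces trivial := by
  let α : Matrix r.Aabs r.Aabs ℂ := Matrix.single (Classical.arbitrary _) (Classical.arbitrary _) 1
  have hα : IsState α := isState_single _
  refine ⟨(Channel.relabel (Equiv.punitProd _)).comp ((Channel.append Unit (r.ω ⊗ₖ α)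
    (r.isState_ω.kronecker hα)).comp (Channel.discard (Unit × Unit))), Channel.discard _,
      Channel.discard _, r.S, Equiv.punitProd _, r.ρ, r.isState_ρ, ?_, fun ξ hξ h => ?_, ?_⟩
  · ext i j
    exact (one_mul _).symm
  · ext i j
    have h1 : Channel.discard (Unit × Unit) ξ () () = 1 :=
      ((Channel.discard (Unit × Unit)).isState hξ).apply_of_subsingleton () ()
    have h2 : ∑ k, α k k = 1 := hα.trace_eq_one
    refine (Finset.sum_congr rfl fun k _ => congrArg (· * (r.ω i j * α k k)) h1).trans ?_
    rw [← Finset.mul_sum, ← Finset.mul_sum, h2, mul_one, one_mul]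
  · have : Subsingleton (trivial.A × trivial.B) := inferInstanceAs (Subsingleton (Unit × Unit))
    exact Channel.eq_of_subsingleton _ _

end Resource

/-- A protocol creating `r` creates everything `r` reduces to. -/
theorem Creates.reduces {l : Depth} {r r' : Resource} {ε : ℝ} (h : Creates l r ε)
    (hr : r.Reduces r') : Creates l r' ε := by
  obtain ⟨P, hv, ha⟩ := h
  obtain ⟨E, A, B, T, e, τ, hτ, hρ, hE, hN⟩ := hr
  let src : r'.S × (T × P.T) ≃ srcSys P.order :=
    (Equiv.prodAssoc r'.S T P.T).symm.trans ((e.prodCongr (Equiv.refl P.T)).trans P.src)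
  let P' : Protocol l r' :=
    { order := P.order
      perm := P.perm
      M₀ := P.M₀
      M₁ := P.M₁
      enc := P.enc.comp E
      steps := P.steps
      fin := A.comp P.fin
      dec := B.comp P.dec
      T := .of (T × P.T)
      src := src
      τ := τ ⊗ₖ P.τ
      isState_τ := hτ.kronecker P.isState_τ
      src_eq := by
        rw [P.src_eq, hρ]
        ext i j
        exact mul_assoc _ _ _ }
  have hin : P'.input = P.input.comp
      (E.tensor ((Channel.relabel e).comp (Channel.append r'.S τ hτ))) := by
    have h1 : (Channel.relabel src).comp (Channel.append r'.S (τ ⊗ₖ P.τ)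
        (hτ.kronecker P.isState_τ)) = ((Channel.relabel P.src).comp
          (Channel.append r.S P.τ P.isState_τ)).comp
            ((Channel.relabel e).comp (Channel.append r'.S τ hτ)) := by
      apply Channel.ext_toFun
      intro X
      ext i j
      exact (mul_assoc _ _ _).symm
    exact (congrArg (fun S => (P.enc.comp E).tensor S) h1).trans
      (Channel.tensor_comp_tensor _ _ _ _).symm
  have hop : P'.op = ((A.tensor B).comp P.op).comp
      (E.tensor ((Channel.relabel e).comp (Channel.append r'.S τ hτ))) := by
    refine (congrArg (fun I => ((A.comp P.fin).tensor (B.comp P.dec)).comp (P.steps.run.comp I))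
      hin).trans ?_
    rw [← Channel.tensor_comp_tensor]
    rfl
  refine ⟨P', fun ξ hξ hm => ?_, fun R ξ hξ hm => ?_⟩
  · have := hv _ (Channel.isState _ hξ) (Resource.testMarginal_encode (hτ := hτ) hρ hE hξ hm)
    exact Eq.mp (congrArg (fun I : Channel _ _ => P.steps.Valid ε (I ξ)) hin.symm) this
  · rw [hop, hN]
    let C := E.tensor ((Channel.relabel e).comp (Channel.append r'.S τ hτ))
    have h1 := ha R (C.amp R ξ) (Channel.isState _ hξ) (by
      rw [Channel.trRight_amp]
      exact Resource.testMarginal_encode hρ hE ((Channel.disc _ R).isState hξ) hm)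
    refine le_trans ?_ h1
    refine Eq.trans_le (congrArg traceNorm ?_) (((A.tensor B).amp R).traceNorm_le _)
    exact (Channel.map_sub ((A.tensor B).amp R) (P.op.amp R (C.amp R ξ))
      (r.N.amp R (C.amp R ξ))).symm

/-! ### The ordered monoid of depth-one resources -/

instance : Preorder Resource where
  le r' r := r.Reduces r'
  le_refl := Resource.Reduces.refl
  le_trans _ _ _ h₁ h₂ := h₂.trans h₁

/-- Depth-one resources up to mutual reduction. -/
abbrev ResClass : Type 1 := Antisymmetrization Resource (· ≤ ·)

/-- The class of a resource. -/
def Resource.cls (r : Resource) : ResClass := toAntisymmetrization (· ≤ ·) r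

theorem cls_le {r r' : Resource} : r'.cls ≤ r.cls ↔ r.Reduces r' :=
  toAntisymmetrization_le_toAntisymmetrization_iff

namespace Resource

theorem Reduces.tensor {r r' s s' : Resource} (h : r.Reduces r') (h' : s.Reduces s') :
    (r.tensor s).Reduces (r'.tensor s') :=
  (h'.tensor_left r).trans
    (((reduces_comm r s').trans (h.tensor_left s')).trans (reduces_comm s' r'))

end Resource

theorem cls_eq {r r' : Resource} (h : r.Reduces r') (h' : r'.Reduces r) : r.cls = r'.cls :=
  le_antisymm (cls_le.mpr h') (cls_le.mpr h)

/-- Up to mutual reduction the tensor product is associative and commutative, so the accounting of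
resources becomes arithmetic of monomials instead of explicit regroupings. -/
instance : CommMonoid ResClass where
  mul := Quotient.map₂ Resource.tensor fun _ _ h _ _ h' => ⟨h.1.tensor h'.1, h.2.tensor h'.2⟩
  one := Resource.trivial.cls
  mul_assoc x y z := by
    induction x, y, z using Quotient.inductionOn₃ with
    | _ r s t => exact cls_eq (Resource.reduces_assoc r s t) (Resource.reduces_assoc' r s t)
  mul_comm x y := by
    induction x, y using Quotient.inductionOn₂ with
    | _ r s => exact cls_eq (Resource.reduces_comm r s) (Resource.reduces_comm s r)
  one_mul x := by
    induction x using Quotient.inductionOn with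
    | _ r =>
      exact Eq.trans (b := (r.tensor Resource.trivial).cls)
        (cls_eq (Resource.reduces_comm _ _) (Resource.reduces_comm _ _))
        (cls_eq (Resource.tensor_trivial_reduces r) (Resource.reduces_tensor_trivial r))
  mul_one x := by
    induction x using Quotient.inductionOn with
    | _ r => exact cls_eq (Resource.tensor_trivial_reduces r) (Resource.reduces_tensor_trivial r)

theorem cls_tensor (r s : Resource) : (r.tensor s).cls = r.cls * s.cls := rfl

instance : IsOrderedMonoid ResClass where
  mul_le_mul_left x y h z := by
    induction x, y, z using Quotient.inductionOn₃ with
    | _ r s t => exact cls_le.mpr ((cls_le.mp h).tensor (Resource.Reduces.refl t))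

theorem one_le_resClass (x : ResClass) : 1 ≤ x := by
  induction x using Quotient.inductionOn with
  | _ r => exact cls_le.mpr (Resource.reduces_trivial r)

theorem cls_flatten (l : Depth) : (flatten l).cls = (l.map Resource.cls).prod := by
  induction l with
  | nil => rfl
  | cons r l ih => rw [flatten, cls_tensor, ih, List.map_cons, List.prod_cons]

theorem cls_flatten_append (l l' : Depth) :
    (flatten (l ++ l')).cls = (flatten l).cls * (flatten l').cls := by
  rw [cls_flatten, cls_flatten, cls_flatten, List.map_append, List.prod_append]

theorem cls_tpow (r : Resource) (k : ℕ) : (r.tpow k).cls = r.cls ^ k := by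
  rw [Resource.tpow, cls_flatten, List.map_replicate, List.prod_replicate]

theorem cls_flatten_tpow (l : Depth) (k : ℕ) : (flatten (tpow l k)).cls = (flatten l).cls ^ k := by
  induction l with
  | nil => exact (one_pow k).symm
  | cons r l ih =>
    have h : flatten (tpow (r :: l) k) = (r.tpow k).tensor (flatten (tpow l k)) := rfl
    rw [h, cls_tensor, cls_tpow, ih, flatten, cls_tensor, mul_pow]

/-- Components outside the range of the injection are dropped, as every class is at least `1`. -/
theorem Reduces.flatten {l l' : Depth} (h : Reduces l l') :
    (flatten l').cls ≤ (flatten l).cls := by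
  obtain ⟨f, hf, h⟩ := h
  have h1 : ∀ l : Depth, (QRes.flatten l).cls = ∏ i : Fin l.length, (l.get i).cls := fun l => by
    rw [cls_flatten, ← List.prod_ofFn]
    have h2 : (List.ofFn fun i => (l.get i).cls) = l.map Resource.cls := by
      have := (List.map_ofFn (f := l.get) (g := Resource.cls)).symm
      rwa [List.ofFn_get] at this
    rw [h2]
  rw [h1, h1]
  calc ∏ i, (l'.get i).cls ≤ ∏ i, (l.get (f i)).cls :=
        Finset.prod_le_prod' fun i _ => cls_le.mpr (h i)
    _ = ∏ j ∈ Finset.univ.map ⟨f, hf⟩, (l.get j).cls := (Finset.prod_map Finset.univ ⟨f, hf⟩ fun j => (l.get j).cls).symm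
    _ ≤ ∏ j, (l.get j).cls := Finset.prod_le_prod_of_subset_of_one_le' (Finset.subset_univ _)
        fun _ _ _ => one_le_resClass _

/-! ### Entanglement and noiseless channels of arbitrary dimension -/

/-- The amplitudes of the maximally entangled state. -/
noncomputable def maxEntVec (J : Type) [Fintype J] [DecidableEq J] : Matrix (J × J) Unit ℂ :=
  Matrix.of fun p _ => if p.1 = p.2 then ((√(Fintype.card J) : ℝ) : ℂ)⁻¹ else 0

theorem inv_sqrt_mul_inv_sqrt (n : ℕ) :
    (((√n : ℝ) : ℂ)⁻¹) * ((√n : ℝ) : ℂ)⁻¹ = (n : ℂ)⁻¹ := by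
  rw [← mul_inv, ← Complex.ofReal_mul, Real.mul_self_sqrt (Nat.cast_nonneg n),
    Complex.ofReal_natCast]

theorem maxEntVec_isometry (J : Type) [Fintype J] [DecidableEq J] [Nonempty J] :
    (maxEntVec J)ᴴ * maxEntVec J = 1 := by
  ext i j
  have h : (Fintype.card J : ℂ) ≠ 0 := by exact_mod_cast Fintype.card_ne_zero
  simp [maxEntVec, Matrix.mul_apply, Fintype.sum_prod_type, inv_sqrt_mul_inv_sqrt, h]

/-- The maximally entangled state of two copies of `J`. -/
noncomputable def ebitOf (J : Sys) : Resource :=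
  Resource.proper (Channel.ofIsometry (maxEntVec J) (maxEntVec_isometry J))

/-- The noiseless quantum channel on `J`. -/
def qubitOf (J : Sys) : Resource := Resource.proper (Channel.relabel (Equiv.punitProd J).symm)

/-- The entries of the maximally entangled state. -/
noncomputable def maxEntCoeff (J : Type) [Fintype J] [DecidableEq J] (p q : J × J) : ℂ :=
  if p.1 = p.2 ∧ q.1 = q.2 then (Fintype.card J : ℂ)⁻¹ else 0

theorem ebitOf_apply (J : Sys) (X : Matrix ((Unit × Unit) × Unit) ((Unit × Unit) × Unit) ℂ)
    (p q : J × J) :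
    (ebitOf J).N X p q = maxEntCoeff J p q * X (((), ()), ()) (((), ()), ()) := by
  let Y : Matrix Unit Unit ℂ := X.submatrix (fun _ => (((), ()), ())) (fun _ => (((), ()), ()))
  have h : (ebitOf J).N X p q = (maxEntVec J * Y * (maxEntVec J)ᴴ) p q := rfl
  refine h.trans ?_
  simp only [Matrix.mul_apply, Finset.univ_unique, Finset.sum_singleton, maxEntVec, Matrix.of_apply,
    Matrix.conjTranspose_apply, apply_ite star, star_zero, star_inv₀, maxEntCoeff,
    Complex.star_def, Complex.conj_ofReal, Y, Matrix.submatrix_apply]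
  by_cases hp : p.1 = p.2 <;> by_cases hq : q.1 = q.2 <;> simp [hp, hq]
  rw [mul_right_comm, inv_sqrt_mul_inv_sqrt]

theorem ebitRes_eq : ebitRes = ebitOf (.of (Fin 2)) := by
  have h : ebitVec = maxEntVec (Fin 2) := by
    ext p u
    simp [ebitVec, maxEntVec]
  simp only [ebitRes, ebitOf, h]

theorem maxEntCoeff_congr {J K : Type} [Fintype J] [DecidableEq J] [Fintype K] [DecidableEq K]
    (e : J ≃ K) (p q : J × J) :
    maxEntCoeff J p q = maxEntCoeff K (e p.1, e p.2) (e q.1, e q.2) := by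
  simp only [maxEntCoeff, e.apply_eq_iff_eq, Fintype.card_congr e]

theorem cls_ebitOf_congr {J K : Sys} (e : J ≃ K) : (ebitOf J).cls = (ebitOf K).cls := by
  have h : ∀ {J K : Sys} (_ : J ≃ K), (ebitOf K).Reduces (ebitOf J) := fun {J K} e => by
    refine Resource.reduces_of_relabel (Equiv.refl Unit) (Equiv.refl Unit) (Equiv.refl Unit) e e
      (fun _ _ => rfl) (fun _ _ => rfl) fun X p q => ?_
    refine (ebitOf_apply J X p q).trans (Eq.trans ?_
      (ebitOf_apply K X (e p.1, e p.2) (e q.1, e q.2)).symm)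
    exact congrArg (· * X (((), ()), ()) (((), ()), ())) (maxEntCoeff_congr e p q)
  exact cls_eq (h e.symm) (h e)

theorem maxEntCoeff_prod (J K : Type) [Fintype J] [DecidableEq J] [Fintype K] [DecidableEq K]
    (p q : (J × K) × (J × K)) : maxEntCoeff (J × K) p q =
      maxEntCoeff K (p.1.2, p.2.2) (q.1.2, q.2.2) *
        maxEntCoeff J (p.1.1, p.2.1) (q.1.1, q.2.1) := by
  simp only [maxEntCoeff, Prod.ext_iff, Fintype.card_prod, Nat.cast_mul, mul_inv_rev, ite_mul,
    zero_mul, mul_ite, mul_zero, ← ite_and]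
  exact if_congr (by tauto) rfl rfl

theorem cls_ebitOf_prod (J K : Sys) :
    (ebitOf (.of (J × K))).cls = (ebitOf J).cls * (ebitOf K).cls := by
  let o : ((Unit × Unit) × (Unit × Unit)) × (Unit × Unit) := ((((), ()), ((), ())), ((), ()))
  have h : ∀ X (p q : (J × K) × (J × K)), ((ebitOf J).tensor (ebitOf K)).N X p q =
      maxEntCoeff (J × K) p q * X o o := by
    intro X p q
    have h1 : ((ebitOf J).tensor (ebitOf K)).N X p q =
      (ebitOf K).N (Matrix.of fun j j' => (ebitOf J).N (Matrix.of fun i i' =>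
        X (((i.1.1, j.1.1), (i.1.2, j.1.2)), (i.2, j.2))
          (((i'.1.1, j'.1.1), (i'.1.2, j'.1.2)), (i'.2, j'.2))) (p.1.1, p.2.1) (q.1.1, q.2.1))
            (p.1.2, p.2.2) (q.1.2, q.2.2) := rfl
    refine h1.trans ((ebitOf_apply K _ _ _).trans ?_)
    refine (congrArg (maxEntCoeff K (p.1.2, p.2.2) (q.1.2, q.2.2) * ·)
      (ebitOf_apply J _ _ _)).trans ?_
    rw [maxEntCoeff_prod, mul_assoc]
    rfl
  refine cls_eq (Resource.reduces_of_relabel (Equiv.prodPUnit Unit) (Equiv.prodPUnit Unit)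
    (Equiv.prodPUnit Unit) (Equiv.refl (J × K)) (Equiv.refl (J × K)) (fun _ _ => one_mul _)
    (fun _ _ => one_mul _) fun X p q => ?_) (Resource.reduces_of_relabel (Equiv.prodPUnit Unit).symm
    (Equiv.prodPUnit Unit).symm (Equiv.prodPUnit Unit).symm (Equiv.refl (J × K))
    (Equiv.refl (J × K)) (fun _ _ => (one_mul _).symm) (fun _ _ => (one_mul _).symm)
    fun X p q => ?_)
  · refine Eq.trans ?_ (ebitOf_apply (.of (J × K)) _ p q).symm
    exact h X p q
  · refine Eq.trans ?_ (h _ p q).symm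
    exact ebitOf_apply (.of (J × K)) X p q

theorem cls_ebitOf_unit : (ebitOf (.of Unit)).cls = 1 := by
  have h : ∀ X p q, (ebitOf (.of Unit)).N X p q = Resource.trivial.N X p q := fun X p q => by
    refine (ebitOf_apply (.of Unit) X p q).trans ?_
    have h1 : maxEntCoeff (Sys.of Unit) p q = 1 :=
      (if_pos ⟨Subsingleton.elim (α := Unit) _ _, Subsingleton.elim (α := Unit) _ _⟩).trans
        (by simp)
    rw [h1, one_mul]
    rfl
  exact cls_eq (Resource.reduces_of_relabel (Equiv.refl Unit) (Equiv.refl Unit) (Equiv.refl Unit)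
    (Equiv.refl Unit) (Equiv.refl Unit) (fun _ _ => rfl) (fun _ _ => rfl)
    fun X p q => (h X p q).symm) (Resource.reduces_of_relabel (Equiv.refl Unit) (Equiv.refl Unit)
    (Equiv.refl Unit) (Equiv.refl Unit) (Equiv.refl Unit) (fun _ _ => rfl) (fun _ _ => rfl)
    fun X p q => h X p q)

theorem cls_qubitOf_congr {J K : Sys} (e : J ≃ K) : (qubitOf J).cls = (qubitOf K).cls := by
  have h : ∀ {J K : Sys} (_ : J ≃ K), (qubitOf K).Reduces (qubitOf J) := fun {J K} e => by
    refine Resource.reduces_of_relabel (Equiv.refl Unit) e (Equiv.refl Unit) (Equiv.refl Unit) e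
      (fun _ _ => rfl) (fun _ _ => rfl) fun X p q => ?_
    have h1 : ∀ J : Sys, ∀ X p q, (qubitOf J).N X p q = X (((), p.2), ()) (((), q.2), ()) :=
      fun _ _ _ _ => rfl
    refine (h1 J X p q).trans (Eq.trans ?_ (h1 K _ _ _).symm)
    exact (congrArg₂ (fun i j : J => X (((), i), ()) (((), j), ())) (e.symm_apply_apply p.2)
      (e.symm_apply_apply q.2)).symm
  exact cls_eq (h e.symm) (h e)

theorem cls_qubitOf_prod (J K : Sys) :
    (qubitOf (.of (J × K))).cls = (qubitOf J).cls * (qubitOf K).cls :=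
  cls_eq (Resource.reduces_of_relabel (Equiv.prodPUnit Unit) (Equiv.refl (J × K))
    (Equiv.prodPUnit Unit) (Equiv.prodPUnit Unit) (Equiv.refl (J × K)) (fun _ _ => one_mul _)
    (fun _ _ => one_mul _) fun _ _ _ => rfl) (Resource.reduces_of_relabel
    (Equiv.prodPUnit Unit).symm (Equiv.refl (J × K)) (Equiv.prodPUnit Unit).symm
    (Equiv.prodPUnit Unit).symm (Equiv.refl (J × K)) (fun _ _ => (one_mul _).symm)
    (fun _ _ => (one_mul _).symm) fun _ _ _ => rfl)

theorem cls_qubitOf_unit : (qubitOf (.of Unit)).cls = 1 :=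
  cls_eq (Resource.reduces_of_relabel (Equiv.refl Unit) (Equiv.refl Unit) (Equiv.refl Unit)
    (Equiv.refl Unit) (Equiv.refl Unit) (fun _ _ => rfl) (fun _ _ => rfl) fun _ _ _ => rfl)
    (Resource.reduces_of_relabel (Equiv.refl Unit) (Equiv.refl Unit)
    (Equiv.refl Unit) (Equiv.refl Unit) (Equiv.refl Unit) (fun _ _ => rfl) (fun _ _ => rfl)
    fun _ _ _ => rfl)

/-- A multiplicative invariant of systems is determined by its value for a qubit. -/
theorem eq_pow_of_card {F : Sys → ResClass} (h₁ : ∀ {J K : Sys}, (J ≃ K) → F J = F K)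
    (h₂ : ∀ J K : Sys, F (.of (J × K)) = F J * F K) (h₃ : F (.of Unit) = 1) :
    ∀ (r : ℕ) (J : Sys), Fintype.card J = 2 ^ r → F J = F (.of (Fin 2)) ^ r
  | 0, J, h => by
    have e : J ≃ Unit := Fintype.equivOfCardEq (by simpa using h)
    rw [h₁ (K := .of Unit) e, h₃, pow_zero]
  | r + 1, J, h => by
    have e : J ≃ (Fin r → Fin 2) × Fin 2 := Fintype.equivOfCardEq (by simp [h, pow_succ])
    rw [h₁ (K := .of ((Sys.of (Fin r → Fin 2)) × (Sys.of (Fin 2)))) e, h₂,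
      eq_pow_of_card h₁ h₂ h₃ r (.of (Fin r → Fin 2)) (by simp), pow_succ]

theorem cls_ebitOf {J : Sys} {r : ℕ} (h : Fintype.card J = 2 ^ r) :
    (ebitOf J).cls = ebitRes.cls ^ r := by
  rw [ebitRes_eq]
  exact eq_pow_of_card (F := fun J => (ebitOf J).cls) cls_ebitOf_congr cls_ebitOf_prod
    cls_ebitOf_unit r J h

theorem cls_qubitOf {J : Sys} {r : ℕ} (h : Fintype.card J = 2 ^ r) :
    (qubitOf J).cls = qubitRes.cls ^ r :=
  eq_pow_of_card (F := fun J => (qubitOf J).cls) cls_qubitOf_congr cls_qubitOf_prod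
    cls_qubitOf_unit r J h

/-! ### Classical channels -/

theorem isClassical_trivial : IsClassical Resource.trivial (Equiv.prodPUnit Unit) where
  arel := inferInstanceAs (Subsingleton Unit)
  source := inferInstanceAs (Subsingleton Unit)
  alice := inferInstanceAs (Subsingleton Unit)
  apply _ _ _ _ := (if_pos (Subsingleton.elim (α := Unit) _ _)).symm

theorem IsClassical.tensor {c d : Resource} {e : c.Arel × c.Aabs ≃ c.B}
    {f : d.Arel × d.Aabs ≃ d.B} (hc : IsClassical c e) (hd : IsClassical d f) :
    IsClassical (c.tensor d) ((Equiv.prodProdProdComm c.Arel d.Arel c.Aabs d.Aabs).trans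
      (e.prodCongr f)) where
  arel := by
    have := hc.arel
    have := hd.arel
    exact inferInstanceAs (Subsingleton (c.Arel × d.Arel))
  source := by
    have := hc.source
    have := hd.source
    exact inferInstanceAs (Subsingleton (c.S × d.S))
  alice := by
    have := hc.alice
    have := hd.alice
    exact inferInstanceAs (Subsingleton (c.A × d.A))
  apply X s p q := by
    have h1 : (c.tensor d).N X p q = d.N (Matrix.of fun j j' => c.N (Matrix.of fun i i' =>
        X (((i.1.1, j.1.1), (i.1.2, j.1.2)), (i.2, j.2))
          (((i'.1.1, j'.1.1), (i'.1.2, j'.1.2)), (i'.2, j'.2))) (p.1.1, p.2.1) (q.1.1, q.2.1))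
            (p.1.2, p.2.2) (q.1.2, q.2.2) := rfl
    refine h1.trans ((hd.apply _ s.2 _ _).trans ?_)
    by_cases h2 : p.2.2 = q.2.2
    · refine (if_pos h2).trans ((hc.apply _ s.1 _ _).trans ?_)
      by_cases h3 : p.2.1 = q.2.1
      · exact (if_pos h3).trans (if_pos (Prod.ext h3 h2)).symm
      · exact (if_neg h3).trans (if_neg fun h => h3 (congrArg Prod.fst h)).symm
    · exact (if_neg h2).trans (if_neg fun h => h2 (congrArg Prod.snd h)).symm

theorem isClassical_cbitRes : IsClassical cbitRes (Equiv.punitProd (Fin 2)) where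
  arel := inferInstanceAs (Subsingleton Unit)
  source := inferInstanceAs (Subsingleton Unit)
  alice := inferInstanceAs (Subsingleton Unit)
  apply X s p q := by
    let Y : Matrix (Fin 2) (Fin 2) ℂ := X.submatrix (fun i => (((), i), ())) (fun i => (((), i), ()))
    have h : cbitRes.N X p q = Channel.dephase (Fin 2) Y p.2 q.2 := rfl
    refine h.trans (Eq.trans (b := if p.2 = q.2 then Y p.2 q.2 else 0) ?_ rfl)
    obtain ⟨_, (i : Fin 2)⟩ := p
    obtain ⟨_, (j : Fin 2)⟩ := q
    change (∑ x : Fin 2, Matrix.single x x (1 : ℂ) * Y * (Matrix.single x x (1 : ℂ))ᴴ) i j =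
      if i = j then Y i j else 0
    fin_cases i <;> fin_cases j <;> simp [Matrix.mul_apply, Matrix.single_apply]

theorem exists_isClassical_flatten_replicate (N : ℕ) :
    Fintype.card (flatten (List.replicate N cbitRes)).B = 2 ^ N ∧
      ∃ e, IsClassical (flatten (List.replicate N cbitRes)) e := by
  induction N with
  | zero => exact ⟨rfl, _, isClassical_trivial⟩
  | succ N ih =>
    obtain ⟨h, e, he⟩ := ih
    refine ⟨?_, _, isClassical_cbitRes.tensor he⟩
    refine (Fintype.card_prod (Fin 2) (flatten (List.replicate N cbitRes)).B).trans ?_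
    rw [h, Fintype.card_fin, pow_succ']

/-! ### The Weyl operators and teleportation -/

section weyl

variable (d : ℕ) [NeZero d]

/-- The product of the Weyl operators with labels `x` and `k`. -/
noncomputable def weyl (k x : ZMod d × ZMod d) : Matrix (ZMod d) (ZMod d) ℂ :=
  Matrix.of fun j m => if j = m + x.1 + k.1 then
    ZMod.stdAddChar (x.2 * (m + k.1) + k.2 * m) else 0

theorem star_stdAddChar (x : ZMod d) : star (ZMod.stdAddChar x : ℂ) = ZMod.stdAddChar (-x) :=
  (AddChar.map_neg_eq_conj _ _).symm

theorem sum_stdAddChar_mul (b : ZMod d) :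
    ∑ x : ZMod d, (ZMod.stdAddChar (x * b) : ℂ) = if b = 0 then (d : ℂ) else 0 := by
  rw [AddChar.sum_mulShift b (ZMod.isPrimitive_stdAddChar d), ZMod.card]
  split_ifs <;> simp

theorem weyl_mul_star (k x k' x' : ZMod d × ZMod d) (j m j' m' : ZMod d) :
    weyl d k x j m * star (weyl d k' x' j' m') =
      if j = m + x.1 + k.1 ∧ j' = m' + x'.1 + k'.1 then
        (ZMod.stdAddChar (x.2 * (m + k.1) + k.2 * m - (x'.2 * (m' + k'.1) + k'.2 * m')) : ℂ)
      else 0 := by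
  by_cases h : j = m + x.1 + k.1 <;> by_cases h' : j' = m' + x'.1 + k'.1
  · simp only [weyl, Matrix.of_apply, if_pos h, if_pos h', star_stdAddChar, if_pos (And.intro h h')]
    rw [← AddChar.map_add_eq_mul, sub_eq_add_neg]
  all_goals simp [weyl, h, h']

theorem weyl_mul_conjTranspose (k x : ZMod d × ZMod d) : weyl d k x * (weyl d k x)ᴴ = 1 := by
  ext j j'
  simp only [Matrix.mul_apply, Matrix.conjTranspose_apply, weyl_mul_star, Matrix.one_apply]
  rw [Finset.sum_eq_single (j - x.1 - k.1)]
  · have h1 : j = j - x.1 - k.1 + x.1 + k.1 := by ring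
    by_cases h : j = j'
    · subst h
      simp only [← h1]
      simp
    · simp only [← h1, true_and, Ne.symm h, h, if_false]
  · intro m _ hm
    refine if_neg fun h => hm ?_
    rw [h.1]
    ring
  · simp

theorem conjTranspose_mul_weyl (k x : ZMod d × ZMod d) : (weyl d k x)ᴴ * weyl d k x = 1 :=
  mul_eq_one_comm.mp (weyl_mul_conjTranspose d k x)

/-- Completeness of the Weyl operators. It makes the Bell measurement an isometry. -/
theorem sum_weyl_mul_star_snd (k : ZMod d × ZMod d) (j m j' m' : ZMod d) :
    ∑ x, weyl d k x j m * star (weyl d k x j' m') = if j = j' ∧ m = m' then (d : ℂ) else 0 := by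
  simp only [weyl_mul_star, Fintype.sum_prod_type]
  have h : ∀ a b : ZMod d, (if j = m + a + k.1 ∧ j' = m' + a + k.1 then
      (ZMod.stdAddChar (b * (m + k.1) + k.2 * m - (b * (m' + k.1) + k.2 * m')) : ℂ) else 0) =
      if j = m + a + k.1 ∧ j' = m' + a + k.1 then
        ZMod.stdAddChar (b * (m - m')) * ZMod.stdAddChar (k.2 * m - k.2 * m') else 0 := by
    intro a b
    rw [← AddChar.map_add_eq_mul]
    congr 2
    ring
  simp only [h]
  rw [Finset.sum_eq_single (j - m - k.1)]
  · have h1 : j = m + (j - m - k.1) + k.1 := by ring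
    by_cases hm : m = m'
    · subst hm
      by_cases hj : j = j'
      · subst hj
        simp only [← h1]
        simp
      · have h2 : ¬ (j' = m + (j - m - k.1) + k.1) := fun h => hj (h1.trans h.symm)
        simp [hj, h2]
    · simp only [← h1, true_and, hm, and_false, if_false]
      split_ifs
      · rw [← Finset.sum_mul, sum_stdAddChar_mul, if_neg (sub_ne_zero.mpr hm), zero_mul]
      · simp
  · intro a _ ha
    refine Finset.sum_eq_zero fun b _ => if_neg fun h => ha ?_
    rw [h.1]
    ring
  · simp

/-- Averaging over the label `k` completely mixes the system on which the Weyl operators with labels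
`x` and `x'` act, and these are orthogonal in trace. -/
theorem sum_weyl_mul_star_fst (x x' : ZMod d × ZMod d) (m m' : ZMod d) :
    ∑ k, ∑ j, weyl d k x j m * star (weyl d k x' j m') =
      if x = x' ∧ m = m' then (d : ℂ) * d else 0 := by
  simp only [weyl_mul_star]
  have h : ∀ k : ZMod d × ZMod d, (∑ j, if j = m + x.1 + k.1 ∧ j = m' + x'.1 + k.1 then
      (ZMod.stdAddChar (x.2 * (m + k.1) + k.2 * m - (x'.2 * (m' + k.1) + k.2 * m')) : ℂ) else 0) =
      if m + x.1 = m' + x'.1 then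
        ZMod.stdAddChar (k.1 * (x.2 - x'.2)) * (ZMod.stdAddChar (k.2 * (m - m')) *
          ZMod.stdAddChar (x.2 * m - x'.2 * m')) else 0 := by
    intro k
    rw [Finset.sum_eq_single (m + x.1 + k.1)]
    · simp only [true_and, add_left_inj, ← AddChar.map_add_eq_mul]
      congr 2
      ring
    · intro j _ hj
      exact if_neg fun h => hj h.1
    · simp
  simp only [h, Fintype.sum_prod_type]
  by_cases h1 : m + x.1 = m' + x'.1
  · simp only [if_pos h1, ← Finset.mul_sum, ← Finset.sum_mul, sum_stdAddChar_mul, sub_eq_zero]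
    by_cases hm : m = m'
    · subst hm
      have h2 : x.1 = x'.1 := add_left_cancel h1
      by_cases h3 : x.2 = x'.2
      · simp [Prod.ext h2 h3]
      · have h4 : x ≠ x' := fun h => h3 (congrArg Prod.snd h)
        simp [h3, h4]
    · simp [hm]
  · have h2 : ¬ (x = x' ∧ m = m') := fun h => h1 (by rw [h.1, h.2])
    simp [h1, h2]

/-- The isometric extension of the measurement in the basis of maximally entangled states, after
a Weyl operator with label `k`. -/
noncomputable def bell (k : ZMod d × ZMod d) :
    Matrix (ZMod d × ZMod d) (ZMod d × ZMod d) ℂ :=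
  Matrix.of fun x p => ((√d : ℝ) : ℂ)⁻¹ * weyl d k x p.1 p.2

theorem bell_isometry (k : ZMod d × ZMod d) : (bell d k)ᴴ * bell d k = 1 := by
  have hd : (d : ℂ) ≠ 0 := by exact_mod_cast NeZero.ne d
  ext p q
  simp only [Matrix.mul_apply, Matrix.conjTranspose_apply, bell, Matrix.of_apply, star_mul,
    star_inv₀, Complex.star_def, Complex.conj_ofReal]
  have h : ∀ x, (starRingEnd ℂ) (weyl d k x p.1 p.2) * ((√d : ℝ) : ℂ)⁻¹ *
      (((√d : ℝ) : ℂ)⁻¹ * weyl d k x q.1 q.2) =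
      (d : ℂ)⁻¹ * (weyl d k x q.1 q.2 * star (weyl d k x p.1 p.2)) := by
    intro x
    rw [← inv_sqrt_mul_inv_sqrt, Complex.star_def]
    ring
  simp only [h, ← Finset.mul_sum, sum_weyl_mul_star_snd, Matrix.one_apply, Prod.ext_iff]
  by_cases h1 : q.1 = p.1 <;> by_cases h2 : q.2 = p.2 <;>
    simp [h1, h2, Ne.symm, hd, eq_comm]

/-- Alice's operation in the teleportation. -/
noncomputable def bellChannel :
    Channel ((ZMod d × ZMod d) × (ZMod d × ZMod d)) ((ZMod d × ZMod d) × (ZMod d × ZMod d)) :=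
  Channel.controlled (bell d) (bell_isometry d)

/-- Bob's operation in the teleportation. -/
noncomputable def weylCorrection :
    Channel (((ZMod d × ZMod d) × (ZMod d × ZMod d)) × ZMod d)
      (((ZMod d × ZMod d) × (ZMod d × ZMod d)) × ZMod d) :=
  Channel.controlled (fun c => (weyl d c.1 c.2)ᴴ) fun c => by
    rw [Matrix.conjTranspose_conjTranspose, weyl_mul_conjTranspose]

/-- The state after Alice's operation. -/
theorem bellChannel_apply (Y : Matrix (ZMod d) (ZMod d) ℂ)
    (k x k' x' kb kb' : ZMod d × ZMod d) (j j' : ZMod d) :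
    bellChannel d (Matrix.of fun w w' => maxEntCoeff (ZMod d × ZMod d) (w.1, kb) (w'.1, kb') *
      (maxEntCoeff (ZMod d) (w.2.1, j) (w'.2.1, j') * Y w.2.2 w'.2.2)) (k, x) (k', x') =
    maxEntCoeff (ZMod d × ZMod d) (k, kb) (k', kb') * (((d : ℂ) * d)⁻¹ *
      (weyl d k x * Y * (weyl d k' x')ᴴ) j j') := by
  refine (Channel.controlled_apply _ _ _ _ _ _ _).trans ?_
  simp only [Matrix.mul_apply, Matrix.conjTranspose_apply, Matrix.of_apply, bell,
    Fintype.sum_prod_type, Finset.sum_mul, Finset.mul_sum]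
  rw [Finset.sum_eq_single j']
  · refine Finset.sum_congr rfl fun m' _ => ?_
    rw [Finset.sum_eq_single j]
    · refine Finset.sum_congr rfl fun m _ => ?_
      have h : maxEntCoeff (ZMod d) (j, j) (j', j') = (d : ℂ)⁻¹ := by simp [maxEntCoeff]
      rw [h, star_mul, star_inv₀, Complex.star_def, Complex.conj_ofReal, mul_inv]
      nth_rewrite 3 [← inv_sqrt_mul_inv_sqrt]
      ring
    · intro i _ hi
      have h : maxEntCoeff (ZMod d) (i, j) (j', j') = 0 := by simp [maxEntCoeff, hi]
      simp [h]
    · simp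
  · intro i _ hi
    have h : ∀ l, maxEntCoeff (ZMod d) (l, j) (i, j') = 0 := fun l => by simp [maxEntCoeff, hi]
    simp [h]
  · simp

/-- Coherent teleportation. -/
theorem weylCorrection_bellChannel (Y : Matrix (ZMod d) (ZMod d) ℂ)
    (k x k' x' kb kb' xb xb' : ZMod d × ZMod d) (m m' : ZMod d) :
    weylCorrection d (Matrix.of fun u u' => if u.1.2 = x ∧ u'.1.2 = x' then
      bellChannel d (Matrix.of fun w w' =>
        maxEntCoeff (ZMod d × ZMod d) (w.1, u.1.1) (w'.1, u'.1.1) *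
          (maxEntCoeff (ZMod d) (w.2.1, u.2) (w'.2.1, u'.2) * Y w.2.2 w'.2.2)) (k, x) (k', x')
      else 0) ((kb, xb), m) ((kb', xb'), m') =
    maxEntCoeff (ZMod d × ZMod d) (k, kb) (k', kb') *
      (maxEntCoeff (ZMod d × ZMod d) (x, xb) (x', xb') * Y m m') := by
  simp only [bellChannel_apply]
  refine (Channel.controlled_apply _ _ _ _ _ _ _).trans ?_
  simp only [Matrix.of_apply, Matrix.conjTranspose_conjTranspose]
  -- When Bob's labels agree with Alice's, his correction cancels the Weyl operators on both sides.
  -- The remaining factor `1 / d ^ 2` does not depend on the outcomes: it is the coefficient of a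
  -- maximally entangled state of the two copies.
  by_cases hx : xb = x ∧ xb' = x'
  · obtain ⟨rfl, rfl⟩ := hx
    by_cases hk : k = kb ∧ k' = kb'
    · obtain ⟨rfl, rfl⟩ := hk
      simp only [and_self, if_true]
      have h : (Matrix.of fun j j' => maxEntCoeff (ZMod d × ZMod d) (k, k) (k', k') *
          (((d : ℂ) * d)⁻¹ * (weyl d k xb * Y * (weyl d k' xb')ᴴ) j j')) =
          (maxEntCoeff (ZMod d × ZMod d) (k, k) (k', k') * ((d : ℂ) * d)⁻¹) •
            (weyl d k xb * Y * (weyl d k' xb')ᴴ) := by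
        ext j j'
        simp [mul_assoc]
      have h2 : (weyl d k xb)ᴴ * (weyl d k xb * Y * (weyl d k' xb')ᴴ) * weyl d k' xb' = Y := by
        rw [Matrix.mul_assoc (weyl d k xb), ← Matrix.mul_assoc, conjTranspose_mul_weyl,
          Matrix.one_mul, Matrix.mul_assoc, conjTranspose_mul_weyl, Matrix.mul_one]
      rw [h, Matrix.mul_smul, Matrix.smul_mul, h2, Matrix.smul_apply, smul_eq_mul]
      have h3 : maxEntCoeff (ZMod d × ZMod d) (xb, xb) (xb', xb') = ((d : ℂ) * d)⁻¹ := by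
        simp [maxEntCoeff]
      rw [h3, mul_assoc]
    · have h : maxEntCoeff (ZMod d × ZMod d) (k, kb) (k', kb') = 0 := if_neg hk
      have h2 : (Matrix.of fun j j' : ZMod d => if xb = xb ∧ xb' = xb' then
          maxEntCoeff (ZMod d × ZMod d) (k, kb) (k', kb') *
          (((d : ℂ) * d)⁻¹ * (weyl d k xb * Y * (weyl d k' xb')ᴴ) j j') else 0) = 0 := by
        ext j j'
        simp [h]
      rw [h2, h]
      simp
  · have h : maxEntCoeff (ZMod d × ZMod d) (x, xb) (x', xb') = 0 :=
      if_neg fun h => hx ⟨h.1.symm, h.2.symm⟩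
    have h2 : (Matrix.of fun j j' : ZMod d => if xb = x ∧ xb' = x' then
        maxEntCoeff (ZMod d × ZMod d) (k, kb) (k', kb') *
        (((d : ℂ) * d)⁻¹ * (weyl d k x * Y * (weyl d k' x')ᴴ) j j') else 0) = 0 := by
      ext j j'
      simp [hx]
    rw [h2, h]
    simp

/-- Alice's measurement outcome is uniformly distributed, and it carries no coherence. -/
theorem sum_bellChannel (Y : Matrix (ZMod d) (ZMod d) ℂ) (x x' : ZMod d × ZMod d) :
    ∑ k, ∑ j, ∑ kb, bellChannel d (Matrix.of fun w w' =>
        maxEntCoeff (ZMod d × ZMod d) (w.1, kb) (w'.1, kb) *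
          (maxEntCoeff (ZMod d) (w.2.1, j) (w'.2.1, j) * Y w.2.2 w'.2.2)) (k, x) (k, x') =
      if x = x' then ((d : ℂ) * d)⁻¹ * ∑ m, Y m m else 0 := by
  have hd : (d : ℂ) ≠ 0 := by exact_mod_cast NeZero.ne d
  simp only [bellChannel_apply]
  have h : ∀ k : ZMod d × ZMod d, ∀ z : ℂ,
      ∑ kb, maxEntCoeff (ZMod d × ZMod d) (k, kb) (k, kb) * z = ((d : ℂ) * d)⁻¹ * z := by
    intro k z
    rw [Finset.sum_eq_single k]
    · simp [maxEntCoeff]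
    · intro l _ hl
      simp [maxEntCoeff, hl.symm]
    · simp
  simp only [h, ← Finset.mul_sum]
  -- The entries of `Y` are pulled out, so that the orthogonality relation for the sum over `k`
  -- applies.
  have h1 : ∑ k, ∑ j, (weyl d k x * Y * (weyl d k x')ᴴ) j j =
      ∑ m, ∑ m', Y m m' * ∑ k, ∑ j, weyl d k x j m * star (weyl d k x' j m') := by
    simp only [Matrix.mul_apply, Matrix.conjTranspose_apply, Finset.sum_mul, Finset.mul_sum]
    have h2 : ∀ k j : _, ∑ m', ∑ m, weyl d k x j m * Y m m' * star (weyl d k x' j m') =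
        ∑ m, ∑ m', Y m m' * (weyl d k x j m * star (weyl d k x' j m')) := by
      intro k j
      rw [Finset.sum_comm]
      refine Finset.sum_congr rfl fun m _ => Finset.sum_congr rfl fun m' _ => by ring
    simp only [h2]
    calc ∑ k, ∑ j, ∑ m, ∑ m', Y m m' * (weyl d k x j m * star (weyl d k x' j m'))
        = ∑ p : (ZMod d × ZMod d) × ZMod d, ∑ q : ZMod d × ZMod d,
            Y q.1 q.2 * (weyl d p.1 x p.2 q.1 * star (weyl d p.1 x' p.2 q.2)) := by
          simp only [Fintype.sum_prod_type]
      _ = ∑ q : ZMod d × ZMod d, ∑ p : (ZMod d × ZMod d) × ZMod d,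
            Y q.1 q.2 * (weyl d p.1 x p.2 q.1 * star (weyl d p.1 x' p.2 q.2)) := Finset.sum_comm
      _ = _ := by simp only [Fintype.sum_prod_type]
  rw [h1]
  simp only [sum_weyl_mul_star_fst]
  by_cases hx : x = x'
  · simp only [hx, true_and, mul_ite, mul_zero, Finset.sum_ite_eq, Finset.mem_univ, if_true,
      ← Finset.sum_mul]
    rw [mul_comm _ ((d : ℂ) * d), inv_mul_cancel_left₀ (mul_ne_zero hd hd)]
  · simp [hx]

end weyl

/-! ### Coherent teleportation with a catalyst -/

section teleport

variable (t b : Resource) (d : ℕ) [NeZero d]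

/-- A resource together with the entanglement used in the teleportation of `ZMod d`; the part of
dimension `d ^ 2` is used catalytically. -/
noncomputable def teleIn : Resource :=
  t.tensor ((ebitOf (.of (ZMod d))).tensor (ebitOf (.of (ZMod d × ZMod d))))

/-- The resource created in the coherent teleportation of `ZMod d`. -/
noncomputable def teleOut : Resource :=
  (t.tensor b).tensor ((qubitOf (.of (ZMod d))).tensor
    ((ebitOf (.of (ZMod d × ZMod d))).tensor (ebitOf (.of (ZMod d × ZMod d)))))

/-- Alice's memory during the use of the first resource. -/
def TeleMem : Sys := .of ((b.Arel × b.Aabs) × ZMod d)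

/-- Alice's memory during the use of the second resource. -/
def TeleMem' : Sys := .of (t.A × (ZMod d × ZMod d))

/-- Alice's initial encoding. -/
def teleEnc : (teleOut t b d).Arel × (teleOut t b d).Aabs ≃
    ((teleIn t d).Arel × (teleIn t d).Aabs) × TeleMem b d where
  toFun (p : ((t.Arel × b.Arel) × (Unit × (Unit × Unit))) ×
      ((t.Aabs × b.Aabs) × (ZMod d × (Unit × Unit)))) :=
    (((p.1.1.1, ((), ())), (p.2.1.1, ((), ()))), ((p.1.1.2, p.2.1.2), p.2.2.1))
  invFun (q : ((t.Arel × (Unit × Unit)) × (t.Aabs × (Unit × Unit))) ×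
      ((b.Arel × b.Aabs) × ZMod d)) :=
    (((q.1.1.1, q.2.1.1), ((), ((), ()))), ((q.1.2.1, q.2.1.2), (q.2.2, ((), ()))))
  left_inv _ := rfl
  right_inv _ := rfl

/-- The identification of the source systems. -/
def teleSrc : (teleOut t b d).S ≃
    (teleIn t d).S × (b.tensor (cohRes (.of (ZMod d × ZMod d)))).S where
  toFun (p : (t.S × b.S) × (Unit × (Unit × Unit))) := ((p.1.1, ((), ())), (p.1.2, ()))
  invFun (q : (t.S × (Unit × Unit)) × (b.S × Unit)) := ((q.1.1, q.2.1), ((), ((), ())))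
  left_inv _ := rfl
  right_inv _ := rfl

/-- Regrouping before Alice's operation. -/
def telePre : (teleIn t d).A × TeleMem b d ≃
    ((ZMod d × ZMod d) × (ZMod d × ZMod d)) × (t.A × (b.Arel × b.Aabs)) where
  toFun (p : (t.A × (ZMod d × (ZMod d × ZMod d))) × ((b.Arel × b.Aabs) × ZMod d)) :=
    ((p.1.2.2, (p.1.2.1, p.2.2)), (p.1.1, p.2.1))
  invFun q := ((q.2.1, (q.1.2.1, q.1.1)), (q.2.2, q.1.2.2))
  left_inv _ := rfl
  right_inv _ := rfl

/-- Regrouping after Alice's operation. -/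
def telePost : ((ZMod d × ZMod d) × (ZMod d × ZMod d)) × (t.A × (b.Arel × b.Aabs)) ≃
    ((b.tensor (cohRes (.of (ZMod d × ZMod d)))).Arel ×
      (b.tensor (cohRes (.of (ZMod d × ZMod d)))).Aabs) × TeleMem' t d where
  toFun q := (((q.2.2.1, q.1.2), (q.2.2.2, ())), (q.2.1, q.1.1))
  invFun (p : ((b.Arel × (ZMod d × ZMod d)) × (b.Aabs × Unit)) × (t.A × (ZMod d × ZMod d))) :=
    ((p.2.2, p.1.1.2), (p.2.1, (p.1.1.1, p.1.2.1)))
  left_inv _ := rfl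
  right_inv _ := rfl

/-- Alice's operation between the two uses. -/
noncomputable def teleMid : Channel ((teleIn t d).A × TeleMem b d)
    (((b.tensor (cohRes (.of (ZMod d × ZMod d)))).Arel ×
      (b.tensor (cohRes (.of (ZMod d × ZMod d)))).Aabs) × TeleMem' t d) :=
  (Channel.relabel (telePost t b d)).comp <|
    ((bellChannel d).amp (t.A × (b.Arel × b.Aabs))).comp (Channel.relabel (telePre t b d))

/-- Alice's final regrouping. -/
def teleFin : (b.tensor (cohRes (.of (ZMod d × ZMod d)))).A × TeleMem' t d ≃
    (teleOut t b d).A where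
  toFun (p : (b.A × (ZMod d × ZMod d)) × (t.A × (ZMod d × ZMod d))) :=
    (((p.2.1, p.1.1), ((), (p.2.2, p.1.2))) :
      (t.A × b.A) × (Unit × ((ZMod d × ZMod d) × (ZMod d × ZMod d))))
  invFun (q : (t.A × b.A) × (Unit × ((ZMod d × ZMod d) × (ZMod d × ZMod d)))) :=
    ((q.1.2, q.2.2.2), (q.1.1, q.2.2.1))
  left_inv _ := rfl
  right_inv _ := rfl

/-- Regrouping before Bob's operation. -/
def teleBobPre : (teleIn t d).B × (b.tensor (cohRes (.of (ZMod d × ZMod d)))).B ≃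
    (((ZMod d × ZMod d) × (ZMod d × ZMod d)) × ZMod d) × (t.B × b.B) where
  toFun (p : (t.B × (ZMod d × (ZMod d × ZMod d))) × (b.B × (ZMod d × ZMod d))) :=
    (((p.1.2.2, p.2.2), p.1.2.1), (p.1.1, p.2.1))
  invFun q := ((q.2.1, (q.1.2, q.1.1.1)), (q.2.2, q.1.1.2))
  left_inv _ := rfl
  right_inv _ := rfl

/-- Regrouping after Bob's operation. -/
def teleBobPost : (((ZMod d × ZMod d) × (ZMod d × ZMod d)) × ZMod d) × (t.B × b.B) ≃
    (teleOut t b d).B where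
  toFun q := ((q.2, (q.1.2, q.1.1)) :
    (t.B × b.B) × (ZMod d × ((ZMod d × ZMod d) × (ZMod d × ZMod d))))
  invFun (p : (t.B × b.B) × (ZMod d × ((ZMod d × ZMod d) × (ZMod d × ZMod d)))) :=
    ((p.2.2, p.2.1), p.1)
  left_inv _ := rfl
  right_inv _ := rfl

/-- Bob's decoding. -/
noncomputable def teleDec : Channel
    ((teleIn t d).B × (b.tensor (cohRes (.of (ZMod d × ZMod d)))).B) (teleOut t b d).B :=
  (Channel.relabel (teleBobPost t b d)).comp <|
    ((weylCorrection d).amp (t.B × b.B)).comp (Channel.relabel (teleBobPre t b d))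

/-- The basis labels of the input of the created resource. -/
def teleLabel (o : (t.Arel × t.Aabs) × t.S) (i : (b.Arel × b.Aabs) × b.S) (m : ZMod d) :
    ((teleOut t b d).Arel × (teleOut t b d).Aabs) × (teleOut t b d).S :=
  ((((o.1.1, i.1.1), ((), ((), ()))), ((o.1.2, i.1.2), (m, ((), ())))),
    ((o.2, i.2), ((), ((), ()))))

variable {t b d}

theorem teleOut_apply (ξ : Matrix (((teleOut t b d).Arel × (teleOut t b d).Aabs) ×
      (teleOut t b d).S) (((teleOut t b d).Arel × (teleOut t b d).Aabs) × (teleOut t b d).S) ℂ)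
    (p q : (teleOut t b d).A × (teleOut t b d).B) :
    (teleOut t b d).N ξ p q =
      maxEntCoeff (ZMod d × ZMod d) (p.1.2.2.2, p.2.2.2.2) (q.1.2.2.2, q.2.2.2.2) *
      (maxEntCoeff (ZMod d × ZMod d) (p.1.2.2.1, p.2.2.2.1) (q.1.2.2.1, q.2.2.2.1) *
      b.N (Matrix.of fun i i' => t.N (Matrix.of fun o o' =>
        ξ (teleLabel t b d o i p.2.2.1) (teleLabel t b d o' i' q.2.2.1))
          (p.1.1.1, p.2.1.1) (q.1.1.1, q.2.1.1)) (p.1.1.2, p.2.1.2) (q.1.1.2, q.2.1.2)) :=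
  (ebitOf_apply (.of (ZMod d × ZMod d)) _ _ _).trans
    (congrArg (maxEntCoeff (ZMod d × ZMod d) (p.1.2.2.2, p.2.2.2.2) (q.1.2.2.2, q.2.2.2.2) * ·)
      (ebitOf_apply (.of (ZMod d × ZMod d)) _ _ _))

theorem teleIn_apply (ξ : Matrix (((teleIn t d).Arel × (teleIn t d).Aabs) ×
      (teleIn t d).S) (((teleIn t d).Arel × (teleIn t d).Aabs) × (teleIn t d).S) ℂ)
    (p q : (teleIn t d).A × (teleIn t d).B) :
    (teleIn t d).N ξ p q =
      maxEntCoeff (ZMod d × ZMod d) (p.1.2.2, p.2.2.2) (q.1.2.2, q.2.2.2) *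
      (maxEntCoeff (ZMod d) (p.1.2.1, p.2.2.1) (q.1.2.1, q.2.2.1) *
      t.N (Matrix.of fun o o' => ξ (((o.1.1, ((), ())), (o.1.2, ((), ()))), (o.2, ((), ())))
        (((o'.1.1, ((), ())), (o'.1.2, ((), ()))), (o'.2, ((), ()))))
          (p.1.1, p.2.1) (q.1.1, q.2.1)) :=
  (ebitOf_apply (.of (ZMod d × ZMod d)) _ _ _).trans
    (congrArg (maxEntCoeff (ZMod d × ZMod d) (p.1.2.2, p.2.2.2) (q.1.2.2, q.2.2.2) * ·)
      (ebitOf_apply (.of (ZMod d)) _ _ _))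

/-- The state before the use of the second resource. -/
theorem stageTwo_tele (ξ : Matrix (((teleOut t b d).Arel × (teleOut t b d).Aabs) ×
      (teleOut t b d).S) (((teleOut t b d).Arel × (teleOut t b d).Aabs) × (teleOut t b d).S) ℂ)
    (i i' : (b.Arel × b.Aabs) × b.S) (x x' k k' kb kb' : ZMod d × ZMod d) (j j' : ZMod d)
    (a a' : t.A) (c c' : t.B) :
    stageTwo (t₂ := b.tensor (cohRes (.of (ZMod d × ZMod d)))) (teleMid t b d) (teleIn t d).N
      (stageOne (t₁ := teleIn t d) (t₂ := b.tensor (cohRes (.of (ZMod d × ZMod d))))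
        (Channel.relabel (teleEnc t b d)) (teleSrc t b d) ξ)
      ((((i.1.1, x), (i.1.2, ())), (i.2, ())), ((a, k), (c, (j, kb))))
      ((((i'.1.1, x'), (i'.1.2, ())), (i'.2, ())), ((a', k'), (c', (j', kb')))) =
    bellChannel d (Matrix.of fun w w' => maxEntCoeff (ZMod d × ZMod d) (w.1, kb) (w'.1, kb') *
      (maxEntCoeff (ZMod d) (w.2.1, j) (w'.2.1, j') *
        (Matrix.of fun m m' : ZMod d => t.N (Matrix.of fun o o' => ξ (teleLabel t b d o i m)
          (teleLabel t b d o' i' m')) (a, c) (a', c')) w.2.2 w'.2.2)) (k, x) (k', x') := by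
  refine Eq.trans (b := bellChannel d (Matrix.of fun w w' => (teleIn t d).N
    (Matrix.of fun o o' => stageOne (t₁ := teleIn t d)
      (t₂ := b.tensor (cohRes (.of (ZMod d × ZMod d))))
      (Channel.relabel (teleEnc t b d)) (teleSrc t b d) ξ (o, ((i.1, w.2.2), (i.2, ())))
        (o', ((i'.1, w'.2.2), (i'.2, ())))) ((a, (w.2.1, w.1)), (c, (j, kb)))
          ((a', (w'.2.1, w'.1)), (c', (j', kb')))) (k, x) (k', x')) rfl ?_
  refine congrFun (congrFun (congrArg (bellChannel d).toFun ?_) _) _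
  ext w w'
  exact teleIn_apply _ _ _

/-- Bob's correction commutes with the use of `b`. Moved in front of it, the correction meets
Alice's operation, and the identity `weylCorrection_bellChannel` applies in each block of the input
of `b`. -/
theorem teleOut_eq : (teleOut t b d).N =
    (stageThree (s := teleOut t b d) (t₁ := teleIn t d)
      (t₂ := b.tensor (cohRes (.of (ZMod d × ZMod d)))) (Channel.relabel (teleFin t b d))
      (teleDec t b d) (b.tensor (cohRes (.of (ZMod d × ZMod d)))).N).comp
    ((stageTwo (t₂ := b.tensor (cohRes (.of (ZMod d × ZMod d)))) (teleMid t b d)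
      (teleIn t d).N).comp
      (stageOne (t₁ := teleIn t d) (t₂ := b.tensor (cohRes (.of (ZMod d × ZMod d))))
        (Channel.relabel (teleEnc t b d)) (teleSrc t b d))) := by
  apply Channel.ext_toFun
  intro ξ
  suffices H : ∀ (a₁ a₁' : t.A) (a₂ a₂' : b.A) (c₁ c₁' : t.B) (c₂ c₂' : b.B)
      (k k' x x' kb kb' xb xb' : ZMod d × ZMod d) (m m' : ZMod d),
      (teleOut t b d).N ξ (((a₁, a₂), ((), (k, x))), ((c₁, c₂), (m, (kb, xb))))
        (((a₁', a₂'), ((), (k', x'))), ((c₁', c₂'), (m', (kb', xb')))) =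
      stageThree (s := teleOut t b d) (t₁ := teleIn t d)
        (t₂ := b.tensor (cohRes (.of (ZMod d × ZMod d)))) (Channel.relabel (teleFin t b d))
        (teleDec t b d) (b.tensor (cohRes (.of (ZMod d × ZMod d)))).N
      (stageTwo (t₂ := b.tensor (cohRes (.of (ZMod d × ZMod d)))) (teleMid t b d) (teleIn t d).N
      (stageOne (t₁ := teleIn t d) (t₂ := b.tensor (cohRes (.of (ZMod d × ZMod d))))
        (Channel.relabel (teleEnc t b d)) (teleSrc t b d) ξ))
        (((a₁, a₂), ((), (k, x))), ((c₁, c₂), (m, (kb, xb))))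
        (((a₁', a₂'), ((), (k', x'))), ((c₁', c₂'), (m', (kb', xb')))) by
    ext p q
    exact H _ _ _ _ _ _ _ _ _ _ _ _ _ _ _ _ _ _
  intro a₁ a₁' a₂ a₂' c₁ c₁' c₂ c₂' k k' x x' kb kb' xb xb' m m'
  let Z := stageTwo (t₂ := b.tensor (cohRes (.of (ZMod d × ZMod d)))) (teleMid t b d)
    (teleIn t d).N (stageOne (t₁ := teleIn t d) (t₂ := b.tensor (cohRes (.of (ZMod d × ZMod d))))
        (Channel.relabel (teleEnc t b d)) (teleSrc t b d) ξ)
  let Y : (b.Arel × b.Aabs) × b.S → (b.Arel × b.Aabs) × b.S → Matrix (ZMod d) (ZMod d) ℂ :=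
    fun i i' => Matrix.of fun m m' : ZMod d => t.N (Matrix.of fun o o' =>
      ξ (teleLabel t b d o i m) (teleLabel t b d o' i' m')) (a₁, c₁) (a₁', c₁')
  let F : (b.Arel × b.Aabs) × b.S → (b.Arel × b.Aabs) × b.S →
      ((ZMod d × ZMod d) × (ZMod d × ZMod d)) × ZMod d →
      ((ZMod d × ZMod d) × (ZMod d × ZMod d)) × ZMod d → ℂ := fun i i' u u' =>
    if u.1.2 = x ∧ u'.1.2 = x' then
      bellChannel d (Matrix.of fun w w' =>
        maxEntCoeff (ZMod d × ZMod d) (w.1, u.1.1) (w'.1, u'.1.1) *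
          (maxEntCoeff (ZMod d) (w.2.1, u.2) (w'.2.1, u'.2) * Y i i' w.2.2 w'.2.2)) (k, x) (k', x')
      else 0
  refine (teleOut_apply _ _ _).trans (Eq.symm ?_)
  refine Eq.trans (b := weylCorrection d (Matrix.of fun u u' =>
    (b.tensor (cohRes (.of (ZMod d × ZMod d)))).N (Matrix.of fun i i' =>
      Z (i, ((a₁, k), (c₁, (u.2, u.1.1)))) (i', ((a₁', k'), (c₁', (u'.2, u'.1.1)))))
        ((a₂, x), (c₂, u.1.2)) ((a₂', x'), (c₂', u'.1.2))) ((kb, xb), m) ((kb', xb'), m')) rfl ?_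
  have h1 : ∀ u u', (b.tensor (cohRes (.of (ZMod d × ZMod d)))).N (Matrix.of fun i i' =>
      Z (i, ((a₁, k), (c₁, (u.2, u.1.1)))) (i', ((a₁', k'), (c₁', (u'.2, u'.1.1)))))
        ((a₂, x), (c₂, u.1.2)) ((a₂', x'), (c₂', u'.1.2)) =
      b.N (Matrix.of fun i i' => F i i' u u') (a₂, c₂) (a₂', c₂') := by
    intro u u'
    refine (tensor_cohRes_apply b (.of (ZMod d × ZMod d)) _ _ _).trans ?_
    by_cases hu : u.1.2 = x ∧ u'.1.2 = x'
    · refine (if_pos hu).trans (congrFun (congrFun (congrArg b.N.toFun ?_) _) _)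
      ext i i'
      exact (stageTwo_tele ξ i i' x x' k k' u.1.1 u'.1.1 u.2 u'.2 a₁ a₁' c₁ c₁').trans
        (if_pos hu).symm
    · refine (if_neg hu).trans ?_
      have h2 : (Matrix.of fun i i' => F i i' u u') = 0 := by
        ext i i'
        exact if_neg hu
      rw [h2, Channel.map_zero]
      rfl
  have h2 : weylCorrection d (Matrix.of fun u u' =>
      b.N (Matrix.of fun i i' => F i i' u u') (a₂, c₂) (a₂', c₂'))
        ((kb, xb), m) ((kb', xb'), m') =
      b.N (Matrix.of fun i i' => weylCorrection d (Matrix.of fun u u' => F i i' u u')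
        ((kb, xb), m) ((kb', xb'), m')) (a₂, c₂) (a₂', c₂') :=
    Channel.comm_apply b.N (weylCorrection d) F _ _ _ _
  have h3 : (Matrix.of fun i i' => weylCorrection d (Matrix.of fun u u' => F i i' u u')
        ((kb, xb), m) ((kb', xb'), m')) = (maxEntCoeff (ZMod d × ZMod d) (x, xb) (x', xb') *
          maxEntCoeff (ZMod d × ZMod d) (k, kb) (k', kb')) • (Matrix.of fun i i' => Y i i' m m') := by
    ext i i'
    refine (weylCorrection_bellChannel d (Y i i') k x k' x' kb kb' xb xb' m m').trans ?_
    exact (mul_left_comm _ _ _).trans (mul_assoc _ _ _).symm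
  refine (congrArg (fun G => weylCorrection d (Matrix.of G) ((kb, xb), m) ((kb', xb'), m'))
    (funext fun u => funext fun u' => h1 u u')).trans (h2.trans ?_)
  rw [h3, Channel.map_smul]
  exact mul_assoc _ _ _

/-- The test and source states of `b` are in product with those of `t`, so tracing out the input of
`b` gives a factor one. -/
theorem testMarginal_stageOne_tele (ξ : Matrix (((teleOut t b d).Arel × (teleOut t b d).Aabs) ×
      (teleOut t b d).S) (((teleOut t b d).Arel × (teleOut t b d).Aabs) × (teleOut t b d).S) ℂ)
    (h : testMarginal ξ = (teleOut t b d).ω ⊗ₖ (teleOut t b d).ρ) :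
    testMarginal (trRight (stageOne (t₁ := teleIn t d)
      (t₂ := b.tensor (cohRes (.of (ZMod d × ZMod d))))
      (Channel.relabel (teleEnc t b d)) (teleSrc t b d) ξ)) =
      (teleIn t d).ω ⊗ₖ (teleIn t d).ρ := by
  ext ⟨⟨r, u⟩, ⟨σ, u₁⟩⟩ ⟨⟨r', u'⟩, ⟨σ', u₁'⟩⟩
  have h1 : ∀ (a : b.Arel) (τ : b.S), ∑ (y : t.Aabs), ∑ (z : b.Aabs), ∑ (m : ZMod d),
      ξ (teleLabel t b d ((r, y), σ) ((a, z), τ) m) (teleLabel t b d ((r', y), σ') ((a, z), τ) m) =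
      t.ω r r' * t.ρ σ σ' * (b.ω a a * b.ρ τ τ) := by
    intro a τ
    have h2 := congrFun (congrFun h (((r, a), ((), ((), ()))), ((σ, τ), ((), ((), ())))))
      (((r', a), ((), ((), ()))), ((σ', τ), ((), ((), ()))))
    refine Eq.trans ?_ (h2.trans ?_)
    · refine Eq.trans ?_ (Fintype.sum_prod_type (α₁ := t.Aabs × b.Aabs)
        (α₂ := ZMod d × (Unit × Unit)) _).symm
      refine Eq.trans ?_ (Fintype.sum_prod_type _).symm
      refine Finset.sum_congr rfl fun y _ => Finset.sum_congr rfl fun z _ => ?_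
      refine Eq.trans ?_ (Fintype.sum_prod_type _).symm
      refine Finset.sum_congr rfl fun m _ => ?_
      refine Eq.symm ?_
      exact Fintype.sum_subsingleton (ι := Unit × Unit) _ ((), ())
    · change ((t.ω r r' * b.ω a a) * ((1 : Matrix Unit Unit ℂ) () () *
        ((1 : Matrix Unit Unit ℂ) () () * (1 : Matrix Unit Unit ℂ) () ()))) *
        ((t.ρ σ σ' * b.ρ τ τ) * ((1 : Matrix Unit Unit ℂ) () () *
        ((1 : Matrix Unit Unit ℂ) () () * (1 : Matrix Unit Unit ℂ) () ()))) = _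
      rw [Matrix.one_apply_eq]
      ring
  have h3 : testMarginal (trRight (stageOne (t₁ := teleIn t d)
      (t₂ := b.tensor (cohRes (.of (ZMod d × ZMod d))))
      (Channel.relabel (teleEnc t b d)) (teleSrc t b d) ξ)) ((r, u), (σ, u₁)) ((r', u'), (σ', u₁')) =
      ∑ a : b.Arel, ∑ τ : b.S, ∑ (y : t.Aabs), ∑ (z : b.Aabs), ∑ (m : ZMod d),
      ξ (teleLabel t b d ((r, y), σ) ((a, z), τ) m)
        (teleLabel t b d ((r', y), σ') ((a, z), τ) m) := by
    calc _ = ∑ y : t.Aabs, ∑ a : b.Arel, ∑ z : b.Aabs, ∑ m : ZMod d, ∑ τ : b.S,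
          ξ (teleLabel t b d ((r, y), σ) ((a, z), τ) m)
            (teleLabel t b d ((r', y), σ') ((a, z), τ) m) := by
          refine (Fintype.sum_prod_type (α₁ := t.Aabs) (α₂ := Unit × Unit) _).trans ?_
          refine Finset.sum_congr rfl fun y _ => ?_
          refine (Fintype.sum_subsingleton (ι := Unit × Unit) _ ((), ())).trans ?_
          refine (Fintype.sum_prod_type (α₁ := (b.Arel × b.Aabs) × ZMod d)
            (α₂ := b.S × Unit) _).trans ?_
          refine (Fintype.sum_prod_type _).trans ?_
          refine (Fintype.sum_prod_type _).trans ?_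
          refine Finset.sum_congr rfl fun a _ => Finset.sum_congr rfl fun z _ =>
            Finset.sum_congr rfl fun m _ => ?_
          refine (Fintype.sum_prod_type _).trans ?_
          exact Finset.sum_congr rfl fun τ _ => Fintype.sum_unique (ι := Unit) _
      _ = _ := by
          rw [Finset.sum_comm]
          refine Finset.sum_congr rfl fun a _ => ?_
          exact (Finset.sum_congr rfl fun y _ => (Finset.sum_congr rfl fun z _ =>
            Finset.sum_comm).trans Finset.sum_comm).trans Finset.sum_comm
  refine h3.trans ?_
  simp only [h1, ← Finset.mul_sum]
  have h4 : ∑ a, b.ω a a = 1 := b.isState_ω.trace_eq_one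
  have h5 : ∑ τ, b.ρ τ τ = 1 := b.isState_ρ.trace_eq_one
  rw [h5]
  simp only [mul_one]
  rw [h4, mul_one]
  change _ = (t.ω r r' * ((1 : Matrix Unit Unit ℂ) () () * (1 : Matrix Unit Unit ℂ) () ())) *
    (t.ρ σ σ' * ((1 : Matrix Unit Unit ℂ) () () * (1 : Matrix Unit Unit ℂ) () ()))
  rw [Matrix.one_apply_eq]
  ring

/-- This is what the catalyst is for: by `sum_bellChannel` the outcome register is maximally mixed
and uncorrelated with the test and source systems of `b`, whatever state is teleported. -/
theorem testMarginal_stageTwo_tele (ξ : Matrix (((teleOut t b d).Arel × (teleOut t b d).Aabs) ×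
      (teleOut t b d).S) (((teleOut t b d).Arel × (teleOut t b d).Aabs) × (teleOut t b d).S) ℂ)
    (h : testMarginal ξ = (teleOut t b d).ω ⊗ₖ (teleOut t b d).ρ) :
    testMarginal (trRight (stageTwo (t₂ := b.tensor (cohRes (.of (ZMod d × ZMod d))))
      (teleMid t b d) (teleIn t d).N (stageOne (t₁ := teleIn t d)
      (t₂ := b.tensor (cohRes (.of (ZMod d × ZMod d))))
      (Channel.relabel (teleEnc t b d)) (teleSrc t b d) ξ))) =
      (b.tensor (cohRes (.of (ZMod d × ZMod d)))).ω ⊗ₖ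
        (b.tensor (cohRes (.of (ZMod d × ZMod d)))).ρ := by
  suffices H : ∀ (r r' : b.Arel) (x x' : ZMod d × ZMod d) (σ σ' : b.S),
      testMarginal (trRight (stageTwo (t₂ := b.tensor (cohRes (.of (ZMod d × ZMod d))))
      (teleMid t b d) (teleIn t d).N (stageOne (t₁ := teleIn t d)
      (t₂ := b.tensor (cohRes (.of (ZMod d × ZMod d))))
      (Channel.relabel (teleEnc t b d)) (teleSrc t b d) ξ))) ((r, x), (σ, ())) ((r', x'), (σ', ()))
      = (b.ω r r' * (if x = x' then ((d : ℂ) * d)⁻¹ else 0)) * b.ρ σ σ' by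
    ext p q
    refine (H p.1.1 q.1.1 p.1.2 q.1.2 p.2.1 q.2.1).trans ?_
    have h1 : ∀ (x x' : ZMod d × ZMod d) (z w : ℂ), (z * (if x = x' then ((d : ℂ) * d)⁻¹ else 0)) * w
        = (z * (((Fintype.card (ZMod d × ZMod d) : ℂ)⁻¹ •
          (1 : Matrix (ZMod d × ZMod d) (ZMod d × ZMod d) ℂ)) x x')) *
            (w * (1 : Matrix Unit Unit ℂ) () ()) := by
      intro x x' z w
      by_cases hx : x = x' <;> simp [hx, -Prod.mk.injEq]
    exact h1 p.1.2 q.1.2 _ _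
  intro r r' x x' σ σ'
  let Y : b.Aabs → t.A → t.B → Matrix (ZMod d) (ZMod d) ℂ := fun z a c =>
    Matrix.of fun m m' : ZMod d => t.N (Matrix.of fun o o' => ξ
      (teleLabel t b d o ((r, z), σ) m) (teleLabel t b d o' ((r', z), σ') m')) (a, c) (a, c)
  have h1 : testMarginal (trRight (stageTwo (t₂ := b.tensor (cohRes (.of (ZMod d × ZMod d))))
      (teleMid t b d) (teleIn t d).N (stageOne (t₁ := teleIn t d)
      (t₂ := b.tensor (cohRes (.of (ZMod d × ZMod d))))
      (Channel.relabel (teleEnc t b d)) (teleSrc t b d) ξ))) ((r, x), (σ, ())) ((r', x'), (σ', ()))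
      = ∑ z, ∑ a, ∑ c, ∑ k, ∑ j, ∑ kb, bellChannel d (Matrix.of fun w w' =>
        maxEntCoeff (ZMod d × ZMod d) (w.1, kb) (w'.1, kb) *
          (maxEntCoeff (ZMod d) (w.2.1, j) (w'.2.1, j) * Y z a c w.2.2 w'.2.2)) (k, x) (k, x') := by
    refine (Fintype.sum_prod_type (α₁ := b.Aabs) (α₂ := Unit) _).trans ?_
    refine Finset.sum_congr rfl fun z _ => ?_
    refine (Fintype.sum_unique (ι := Unit) _).trans ?_
    refine (Fintype.sum_prod_type (α₁ := t.A × (ZMod d × ZMod d))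
      (α₂ := t.B × (ZMod d × (ZMod d × ZMod d))) _).trans ?_
    refine (Fintype.sum_prod_type _).trans ?_
    refine Finset.sum_congr rfl fun a _ => ?_
    refine Eq.trans ?_ Finset.sum_comm
    refine Finset.sum_congr rfl fun k _ => ?_
    refine (Fintype.sum_prod_type _).trans ?_
    refine Finset.sum_congr rfl fun c _ => ?_
    refine (Fintype.sum_prod_type _).trans ?_
    refine Finset.sum_congr rfl fun j _ => Finset.sum_congr rfl fun kb _ => ?_
    exact stageTwo_tele ξ ((r, z), σ) ((r', z), σ') x x' k k kb kb j j a a c c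
  rw [h1]
  simp only [sum_bellChannel]
  have h2 : ∀ z m, ∑ a, ∑ c, Y z a c m m = ∑ y, ∑ e, ∑ τ,
      ξ (teleLabel t b d ((e, y), τ) ((r, z), σ) m)
        (teleLabel t b d ((e, y), τ) ((r', z), σ') m) := by
    intro z m
    have h3 := t.N.trace_apply (Matrix.of fun o o' => ξ
      (teleLabel t b d o ((r, z), σ) m) (teleLabel t b d o' ((r', z), σ') m))
    refine Eq.trans (Fintype.sum_prod_type
      (fun v : t.A × t.B => Y z v.1 v.2 m m)).symm (h3.trans ?_)
    refine (Fintype.sum_prod_type _).trans ?_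
    refine (Fintype.sum_prod_type _).trans ?_
    exact Finset.sum_comm
  have h3 : ∀ e τ, ∑ y : t.Aabs, ∑ z, ∑ m, ξ (teleLabel t b d ((e, y), τ) ((r, z), σ) m)
        (teleLabel t b d ((e, y), τ) ((r', z), σ') m) =
      b.ω r r' * b.ρ σ σ' * (t.ω e e * t.ρ τ τ) := by
    intro e τ
    have h2 := congrFun (congrFun h (((e, r), ((), ((), ()))), ((τ, σ), ((), ((), ())))))
      (((e, r'), ((), ((), ()))), ((τ, σ'), ((), ((), ()))))
    refine Eq.trans ?_ (h2.trans ?_)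
    · refine Eq.trans ?_ (Fintype.sum_prod_type (α₁ := t.Aabs × b.Aabs)
        (α₂ := ZMod d × (Unit × Unit)) _).symm
      refine Eq.trans ?_ (Fintype.sum_prod_type _).symm
      refine Finset.sum_congr rfl fun y _ => Finset.sum_congr rfl fun z _ => ?_
      refine Eq.trans ?_ (Fintype.sum_prod_type _).symm
      refine Finset.sum_congr rfl fun m _ => ?_
      refine Eq.symm ?_
      exact Fintype.sum_subsingleton (ι := Unit × Unit) _ ((), ())
    · change ((t.ω e e * b.ω r r') * ((1 : Matrix Unit Unit ℂ) () () *
        ((1 : Matrix Unit Unit ℂ) () () * (1 : Matrix Unit Unit ℂ) () ()))) *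
        ((t.ρ τ τ * b.ρ σ σ') * ((1 : Matrix Unit Unit ℂ) () () *
        ((1 : Matrix Unit Unit ℂ) () () * (1 : Matrix Unit Unit ℂ) () ()))) = _
      rw [Matrix.one_apply_eq]
      ring
  have h4 : ∑ a, t.ω a a = 1 := t.isState_ω.trace_eq_one
  have h5 : ∑ τ, t.ρ τ τ = 1 := t.isState_ρ.trace_eq_one
  have h6 : ∑ z, ∑ a, ∑ c, ∑ m, Y z a c m m = b.ω r r' * b.ρ σ σ' := by
    calc ∑ z, ∑ a, ∑ c, ∑ m, Y z a c m m = ∑ z, ∑ m, ∑ a, ∑ c, Y z a c m m :=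
          Finset.sum_congr rfl fun z _ => (Finset.sum_congr rfl fun a _ =>
            Finset.sum_comm).trans Finset.sum_comm
      _ = ∑ z, ∑ m, ∑ y, ∑ e, ∑ τ, ξ (teleLabel t b d ((e, y), τ) ((r, z), σ) m)
            (teleLabel t b d ((e, y), τ) ((r', z), σ') m) :=
          Finset.sum_congr rfl fun z _ => Finset.sum_congr rfl fun m _ => h2 z m
      _ = ∑ z, ∑ m, ∑ e, ∑ τ, ∑ y, ξ (teleLabel t b d ((e, y), τ) ((r, z), σ) m)
            (teleLabel t b d ((e, y), τ) ((r', z), σ') m) :=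
          Finset.sum_congr rfl fun z _ => Finset.sum_congr rfl fun m _ =>
            Finset.sum_comm.trans (Finset.sum_congr rfl fun e _ => Finset.sum_comm)
      _ = ∑ e, ∑ τ, ∑ z, ∑ m, ∑ y, ξ (teleLabel t b d ((e, y), τ) ((r, z), σ) m)
            (teleLabel t b d ((e, y), τ) ((r', z), σ') m) := by
          refine (Finset.sum_congr rfl fun z _ => Finset.sum_comm).trans (Finset.sum_comm.trans
            (Finset.sum_congr rfl fun e _ => ?_))
          exact (Finset.sum_congr rfl fun z _ => Finset.sum_comm).trans Finset.sum_comm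
      _ = ∑ e, ∑ τ, b.ω r r' * b.ρ σ σ' * (t.ω e e * t.ρ τ τ) := by
          refine Finset.sum_congr rfl fun e _ => Finset.sum_congr rfl fun τ _ => ?_
          rw [← h3]
          exact (Finset.sum_congr rfl fun z _ => Finset.sum_comm).trans Finset.sum_comm
      _ = _ := by
          simp only [← Finset.mul_sum]
          rw [h5]
          simp only [mul_one]
          rw [h4, mul_one]
  by_cases hx : x = x'
  · simp only [if_pos hx, ← Finset.mul_sum]
    rw [h6]
    ring
  · simp only [if_neg hx, Finset.sum_const_zero, mul_zero, zero_mul]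

/-- Coherent teleportation: one use of a resource which contains entanglement, and one use of a
coherent channel, create a noiseless quantum channel and entanglement. -/
theorem Creates.teleport {l₁ l₂ : Depth} {ε₁ ε₂ : ℝ} (h₁ : Creates l₁ (teleIn t d) ε₁)
    (h₂ : Creates l₂ (b.tensor (cohRes (.of (ZMod d × ZMod d)))) ε₂) (hε₂ : 0 ≤ ε₂) :
    Creates (l₁ ++ l₂) (teleOut t b d) (ε₁ + ε₂) := by
  refine h₁.comp h₂ hε₂ (Channel.relabel (teleEnc t b d)) (teleMid t b d)
    (Channel.relabel (teleFin t b d)) (teleDec t b d) (teleSrc t b d) ?_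
    (fun ξ _ h => testMarginal_stageOne_tele ξ h) (fun ξ _ h => testMarginal_stageTwo_tele ξ h)
    teleOut_eq
  ext ⟨⟨σ, τ⟩, u⟩ ⟨⟨σ', τ'⟩, u'⟩
  change (t.ρ σ σ' * b.ρ τ τ') * ((1 : Matrix Unit Unit ℂ) () () *
      ((1 : Matrix Unit Unit ℂ) () () * (1 : Matrix Unit Unit ℂ) () ())) =
    (t.ρ σ σ' * ((1 : Matrix Unit Unit ℂ) () () * (1 : Matrix Unit Unit ℂ) () ())) *
      (b.ρ τ τ' * (1 : Matrix Unit Unit ℂ) () ())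
  rw [Matrix.one_apply_eq]
  ring

end teleport

open Protocol.CohExt (swapEquiv)

/-! ### Coherent channels -/

theorem cohRes_reduces_of_equiv {X Y : Sys} (e : Y ≃ X) : (cohRes X).Reduces (cohRes Y) := by
  refine Resource.reduces_of_relabel e (Equiv.refl Unit) (Equiv.refl Unit) e e (fun i j => ?_)
    (fun _ _ => rfl) fun Z p q => ?_
  · have h : ∀ i j : Y, ((Fintype.card Y : ℂ)⁻¹ • (1 : Matrix Y Y ℂ)) i j =
        ((Fintype.card X : ℂ)⁻¹ • (1 : Matrix X X ℂ)) (e i) (e j) := fun i j => by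
      simp [Matrix.one_apply, Fintype.card_congr e]
    exact h i j
  · refine (cohRes_apply Y Z p q).trans (Eq.trans ?_ (cohRes_apply X _ _ _).symm)
    refine if_congr (and_congr e.apply_eq_iff_eq.symm e.apply_eq_iff_eq.symm) ?_ rfl
    exact (congrArg₂ (fun i j : Y => Z ((i, ()), ()) ((j, ()), ())) (e.symm_apply_apply p.1)
      (e.symm_apply_apply q.1)).symm

/-- Alice fills the unneeded factor with the maximally mixed state, as the test state demands; both
parties discard their copies of it. -/
theorem cohRes_prod_reduces (Y Z : Sys) : (cohRes (.of (Y × Z))).Reduces (cohRes Y) := by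
  have hz : ∑ z : Z, ((Fintype.card Z : ℂ)⁻¹ • (1 : Matrix Z Z ℂ)) z z = 1 :=
    (isState_maximallyMixed Z).trace_eq_one
  refine ⟨(Channel.relabel (swapEquiv Y Unit Z)).comp (Channel.append (Y × Unit) _
    (isState_maximallyMixed Z)), Channel.disc Y Z, Channel.disc Y Z, .of Unit,
    Equiv.prodPUnit Unit, 1, isState_one_unit, ?_, fun ξ hξ h => ?_, ?_⟩
  · ext i j
    exact (one_mul _).symm
  · ext ⟨y, z⟩ ⟨y', z'⟩
    have h1 := congrFun (congrFun h y) y'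
    refine Eq.trans (b := trRight ξ y y' *
      ((Fintype.card Z : ℂ)⁻¹ • (1 : Matrix Z Z ℂ)) z z')
      (Finset.sum_mul Finset.univ (fun u : Unit => ξ (y, u) (y', u)) _).symm ?_
    refine (congrArg (· * ((Fintype.card Z : ℂ)⁻¹ • (1 : Matrix Z Z ℂ)) z z') h1).trans ?_
    change ((Fintype.card Y : ℂ)⁻¹ * (1 : Matrix Y Y ℂ) y y') *
      ((Fintype.card Z : ℂ)⁻¹ * (1 : Matrix Z Z ℂ) z z') =
      (Fintype.card (Y × Z) : ℂ)⁻¹ * (1 : Matrix (Y × Z) (Y × Z) ℂ) (y, z) (y', z')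
    rw [Fintype.card_prod, Nat.cast_mul, mul_inv, ← Matrix.one_kronecker_one,
      Matrix.kroneckerMap_apply]
    ring
  · apply Channel.ext_toFun
    intro X
    suffices H : ∀ a b a' b' : Y, (cohRes Y).N X (a, b) (a', b') =
        ∑ z, ∑ w, (cohRes (.of (Y × Z))).N (Matrix.of fun i i' =>
          X ((i.1.1.1, ()), ()) ((i'.1.1.1, ()), ()) *
            ((Fintype.card Z : ℂ)⁻¹ • (1 : Matrix Z Z ℂ)) i.1.1.2 i'.1.1.2 * 1) ((a, w), (b, z))
              ((a', w), (b', z)) by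
      ext p q
      exact H p.1 p.2 q.1 q.2
    intro a b a' b'
    refine (cohRes_apply Y X (a, b) (a', b')).trans (Eq.symm ?_)
    have h1 : ∀ z w : Z, (cohRes (.of (Y × Z))).N (Matrix.of fun i i' =>
      X ((i.1.1.1, ()), ()) ((i'.1.1.1, ()), ()) *
        ((Fintype.card Z : ℂ)⁻¹ • (1 : Matrix Z Z ℂ)) i.1.1.2 i'.1.1.2 * 1) ((a, w), (b, z))
          ((a', w), (b', z)) = if z = w then (if b = a ∧ b' = a' then
            X ((a, ()), ()) ((a', ()), ()) else 0) *
              ((Fintype.card Z : ℂ)⁻¹ • (1 : Matrix Z Z ℂ)) w w else 0 := by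
      intro z w
      refine (cohRes_apply (.of (Y × Z)) _ _ _).trans ?_
      by_cases hw : z = w
      · subst hw
        rw [if_pos rfl, ite_mul, zero_mul]
        refine if_congr (and_congr ?_ ?_) (mul_one _) rfl
        · exact ⟨congrArg Prod.fst, fun h => Prod.ext h rfl⟩
        · exact ⟨congrArg Prod.fst, fun h => Prod.ext h rfl⟩
      · rw [if_neg hw]
        exact if_neg fun h => hw (congrArg Prod.snd h.1)
    refine (Finset.sum_congr rfl fun z _ => Finset.sum_congr rfl fun w _ => h1 z w).trans ?_
    simp only [Finset.sum_ite_eq, Finset.mem_univ, if_true]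
    rw [← Finset.mul_sum, hz, mul_one]
    exact if_congr Iff.rfl rfl rfl

/-! ### Entanglement from a coherent channel -/

section entangle

variable (t b : Resource) (Y : Sys)

theorem isState_maxEntCoeff : IsState (Matrix.of (maxEntCoeff Y)) := by
  have h := (Channel.ofIsometry (maxEntVec Y) (maxEntVec_isometry Y)).isState isState_one_unit
  refine Eq.mp (congrArg IsState ?_) h
  ext p q
  exact (ebitOf_apply Y 1 p q).trans (mul_one _)

/-- The resource with additional entanglement. -/
noncomputable def entOut : Resource := (t.tensor b).tensor (ebitOf Y)

/-- Alice's initial encoding. -/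
def entEnc : (entOut t b Y).Arel × (entOut t b Y).Aabs ≃
    (t.Arel × t.Aabs) × Sys.of (b.Arel × b.Aabs) where
  toFun (p : ((t.Arel × b.Arel) × Unit) × ((t.Aabs × b.Aabs) × Unit)) :=
    ((p.1.1.1, p.2.1.1), (p.1.1.2, p.2.1.2))
  invFun (q : (t.Arel × t.Aabs) × (b.Arel × b.Aabs)) :=
    (((q.1.1, q.2.1), ()), ((q.1.2, q.2.2), ()))
  left_inv _ := rfl
  right_inv _ := rfl

/-- The identification of the source systems. -/
def entSrc : (entOut t b Y).S ≃ t.S × (b.tensor (cohRes Y)).S where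
  toFun (p : (t.S × b.S) × Unit) := (p.1.1, (p.1.2, ()))
  invFun (q : t.S × (b.S × Unit)) := ((q.1, q.2.1), ())
  left_inv _ := rfl
  right_inv _ := rfl

/-- Regrouping of the inputs of the coherent channel. -/
def entPre : (t.A × Sys.of (b.Arel × b.Aabs)) × (Y × Y) ≃
    ((b.tensor (cohRes Y)).Arel × (b.tensor (cohRes Y)).Aabs) × Sys.of (t.A × Y) where
  toFun (p : (t.A × (b.Arel × b.Aabs)) × (Y × Y)) :=
    ((((p.1.2.1, p.2.2), (p.1.2.2, ())), (p.1.1, p.2.1)) :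
      ((b.Arel × Y) × (b.Aabs × Unit)) × (t.A × Y))
  invFun (q : ((b.Arel × Y) × (b.Aabs × Unit)) × (t.A × Y)) :=
    ((q.2.1, (q.1.1.1, q.1.2.1)), (q.2.2, q.1.1.2))
  left_inv _ := rfl
  right_inv _ := rfl

/-- Alice prepares the input of the coherent channel. -/
noncomputable def entMid : Channel (t.A × Sys.of (b.Arel × b.Aabs))
    (((b.tensor (cohRes Y)).Arel × (b.tensor (cohRes Y)).Aabs) × Sys.of (t.A × Y)) :=
  (Channel.relabel (entPre t b Y)).comp (Channel.append _ _ (isState_maxEntCoeff Y))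

variable {Y} in
/-- Alice erases her copy of the output of the coherent channel. -/
def entErase (y : Y) : (b.tensor (cohRes Y)).A × Sys.of (t.A × Y) ≃ (entOut t b Y).A × Y where
  toFun (p : (b.A × Y) × (t.A × Y)) :=
    (((p.2.1, p.1.1), p.2.2), Equiv.swap p.2.2 y p.1.2)
  invFun (q : ((t.A × b.A) × Y) × Y) :=
    ((q.1.1.2, Equiv.swap q.1.2 y q.2), (q.1.1.1, q.1.2))
  left_inv (p : (b.A × Y) × (t.A × Y)) := by
    exact congrArg (fun z => ((p.1.1, z), p.2)) ((Equiv.swap _ _).symm_apply_apply _)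
  right_inv (q : ((t.A × b.A) × Y) × Y) := by
    exact congrArg (fun z => (q.1, z)) ((Equiv.swap _ _).symm_apply_apply _)

/-- Regrouping of Bob's systems. -/
def entBob : t.B × (b.tensor (cohRes Y)).B ≃ (entOut t b Y).B :=
  (Equiv.prodAssoc t.B b.B Y).symm

/-- The basis labels of the input of the created resource. -/
def entLabel (o : (t.Arel × t.Aabs) × t.S) (i : (b.Arel × b.Aabs) × b.S) :
    ((entOut t b Y).Arel × (entOut t b Y).Aabs) × (entOut t b Y).S :=
  ((((o.1.1, i.1.1), ()), ((o.1.2, i.1.2), ())), ((o.2, i.2), ()))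

variable {t b Y}

theorem entOut_apply (ξ : Matrix (((entOut t b Y).Arel × (entOut t b Y).Aabs) × (entOut t b Y).S)
      (((entOut t b Y).Arel × (entOut t b Y).Aabs) × (entOut t b Y).S) ℂ)
    (p q : (entOut t b Y).A × (entOut t b Y).B) :
    (entOut t b Y).N ξ p q = maxEntCoeff Y (p.1.2, p.2.2) (q.1.2, q.2.2) *
      b.N (Matrix.of fun i i' => t.N (Matrix.of fun o o' =>
        ξ (entLabel t b Y o i) (entLabel t b Y o' i'))
          (p.1.1.1, p.2.1.1) (q.1.1.1, q.2.1.1)) (p.1.1.2, p.2.1.2) (q.1.1.2, q.2.1.2) :=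
  ebitOf_apply Y _ _ _

/-- Half of a maximally entangled state sent through the coherent channel gives three equal copies
in superposition, two of them with Alice. Controlled by one, she resets the other to `y`, which then
factors out. -/
theorem entOut_eq (y : Y) : (entOut t b Y).N =
    (stageThree (s := entOut t b Y) (t₁ := t) (t₂ := b.tensor (cohRes Y))
      ((Channel.disc (entOut t b Y).A Y).comp (Channel.relabel (entErase t b y)))
      (Channel.relabel (entBob t b Y)) (b.tensor (cohRes Y)).N).comp
    ((stageTwo (t₂ := b.tensor (cohRes Y)) (entMid t b Y) t.N).comp
      (stageOne (t₁ := t) (t₂ := b.tensor (cohRes Y))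
        (Channel.relabel (entEnc t b Y)) (entSrc t b Y))) := by
  apply Channel.ext_toFun
  intro ξ
  let Z := stageTwo (t₂ := b.tensor (cohRes Y)) (entMid t b Y) t.N
    (stageOne (t₁ := t) (t₂ := b.tensor (cohRes Y)) (Channel.relabel (entEnc t b Y))
      (entSrc t b Y) ξ)
  suffices H : ∀ (a₁ a₁' : t.A) (a₂ a₂' : b.A) (c₁ c₁' : t.B) (c₂ c₂' : b.B) (r r' x x' : Y),
      (entOut t b Y).N ξ (((a₁, a₂), r), ((c₁, c₂), x)) (((a₁', a₂'), r'), ((c₁', c₂'), x')) =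
      ∑ w, (b.tensor (cohRes Y)).N (Matrix.of fun i i' =>
        Z (i, ((a₁, r), c₁)) (i', ((a₁', r'), c₁'))) ((a₂, Equiv.swap r y w), (c₂, x))
          ((a₂', Equiv.swap r' y w), (c₂', x')) by
    ext p q
    exact H p.1.1.1 q.1.1.1 p.1.1.2 q.1.1.2 p.2.1.1 q.2.1.1 p.2.1.2 q.2.1.2 p.1.2 q.1.2 p.2.2 q.2.2
  intro a₁ a₁' a₂ a₂' c₁ c₁' c₂ c₂' r r' x x'
  refine (entOut_apply _ _ _).trans (Eq.symm ?_)
  let G : Matrix ((b.Arel × b.Aabs) × b.S) ((b.Arel × b.Aabs) × b.S) ℂ :=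
    Matrix.of fun i i' => t.N (Matrix.of fun o o' =>
      ξ (entLabel t b Y o i) (entLabel t b Y o' i')) (a₁, c₁) (a₁', c₁')
  have h1 : ∀ v v' : Y, (b.tensor (cohRes Y)).N (Matrix.of fun i i' =>
        Z (i, ((a₁, r), c₁)) (i', ((a₁', r'), c₁'))) ((a₂, v), (c₂, x)) ((a₂', v'), (c₂', x')) =
      if x = v ∧ x' = v' then maxEntCoeff Y (r, v) (r', v') * b.N G (a₂, c₂) (a₂', c₂') else 0 := by
    intro v v'
    refine (tensor_cohRes_apply b Y _ _ _).trans (if_congr Iff.rfl ?_ rfl)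
    refine Eq.trans ?_ (congrFun (congrFun (b.N.map_smul (maxEntCoeff Y (r, v) (r', v')) G)
      (a₂, c₂)) (a₂', c₂'))
    refine congrFun (congrFun (congrArg b.N.toFun ?_) _) _
    ext i i'
    exact mul_comm _ _
  refine (Finset.sum_congr rfl fun w _ => h1 _ _).trans ?_
  rw [Finset.sum_eq_single y]
  · rw [Equiv.swap_apply_right, Equiv.swap_apply_right]
    by_cases hx : x = r ∧ x' = r'
    · obtain ⟨rfl, rfl⟩ := hx
      exact if_pos ⟨rfl, rfl⟩
    · rw [if_neg hx]
      have h2 : maxEntCoeff Y (r, x) (r', x') = 0 := if_neg fun h => hx ⟨h.1.symm, h.2.symm⟩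
      exact (mul_eq_zero_of_left h2 _).symm
  · intro w _ hw
    -- The swap takes `w` to `r` only for `w = y`; no other value of the erased copy occurs.
    have h2 : maxEntCoeff Y (r, Equiv.swap r y w) (r', Equiv.swap r' y w) = 0 :=
      if_neg fun h => hw (by
        have h3 := congrArg (Equiv.swap r y) h.1
        simpa using h3.symm)
    rw [h2, zero_mul, ite_self]
  · simp

theorem testMarginal_stageOne_ent
    (ξ : Matrix (((entOut t b Y).Arel × (entOut t b Y).Aabs) × (entOut t b Y).S)
      (((entOut t b Y).Arel × (entOut t b Y).Aabs) × (entOut t b Y).S) ℂ)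
    (h : testMarginal ξ = (entOut t b Y).ω ⊗ₖ (entOut t b Y).ρ) :
    testMarginal (trRight (stageOne (t₁ := t) (t₂ := b.tensor (cohRes Y))
      (Channel.relabel (entEnc t b Y)) (entSrc t b Y) ξ)) = t.ω ⊗ₖ t.ρ := by
  ext ⟨r, σ⟩ ⟨r', σ'⟩
  have h1 : ∀ (a : b.Arel) (τ : b.S), ∑ (y : t.Aabs), ∑ (z : b.Aabs),
      ξ (entLabel t b Y ((r, y), σ) ((a, z), τ)) (entLabel t b Y ((r', y), σ') ((a, z), τ)) =
      t.ω r r' * t.ρ σ σ' * (b.ω a a * b.ρ τ τ) := by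
    intro a τ
    have h2 := congrFun (congrFun h (((r, a), ()), ((σ, τ), ()))) (((r', a), ()), ((σ', τ), ()))
    refine Eq.trans ?_ (h2.trans ?_)
    · refine Eq.trans ?_ (Fintype.sum_prod_type (α₁ := t.Aabs × b.Aabs) (α₂ := Unit) _).symm
      refine Eq.trans ?_ (Fintype.sum_prod_type _).symm
      refine Finset.sum_congr rfl fun y _ => Finset.sum_congr rfl fun z _ => ?_
      refine Eq.symm ?_
      exact Fintype.sum_unique (ι := Unit) _
    · change ((t.ω r r' * b.ω a a) * (1 : Matrix Unit Unit ℂ) () ()) *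
        ((t.ρ σ σ' * b.ρ τ τ) * (1 : Matrix Unit Unit ℂ) () ()) = _
      rw [Matrix.one_apply_eq]
      ring
  have h3 : testMarginal (trRight (stageOne (t₁ := t) (t₂ := b.tensor (cohRes Y))
      (Channel.relabel (entEnc t b Y)) (entSrc t b Y) ξ)) (r, σ) (r', σ') =
      ∑ a : b.Arel, ∑ τ : b.S, ∑ (y : t.Aabs), ∑ (z : b.Aabs),
      ξ (entLabel t b Y ((r, y), σ) ((a, z), τ)) (entLabel t b Y ((r', y), σ') ((a, z), τ)) := by
    calc _ = ∑ y : t.Aabs, ∑ a : b.Arel, ∑ z : b.Aabs, ∑ τ : b.S,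
          ξ (entLabel t b Y ((r, y), σ) ((a, z), τ)) (entLabel t b Y ((r', y), σ') ((a, z), τ)) := by
          refine Finset.sum_congr rfl fun y _ => ?_
          refine (Fintype.sum_prod_type (α₁ := b.Arel × b.Aabs) (α₂ := b.S × Unit) _).trans ?_
          refine (Fintype.sum_prod_type _).trans ?_
          refine Finset.sum_congr rfl fun a _ => Finset.sum_congr rfl fun z _ => ?_
          refine (Fintype.sum_prod_type _).trans ?_
          exact Finset.sum_congr rfl fun τ _ => Fintype.sum_unique (ι := Unit) _
      _ = _ := by
          rw [Finset.sum_comm]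
          refine Finset.sum_congr rfl fun a _ => ?_
          exact (Finset.sum_congr rfl fun y _ => Finset.sum_comm).trans Finset.sum_comm
  refine h3.trans ?_
  simp only [h1, ← Finset.mul_sum]
  have h4 : ∑ a, b.ω a a = 1 := b.isState_ω.trace_eq_one
  have h5 : ∑ τ, b.ρ τ τ = 1 := b.isState_ρ.trace_eq_one
  rw [h5]
  simp only [mul_one]
  rw [h4, mul_one]
  rfl

theorem sum_maxEntCoeff (x x' : Y) : ∑ r, maxEntCoeff Y (r, x) (r, x') =
    ((Fintype.card Y : ℂ)⁻¹ • (1 : Matrix Y Y ℂ)) x x' := by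
  by_cases h : x = x'
  · subst h
    simp [maxEntCoeff]
  · have : ∀ r : Y, ¬ (r = x ∧ r = x') := fun r hr => h (hr.1.symm.trans hr.2)
    simp [maxEntCoeff, h, this]

/-- Half of a maximally entangled state is maximally mixed and independent of the input of `b`. -/
theorem testMarginal_stageTwo_ent
    (ξ : Matrix (((entOut t b Y).Arel × (entOut t b Y).Aabs) × (entOut t b Y).S)
      (((entOut t b Y).Arel × (entOut t b Y).Aabs) × (entOut t b Y).S) ℂ)
    (h : testMarginal ξ = (entOut t b Y).ω ⊗ₖ (entOut t b Y).ρ) :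
    testMarginal (trRight (stageTwo (t₂ := b.tensor (cohRes Y)) (entMid t b Y) t.N
      (stageOne (t₁ := t) (t₂ := b.tensor (cohRes Y))
      (Channel.relabel (entEnc t b Y)) (entSrc t b Y) ξ))) =
      (b.tensor (cohRes Y)).ω ⊗ₖ (b.tensor (cohRes Y)).ρ := by
  suffices H : ∀ (r r' : b.Arel) (x x' : Y) (σ σ' : b.S),
      testMarginal (trRight (stageTwo (t₂ := b.tensor (cohRes Y)) (entMid t b Y) t.N
        (stageOne (t₁ := t) (t₂ := b.tensor (cohRes Y)) (Channel.relabel (entEnc t b Y))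
        (entSrc t b Y) ξ))) ((r, x), (σ, ())) ((r', x'), (σ', ()))
      = (b.ω r r' * ((Fintype.card Y : ℂ)⁻¹ • (1 : Matrix Y Y ℂ)) x x') * (b.ρ σ σ' * 1) by
    ext p q
    exact H p.1.1 q.1.1 p.1.2 q.1.2 p.2.1 q.2.1
  intro r r' x x' σ σ'
  let V : b.Aabs → Matrix (t.A × t.B) (t.A × t.B) ℂ := fun z => t.N (Matrix.of fun o o' => ξ
      (entLabel t b Y o ((r, z), σ)) (entLabel t b Y o' ((r', z), σ')))
  have h1 : testMarginal (trRight (stageTwo (t₂ := b.tensor (cohRes Y)) (entMid t b Y) t.N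
      (stageOne (t₁ := t) (t₂ := b.tensor (cohRes Y)) (Channel.relabel (entEnc t b Y))
      (entSrc t b Y) ξ))) ((r, x), (σ, ())) ((r', x'), (σ', ())) =
      ∑ z, (V z).trace * ∑ k, maxEntCoeff Y (k, x) (k, x') := by
    refine (Fintype.sum_prod_type (α₁ := b.Aabs) (α₂ := Unit) _).trans ?_
    refine Finset.sum_congr rfl fun z _ => ?_
    refine (Fintype.sum_unique (ι := Unit) _).trans ?_
    refine (Fintype.sum_prod_type (α₁ := t.A × Y) (α₂ := t.B) _).trans ?_
    refine (Fintype.sum_prod_type _).trans ?_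
    have h2 : (V z).trace = ∑ a, ∑ c, V z (a, c) (a, c) := Fintype.sum_prod_type _
    rw [h2, Finset.sum_mul]
    refine Finset.sum_congr rfl fun a _ => ?_
    rw [Finset.mul_sum]
    refine Finset.sum_congr rfl fun k _ => ?_
    rw [Finset.sum_mul]
    rfl
  have h3 : ∀ e τ, ∑ y : t.Aabs, ∑ z, ξ (entLabel t b Y ((e, y), τ) ((r, z), σ))
        (entLabel t b Y ((e, y), τ) ((r', z), σ')) =
      b.ω r r' * b.ρ σ σ' * (t.ω e e * t.ρ τ τ) := by
    intro e τ
    have h2 := congrFun (congrFun h (((e, r), ()), ((τ, σ), ()))) (((e, r'), ()), ((τ, σ'), ()))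
    refine Eq.trans ?_ (h2.trans ?_)
    · refine Eq.trans ?_ (Fintype.sum_prod_type (α₁ := t.Aabs × b.Aabs) (α₂ := Unit) _).symm
      refine Eq.trans ?_ (Fintype.sum_prod_type _).symm
      refine Finset.sum_congr rfl fun y _ => Finset.sum_congr rfl fun z _ => ?_
      refine Eq.symm ?_
      exact Fintype.sum_unique (ι := Unit) _
    · change ((t.ω e e * b.ω r r') * (1 : Matrix Unit Unit ℂ) () ()) *
        ((t.ρ τ τ * b.ρ σ σ') * (1 : Matrix Unit Unit ℂ) () ()) = _
      rw [Matrix.one_apply_eq]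
      ring
  have h4 : ∑ a, t.ω a a = 1 := t.isState_ω.trace_eq_one
  have h5 : ∑ τ, t.ρ τ τ = 1 := t.isState_ρ.trace_eq_one
  have h6 : ∑ z, (V z).trace = b.ω r r' * b.ρ σ σ' := by
    calc ∑ z, (V z).trace = ∑ z, ∑ e, ∑ y, ∑ τ, ξ (entLabel t b Y ((e, y), τ) ((r, z), σ))
            (entLabel t b Y ((e, y), τ) ((r', z), σ')) := by
          refine Finset.sum_congr rfl fun z _ => (t.N.trace_apply _).trans ?_
          refine (Fintype.sum_prod_type _).trans ?_
          exact Fintype.sum_prod_type _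
      _ = ∑ e, ∑ τ, ∑ y, ∑ z, ξ (entLabel t b Y ((e, y), τ) ((r, z), σ))
            (entLabel t b Y ((e, y), τ) ((r', z), σ')) := by
          refine Finset.sum_comm.trans (Finset.sum_congr rfl fun e _ => ?_)
          refine (Finset.sum_congr rfl fun z _ => Finset.sum_comm).trans ?_
          exact Finset.sum_comm.trans (Finset.sum_congr rfl fun τ _ => Finset.sum_comm)
      _ = ∑ e, ∑ τ, b.ω r r' * b.ρ σ σ' * (t.ω e e * t.ρ τ τ) :=
          Finset.sum_congr rfl fun e _ => Finset.sum_congr rfl fun τ _ => h3 e τ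
      _ = _ := by
          simp only [← Finset.mul_sum]
          rw [h5]
          simp only [mul_one]
          rw [h4, mul_one]
  rw [h1, ← Finset.sum_mul, h6, sum_maxEntCoeff]
  ring

/-- A coherent channel creates entanglement. -/
theorem Creates.entangle {l₁ l₂ : Depth} {ε₁ ε₂ : ℝ} (h₁ : Creates l₁ t ε₁)
    (h₂ : Creates l₂ (b.tensor (cohRes Y)) ε₂) (hε₂ : 0 ≤ ε₂) :
    Creates (l₁ ++ l₂) ((t.tensor b).tensor (ebitOf Y)) (ε₁ + ε₂) := by
  refine h₁.comp (s := entOut t b Y) h₂ hε₂ (Channel.relabel (entEnc t b Y)) (entMid t b Y)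
    ((Channel.disc (entOut t b Y).A Y).comp (Channel.relabel (entErase t b (Classical.arbitrary Y))))
    (Channel.relabel (entBob t b Y)) (entSrc t b Y) ?_
    (fun ξ _ h => testMarginal_stageOne_ent ξ h) (fun ξ _ h => testMarginal_stageTwo_ent ξ h)
    (entOut_eq _)
  ext ⟨⟨σ, τ⟩, u⟩ ⟨⟨σ', τ'⟩, u'⟩
  change (t.ρ σ σ' * b.ρ τ τ') * (1 : Matrix Unit Unit ℂ) () () =
    t.ρ σ σ' * (b.ρ τ τ' * (1 : Matrix Unit Unit ℂ) () ())
  rw [Matrix.one_apply_eq]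
  ring

end entangle

/-! ### Iterated coherent teleportation -/

theorem copies_succ (k : ℕ) (l : Depth) : copies (k + 1) l = copies k l ++ l := by
  rw [copies, List.replicate_succ', List.flatten_append, List.flatten_singleton, ← copies]

theorem copies_mul (k k' : ℕ) (l : Depth) : copies (k * k') l = copies k (copies k' l) := by
  induction k with
  | zero => rw [Nat.zero_mul]; rfl
  | succ k ih =>
    rw [copies_succ, ← ih, Nat.succ_mul, copies, copies, copies, List.replicate_add,
      List.flatten_append]

theorem exists_cls_eq (x : ResClass) : ∃ r : Resource, r.cls = x := by
  induction x using Quotient.inductionOn with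
  | _ r => exact ⟨r, rfl⟩

/-- Teleportation in dimension `2 ^ r` needs a message space of dimension `2 ^ (2 * r)`; the
superfluous part of the coherent channel is discarded. -/
theorem creates_cohRes_zmod {l : Depth} {b : Resource} {X : Sys} {ε : ℝ} {N r : ℕ}
    (h : Creates l (b.tensor (cohRes X)) ε) (hX : Fintype.card X = 2 ^ N) (hr : 2 * r ≤ N) :
    Creates l (b.tensor (cohRes (.of (ZMod (2 ^ r) × ZMod (2 ^ r))))) ε := by
  let Y : Sys := .of (ZMod (2 ^ r) × ZMod (2 ^ r))
  let Z : Sys := .of (Fin (2 ^ (N - 2 * r)))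
  have hc : Fintype.card ((ZMod (2 ^ r) × ZMod (2 ^ r)) × Fin (2 ^ (N - 2 * r))) =
      Fintype.card X := by
    rw [hX, Fintype.card_prod, Fintype.card_prod, ZMod.card, Fintype.card_fin, ← pow_add,
      ← pow_add]
    congr 1
    omega
  have e : Y × Z ≃ X := Fintype.equivOfCardEq hc
  exact (h.reduces (Resource.Reduces.tensor_left b (cohRes_reduces_of_equiv (Y := .of (Y × Z)) e))).reduces
    (Resource.Reduces.tensor_left b (cohRes_prod_reduces Y Z))

theorem card_zmod_prod (r : ℕ) : Fintype.card (ZMod (2 ^ r) × ZMod (2 ^ r)) = 2 ^ (2 * r) := by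
  rw [Fintype.card_prod, ZMod.card, ← pow_add, two_mul]

/-- Repeated use of coherent channels; the entanglement created in one round is used for the
teleportation in the next ones. -/
theorem exists_creates_iterate {l : Depth} {b : Resource} {r : ℕ} {ε : ℝ} (hε : 0 ≤ ε)
    (h : Creates l (b.tensor (cohRes (.of (ZMod (2 ^ r) × ZMod (2 ^ r))))) ε) (k : ℕ) :
    ∃ s, Creates (copies (k + 3) l) s ((k + 3 : ℕ) * ε) ∧
      b.cls ^ (k + 3) * qubitRes.cls ^ (k * r) * ebitRes.cls ^ ((k + 4) * r) ≤ s.cls := by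
  have hY : (ebitOf (.of (ZMod (2 ^ r) × ZMod (2 ^ r)))).cls = ebitRes.cls ^ (2 * r) :=
    cls_ebitOf (card_zmod_prod r)
  have hJ : (ebitOf (.of (ZMod (2 ^ r)))).cls = ebitRes.cls ^ r := cls_ebitOf (ZMod.card _)
  have hQ : (qubitOf (.of (ZMod (2 ^ r)))).cls = qubitRes.cls ^ r := cls_qubitOf (ZMod.card _)
  induction k with
  | zero =>
    -- The start needs a resource to which entanglement can be added: one copy yields `b` alone, and
    -- two more yield `2 * r` ebits each. The next round requires only `r + 2 * r` of these.
    have h1 : Creates l b ε := h.reduces (cls_le.mp (by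
      rw [cls_tensor]
      exact le_mul_of_one_le_right' (one_le_resClass _)))
    have h3 := (h1.entangle h hε).entangle h hε
    refine ⟨((((b.tensor b).tensor (ebitOf (.of (ZMod (2 ^ r) × ZMod (2 ^ r))))).tensor b).tensor
      (ebitOf (.of (ZMod (2 ^ r) × ZMod (2 ^ r))))), ?_, ?_⟩
    · refine Eq.mpr (congrArg (Creates · _ _) ?_) (h3.mono ?_)
      · rw [copies_succ, copies_succ, copies_succ]
        rfl
      · push_cast
        linarith
    · simp only [cls_tensor, hY]
      refine le_of_eq ?_
      rw [zero_mul, pow_zero, mul_one, show (0 + 4) * r = 2 * r + 2 * r by ring,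
        pow_add ebitRes.cls, zero_add, pow_succ, pow_two]
      generalize ebitRes.cls ^ (2 * r) = y
      ac_rfl
  | succ k ih =>
    obtain ⟨s, hs, hle⟩ := ih
    -- `t` is what remains after setting aside the `3 * r` ebits that the next round takes, `r` for
    -- teleporting and `2 * r` as catalyst. It returns `4 * r`, a net gain of `r`.
    obtain ⟨t, ht⟩ := exists_cls_eq
      (b.cls ^ (k + 3) * qubitRes.cls ^ (k * r) * ebitRes.cls ^ ((k + 1) * r))
    have h1 : Creates (copies (k + 3) l) (teleIn t (2 ^ r)) ((k + 3 : ℕ) * ε) :=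
      hs.reduces (cls_le.mp (le_trans (le_of_eq (by
        rw [teleIn, cls_tensor, cls_tensor, ht, hJ, hY, ← pow_add, mul_assoc, ← pow_add]
        congr 2
        ring)) hle))
    have h2 := h1.teleport h hε
    refine ⟨teleOut t b (2 ^ r), ?_, ?_⟩
    · rw [show k + 1 + 3 = (k + 3) + 1 by ring, copies_succ]
      refine h2.mono ?_
      push_cast
      linarith
    · rw [teleOut, cls_tensor, cls_tensor, cls_tensor, cls_tensor, hY, hQ, ht]
      refine le_of_eq ?_
      rw [show k + 1 + 3 = (k + 3) + 1 by ring, show (k + 1) * r = k * r + r by ring,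
        show (k + 1 + 4) * r = k * r + r + (2 * r + 2 * r) by ring, pow_succ b.cls,
        pow_add qubitRes.cls, pow_add ebitRes.cls _ (2 * r + 2 * r), pow_add _ (2 * r)]
      generalize ebitRes.cls ^ (2 * r) = y
      generalize ebitRes.cls ^ (k * r + r) = z
      generalize b.cls ^ (k + 3) = w
      ac_rfl

/-! ### Asymptotics -/

/-- The error of one block is continuous and vanishes at zero. As the number `K` of blocks is fixed
before `ε`, the accumulated error can be made arbitrarily small. -/
theorem exists_pos_error (K : ℕ) {ε : ℝ} (hε : 0 < ε) :
    ∃ x : ℝ, 0 < x ∧ x < 1 / 8 ∧ K * (x + 2 * √(17 * x + 4 * √(8 * x))) ≤ ε := by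
  have hc : Continuous fun x : ℝ => K * (x + 2 * √(17 * x + 4 * √(8 * x))) := by fun_prop
  have h1 : ∀ᶠ x in nhds (0 : ℝ), K * (x + 2 * √(17 * x + 4 * √(8 * x))) < ε :=
    hc.continuousAt.eventually_lt continuousAt_const (by simpa using hε)
  have h2 : ∀ᶠ x in nhdsWithin (0 : ℝ) (Set.Ioi 0), x ∈ Set.Ioo (0 : ℝ) (1 / 8) :=
    Ioo_mem_nhdsGT (by norm_num)
  obtain ⟨x, hx, hx'⟩ := ((h1.filter_mono nhdsWithin_le_nhds).and h2).exists
  exact ⟨x, hx'.1, hx'.2, hx.le⟩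

theorem IsAsymptotic.exists_cls_le {β : ResSeq} (hβ : IsAsymptotic β) :
    ∃ N, ∀ m n, N ≤ m → m ≤ n → (flatten (β m)).cls ≤ (flatten (β n)).cls := by
  obtain ⟨N, hN⟩ := hβ.mono
  refine ⟨N, fun m n hm hmn => ?_⟩
  induction n, hmn using Nat.le_induction with
  | base => exact le_rfl
  | succ n hn ih => exact ih.trans (hN (n + 1) (hm.trans (hn.trans n.le_succ))).flatten

/-- A block of the protocol, made coherent. -/
theorem ResIneqDecoupled.creates {α β : ResSeq} {R : ℝ}
    (h : ResIneqDecoupled α β (ResSeq.scale R cbit)) {δ : ℝ} (hδ : 0 < δ) (hδ' : δ < 1) :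
    ∃ k : ℕ, 1 ≤ k ∧ ∀ ε : ℝ, 0 < ε → ε < 1 / 8 → ∃ N, ∀ n : ℕ, N ≤ n →
      Creates (copies k (α (n / k))) ((flatten (β ⌊(1 - δ) * n⌋₊)).tensor
        (cohRes (.of (ZMod (2 ^ (⌊R * ⌊(1 - δ) * n⌋₊⌋₊ / 2)) ×
          ZMod (2 ^ (⌊R * ⌊(1 - δ) * n⌋₊⌋₊ / 2)))))) (ε + 2 * √(17 * ε + 4 * √(8 * ε))) := by
  obtain ⟨k, hk, h⟩ := h δ hδ hδ'
  refine ⟨k, hk, fun ε hε hε' => ?_⟩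
  obtain ⟨N, hN⟩ := h ε hε
  refine ⟨N, fun n hn => ?_⟩
  obtain ⟨P, hval, hacc, hdec⟩ := hN n hn
  obtain ⟨hcard, e, he⟩ := exists_isClassical_flatten_replicate ⌊R * ⌊(1 - δ) * n⌋₊⌋₊
  -- `flatten` of a one-element list carries a trivial factor, which is classical as well.
  have h1 := creates_tensor_cohRes hε' hval hacc hdec (he.tensor isClassical_trivial)
  refine creates_cohRes_zmod h1 (N := ⌊R * ⌊(1 - δ) * n⌋₊⌋₊) ?_ (by omega)
  refine (Fintype.card_prod (flatten (List.replicate ⌊R * ⌊(1 - δ) * n⌋₊⌋₊ cbitRes)).B Unit).trans ?_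
  rw [hcard, Fintype.card_unit, mul_one]

/-- The estimates of the block lengths. -/
theorem exists_block_estimates {R δ : ℝ} (hR : 0 < R) (hδ : 0 < δ) (hδ' : δ < 1) {K : ℕ}
    (hK : 12 ≤ K * δ) (M : ℕ) : ∃ N, ∀ n : ℕ, N ≤ n →
      M ≤ n / K ∧ M ≤ ⌊(1 - δ) * n⌋₊ ∧ M ≤ K * ⌊(1 - δ / 4) * (n / K : ℕ)⌋₊ ∧
      ⌊(1 - δ) * n⌋₊ ≤ ⌊((K * ⌊(1 - δ / 4) * (n / K : ℕ)⌋₊ : ℕ) : ℝ) * (1 - δ / 4)⌋₊ ∧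
      ⌊R / 2 * ⌊(1 - δ) * n⌋₊⌋₊ ≤ (K - 3) * (⌊R * ⌊(1 - δ / 4) * (n / K : ℕ)⌋₊⌋₊ / 2) := by
  have hK1 : (12 : ℝ) ≤ K := hK.trans (mul_le_of_le_one_right (Nat.cast_nonneg K) hδ'.le)
  have hK2 : 12 ≤ K := by exact_mod_cast hK1
  -- The first two terms make the block lengths large, the third absorbs the rounding in the number
  -- of qubits, and the last one that in the length of `β`.
  refine ⟨M * K + ⌈M / (1 - δ)⌉₊ + ⌈4 * (R + 1) * K / (R * δ)⌉₊ + ⌈4 * K / δ⌉₊, fun n hn => ?_⟩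
  have hn1 : M * K ≤ n := by omega
  have hn2 : (M : ℝ) ≤ n * (1 - δ) := (div_le_iff₀ (by linarith)).mp
    ((Nat.le_ceil _).trans (Nat.cast_le.mpr (by omega)))
  have hn3 : 4 * (R + 1) * K ≤ n * (R * δ) := (div_le_iff₀ (by positivity)).mp
    ((Nat.le_ceil _).trans (Nat.cast_le.mpr (by omega)))
  have hn4 : 4 * (K : ℝ) ≤ n * δ := (div_le_iff₀ hδ).mp
    ((Nat.le_ceil _).trans (Nat.cast_le.mpr (by omega)))
  have h0 : (n : ℝ) ≤ K * ((n / K : ℕ) : ℝ) + K := by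
    exact_mod_cast (Nat.lt_mul_div_succ n (by omega : 0 < K)).le
  have h1 : (1 - δ / 4) * (n / K : ℕ) ≤ (⌊(1 - δ / 4) * (n / K : ℕ)⌋₊ : ℝ) + 1 :=
    (Nat.lt_floor_add_one _).le
  have h2 : R * ⌊(1 - δ / 4) * (n / K : ℕ)⌋₊ ≤
      2 * ((⌊R * ⌊(1 - δ / 4) * (n / K : ℕ)⌋₊⌋₊ / 2 : ℕ) : ℝ) + 2 := by
    refine (Nat.lt_floor_add_one _).le.trans ?_
    generalize ⌊R * ⌊(1 - δ / 4) * (n / K : ℕ)⌋₊⌋₊ = a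
    have : a + 1 ≤ 2 * (a / 2) + 2 := by omega
    exact_mod_cast this
  generalize ⌊R * ⌊(1 - δ / 4) * (n / K : ℕ)⌋₊⌋₊ / 2 = r at h2 ⊢
  generalize ⌊(1 - δ / 4) * ((n / K : ℕ) : ℝ)⌋₊ = m at h1 h2 ⊢
  have h3 : (1 - δ / 4) * n - 2 * K ≤ K * m := by
    have h4 := mul_le_mul_of_nonneg_left h0 (by linarith : 0 ≤ 1 - δ / 4)
    have h5 := mul_le_mul_of_nonneg_left h1 (Nat.cast_nonneg K : (0 : ℝ) ≤ K)
    have h6 := mul_nonneg hδ.le (Nat.cast_nonneg K : (0 : ℝ) ≤ K)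
    linarith
  have h4 : (1 - δ / 2) * n - 2 * K ≤ K * m * (1 - δ / 4) := by
    have h5 := mul_le_mul_of_nonneg_right h3 (by linarith : 0 ≤ 1 - δ / 4)
    have h6 := mul_nonneg hδ.le (Nat.cast_nonneg K : (0 : ℝ) ≤ K)
    have h7 := mul_nonneg (sq_nonneg δ) (Nat.cast_nonneg n : (0 : ℝ) ≤ n)
    linarith
  refine ⟨(Nat.le_div_iff_mul_le (by omega)).mpr hn1, Nat.le_floor (by linarith), ?_,
    Nat.floor_le_floor (by push_cast; linarith), ?_⟩
  · have : (M : ℝ) ≤ K * m := by linarith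
    exact_mod_cast this
  · have h5 : ((K - 3 : ℕ) : ℝ) = K - 3 := by
      rw [Nat.cast_sub (by omega)]
      norm_num
    -- The three rounds without teleportation are a fraction of at most `δ / 4` of all rounds, as
    -- `12 ≤ K * δ`.
    have h6 : (1 - δ / 4) * K ≤ ((K - 3 : ℕ) : ℝ) := by linarith
    have h7 : R / 2 * ⌊(1 - δ) * n⌋₊ ≤ R / 2 * ((1 - δ) * n) :=
      mul_le_mul_of_nonneg_left (Nat.floor_le (mul_nonneg (by linarith) (Nat.cast_nonneg n)))
        (by linarith)
    have h8 : R / 2 * ((1 - δ) * n) ≤ ((K - 3 : ℕ) : ℝ) * r := by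
      refine le_trans ?_ (mul_le_mul_of_nonneg_right h6 (Nat.cast_nonneg r))
      have h9 := mul_le_mul_of_nonneg_left h2
        (mul_nonneg (by linarith : 0 ≤ 1 - δ / 4) (Nat.cast_nonneg K : (0 : ℝ) ≤ K))
      have h10 := mul_le_mul_of_nonneg_left h4 hR.le
      have h11 := mul_nonneg hδ.le (Nat.cast_nonneg K : (0 : ℝ) ≤ K)
      linarith
    have h9 := (Nat.floor_le (by positivity : 0 ≤ R / 2 * (⌊(1 - δ) * n⌋₊ : ℝ))).trans (h7.trans h8)
    exact_mod_cast h9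

end QRes

/-! ### Rule O -/

theorem mainTheorem4 (α β : QRes.ResSeq) (hα : QRes.IsAsymptotic α) (hβ : QRes.IsAsymptotic β)
    (R : ℝ) (hR : 0 < R)
    (h : QRes.ResIneqDecoupled α β (QRes.ResSeq.scale R QRes.cbit)) :
    QRes.ResIneq α
      ((β.plus (QRes.ResSeq.scale (R / 2) QRes.ebit)).plus
        (QRes.ResSeq.scale (R / 2) QRes.qubit)) := by
  open QRes in
  intro δ hδ hδ'
  -- `K` is the number of rounds. A loss of `δ / 4` is allowed in each of three places: within a
  -- block, in joining the blocks of `β`, and in the rounds without teleportation.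
  obtain ⟨K, hK⟩ := exists_nat_ge (12 / δ)
  have hK : 12 ≤ K * δ := (div_le_iff₀ hδ).mp hK
  have hK' : (12 : ℝ) ≤ K := hK.trans (mul_le_of_le_one_right (Nat.cast_nonneg K) hδ'.le)
  have hK3 : 12 ≤ K := by exact_mod_cast hK'
  obtain ⟨k, hk, h⟩ := h.creates (δ := δ / 4) (by linarith) (by linarith)
  refine ⟨K * k, Nat.mul_pos (by omega) hk, fun ε hε => ?_⟩
  obtain ⟨x, hx, hx', hle⟩ := exists_pos_error K hε
  obtain ⟨N₁, hN₁⟩ := h x hx hx'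
  obtain ⟨N₂, hN₂⟩ := hβ.exists_cls_le
  obtain ⟨N₃, hN₃⟩ := hβ.quasi_iid (δ / 4) (by linarith) (by linarith) K (by omega)
  obtain ⟨N, hN⟩ := exists_block_estimates hR hδ hδ' hK (N₁ + N₂ + N₃)
  refine ⟨N, fun n hn => ?_⟩
  obtain ⟨h1, h2, h3, h4, h5⟩ := hN n hn
  have hC := hN₁ (n / K) (by omega)
  -- The quasi-i.i.d. property at the index `K * m₀`, `m₀` being the length in one block: `K` copies
  -- of `β` at `m₀` contain `β` at `(1 - δ / 4) * K * m₀`, which is beyond the required length.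
  have hβ' := (hN₃ _ (le_trans (by omega) h3)).2.flatten
  rw [cls_flatten_tpow, Nat.mul_div_cancel_left _ (by omega)] at hβ'
  have hβ'' := (hN₂ _ _ (le_trans (by omega) h2) h4).trans hβ'
  generalize ⌊(1 - δ / 4) * ((n / K : ℕ) : ℝ)⌋₊ = m₀ at *
  generalize ⌊R * (m₀ : ℝ)⌋₊ / 2 = r at *
  obtain ⟨s, hs, hle'⟩ := exists_creates_iterate (by positivity) hC (K - 3)
  -- The `K` rounds use `k` copies each at length `n / K / k = n / (K * k)`, hence in all the `K *
  -- k` copies of the definition.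
  rw [show K - 3 + 3 = K by omega, ← copies_mul, Nat.div_div_eq_div_mul] at hs
  refine (hs.mono hle).reduces (cls_le.mp (le_trans ?_ hle'))
  rw [show K - 3 + 3 = K by omega]
  change (flatten ((β ⌊(1 - δ) * n⌋₊ ++ [ebitRes.tpow ⌊R / 2 * ⌊(1 - δ) * n⌋₊⌋₊]) ++
    [qubitRes.tpow ⌊R / 2 * ⌊(1 - δ) * n⌋₊⌋₊])).cls ≤ _
  rw [cls_flatten_append, cls_flatten_append, cls_flatten [_], cls_flatten [_]]
  simp only [List.map_cons, List.map_nil, List.prod_cons, List.prod_nil, mul_one, cls_tpow]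
  rw [mul_right_comm]
  refine mul_le_mul' (mul_le_mul' hβ'' ?_) ?_
  · exact pow_le_pow_right' (one_le_resClass _) h5
  -- The initial entanglement is left over at the end, so there are even more ebits than qubits.
  · exact pow_le_pow_right' (one_le_resClass _) (h5.trans (Nat.mul_le_mul_right _ (by omega)))
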